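/- Let $k$ be a field. For a matroid $M$ on a finite set $S$, let $V(M)=k^S$ with basis $(e_s)_{s\in S}$, let $\overline V(M)=\{v\in V(M):\sum_{s} v_s=0\}$, and let $A(M)=\Lambda(V(M))/I(M)$ be the Orlik–Solomon algebra, where $\partial$ is the graded derivation of $\Lambda(V(M))$ with $\partial e_s=1$ for all $s$ and $I(M)$ is the ideal generated by the elements $\partial(e_C)$, for $C$ a circuit of $M$ and $e_C=\prod_{s\in C}e_s$. For $v\in V(M)$, right multiplication by $v$ makes $A(M)$ a cochain complex $(A(M),\cdot v)$, and for $p\ge 0$ the resonance variety is $$\mathcal R^p(M)=\{v\in V(M):\dim_k H^p(A(M),\cdot v)\ge 1\}.$$ Let $M_1,M_2$ be matroids on finite sets $S_1,S_2$ with $S_1\cap S_2=\{i\}$ and $M_1|_{\{i\}}=M_2|_{\{i\}}$ (that is, $i$ is a loop of both or of neither). Let $M_1\oplus M_2$ be the direct sum, on the disjoint union $S_1\sqcup S_2$, and let $M_1\oplus_{i}M_2$ be the parallel connection: the matroid on $S_1\cup S_2$ whose circuits are the circuits of $M_1$, the circuits of $M_2$, and the nonempty sets $(C_1\setminus\{i\})\cup(C_2\setminus\{i\})$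 with $C_j$ a circuit of $M_j$ containing $i$, for $j=1,2$. Let $\phi\colon V(M_1\oplus M_2)\to V(M_1\oplus_{i}M_2)$ be the linear map induced by the identification $S_1\sqcup S_2\to S_1\cup S_2$. Then $\phi$ restricts to a linear isomorphism $\overline\phi\colon\overline V(M_1)\oplus\overline V(M_2)\to\overline V(M_1\oplus_{i}M_2)$. For every $p\ge0$ one has $\mathcal R^p(M_1\oplus M_2)\subseteq\overline V(M_1)\oplus\overline V(M_2)$ and $\mathcal R^p(M_1\oplus_{i}M_2)\subseteq\overline V(M_1\oplus_{i}M_2)$, and, for every $p\ge 0$ with $p\neq\operatorname{rank}(M_1\oplus M_2)$, the map $\overline\phi$ restricts to a bijection, hence an isomorphism, $$\mathcal R^p(M_1\oplus M_2)\;\cong\;\mathcal R^p(M_1\oplus_{i}M_2).$$ -/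

import Mathlib

open Set
open scoped Matroid

/-! ### The Orlik-Solomon algebra of a matroid -/

section OrlikSolomon

variable (k : Type*) [Field k] {α : Type*} (M : Matroid α)

/-- The vector space `V(M) = k^S` on the ground set `S` of `M`; its distinguished basis is
`e_s = Finsupp.single s 1`. -/
abbrev VSpace : Type _ := M.E →₀ k

/-- The sum of the coordinates, `e_s ↦ 1`. -/
noncomputable def coordSum : VSpace k M →ₗ[k] k :=
  Finsupp.linearCombination k (fun _ : M.E => (1 : k))

/-- The hyperplane of the vectors of `V(M)` whose coordinates sum to zero. -/
noncomputable def VBar : Submodule k (VSpace k M) := LinearMap.ker (coordSum k M)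

/-- The graded derivation `∂` of the exterior algebra `Λ(V)` with `∂ e_s = 1` for all `s`:
the contraction `∂ (v ∧ x) = (∑ v_s) x - v ∧ ∂ x`. -/
noncomputable def extBoundary :
    ExteriorAlgebra k (VSpace k M) →ₗ[k] ExteriorAlgebra k (VSpace k M) :=
  CliffordAlgebra.contractLeft (Q := (0 : QuadraticForm k (VSpace k M))) (coordSum k M)

/-- The monomial `e_{s_1} ∧ ⋯ ∧ e_{s_r}` in `Λ(V)`. -/
noncomputable def extMonomial (l : List M.E) : ExteriorAlgebra k (VSpace k M) :=
  (l.map fun s => ExteriorAlgebra.ι k (Finsupp.single s (1 : k))).prod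

/-- The Orlik-Solomon ideal, generated by the elements `∂ e_C` for the circuits `C` of `M`. Each
circuit is enumerated in all possible orders; this changes `e_C` by a sign only, and so does not
change the ideal. -/
noncomputable def osIdeal : TwoSidedIdeal (ExteriorAlgebra k (VSpace k M)) :=
  TwoSidedIdeal.span {x | ∃ l : List M.E, l.Nodup ∧
    M.IsCircuit ((fun s : M.E => (s : α)) '' {s | s ∈ l}) ∧
    x = extBoundary k M (extMonomial k M l)}

/-- The Orlik-Solomon algebra `A(M) = Λ(V) / I(M)`. -/
abbrev OSAlgebra : Type _ := (osIdeal k M).ringCon.Quotient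

/-- The quotient map `Λ(V) → A(M)`. -/
noncomputable def osMk : ExteriorAlgebra k (VSpace k M) →ₐ[k] OSAlgebra k M :=
  RingCon.mkₐ k (osIdeal k M).ringCon

/-- The graded piece `A^p(M)`. -/
noncomputable def osGraded (p : ℕ) : Submodule k (OSAlgebra k M) :=
  (⋀[k]^p (VSpace k M)).map (osMk k M).toLinearMap

/-- Right multiplication by `v ∈ V(M)` on `A(M)`, the differential of the complex `(A(M), ·v)`. -/
noncomputable def osDiff (v : VSpace k M) : OSAlgebra k M →ₗ[k] OSAlgebra k M :=
  LinearMap.mulRight k (osMk k M (ExteriorAlgebra.ι k v))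

/-- The cocycles of degree `p` of the complex `(A(M), ·v)`. -/
noncomputable def osCocycles (p : ℕ) (v : VSpace k M) : Submodule k (OSAlgebra k M) :=
  osGraded k M p ⊓ LinearMap.ker (osDiff k M v)

/-- The coboundaries of degree `p` of the complex `(A(M), ·v)`. -/
noncomputable def osCoboundaries : ℕ → VSpace k M → Submodule k (OSAlgebra k M)
  | 0, _ => ⊥
  | p + 1, v => (osGraded k M p).map (osDiff k M v)

theorem osCoboundaries_le_osCocycles (p : ℕ) (v : VSpace k M) :
    osCoboundaries k M p v ≤ osCocycles k M p v := by
  cases p with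
  | zero => exact bot_le
  | succ p =>
    rintro _ ⟨_, ⟨x, hx, rfl⟩, rfl⟩
    refine ⟨⟨x * ExteriorAlgebra.ι k v, ?_, ?_⟩, ?_⟩
    · have h : (⋀[k]^(p + 1) (VSpace k M)) = (⋀[k]^p (VSpace k M)) *
          LinearMap.range (ExteriorAlgebra.ι k (M := VSpace k M)) := pow_succ _ _
      rw [h]
      exact Submodule.mul_mem_mul hx ⟨v, rfl⟩
    · simp [osDiff]
    · simp only [osDiff, SetLike.mem_coe, LinearMap.mem_ker, LinearMap.mulRight_apply, mul_assoc]
      rw [← map_mul, ExteriorAlgebra.ι_sq_zero, map_zero, mul_zero]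

/-- The cohomology `H^p(A(M), ·v)`. -/
abbrev OSCohomology (p : ℕ) (v : VSpace k M) : Type _ :=
  osCocycles k M p v ⧸ (osCoboundaries k M p v).submoduleOf (osCocycles k M p v)

/-- The resonance variety `R^p(M) = {v ∈ V(M) : dim H^p(A(M), ·v) ≥ 1}`. -/
noncomputable def resonance (p : ℕ) : Set (VSpace k M) :=
  {v | 1 ≤ Module.rank k (OSCohomology k M p v)}

end OrlikSolomon

/-! ### The parallel connection along a single element -/

section ParallelConnection

variable {α : Type*}

/-- The circuits of the parallel connection of `M₁` and `M₂` along `i`: those of `M₁`, those of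
`M₂`, and the sets `(C₁ - i) ∪ (C₂ - i)` with `C₁`, `C₂` circuits of `M₁`, `M₂` through `i`. (The
condition that the latter set be nonempty matters only if `i` is a loop.) -/
def IsPCCircuit (M₁ M₂ : Matroid α) (i : α) (C : Set α) : Prop :=
  M₁.IsCircuit C ∨ M₂.IsCircuit C ∨
    (C.Nonempty ∧ ∃ C₁ C₂ : Set α, M₁.IsCircuit C₁ ∧ M₂.IsCircuit C₂ ∧ i ∈ C₁ ∧ i ∈ C₂ ∧
      C = (C₁ \ {i}) ∪ (C₂ \ {i}))

/-- The independent sets of the parallel connection: the sets without a circuit. -/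
def PCIndep (M₁ M₂ : Matroid α) (i : α) (I : Set α) : Prop :=
  I ⊆ M₁.E ∪ M₂.E ∧ ∀ C, IsPCCircuit M₁ M₂ i C → ¬ C ⊆ I

theorem pcIndep_empty (M₁ M₂ : Matroid α) (i : α) : PCIndep M₁ M₂ i ∅ := by
  refine ⟨empty_subset _, fun C hC hC0 => ?_⟩
  obtain rfl := subset_empty_iff.1 hC0
  rcases hC with hC | hC | hC
  · exact M₁.empty_not_isCircuit hC
  · exact M₂.empty_not_isCircuit hC
  · exact not_nonempty_empty hC.1

theorem PCIndep.subset {M₁ M₂ : Matroid α} {i : α} {I J : Set α} (hJ : PCIndep M₁ M₂ i J)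
    (hIJ : I ⊆ J) : PCIndep M₁ M₂ i I :=
  ⟨hIJ.trans hJ.1, fun C hC hCI => hJ.2 C hC (hCI.trans hIJ)⟩

theorem PCIndep.left {M₁ M₂ : Matroid α} {i : α} {I : Set α} (h : PCIndep M₁ M₂ i I) :
    M₁.Indep (I ∩ M₁.E) :=
  Matroid.indep_iff_forall_subset_not_isCircuit'.2
    ⟨fun C hC hC1 => h.2 C (Or.inl hC1) (hC.trans inter_subset_left), inter_subset_right⟩

theorem PCIndep.right {M₁ M₂ : Matroid α} {i : α} {I : Set α} (h : PCIndep M₁ M₂ i I) :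
    M₂.Indep (I ∩ M₂.E) :=
  Matroid.indep_iff_forall_subset_not_isCircuit'.2
    ⟨fun C hC hC1 => h.2 C (Or.inr (Or.inl hC1)) (hC.trans inter_subset_left), inter_subset_right⟩

theorem isPCCircuit_comm {M₁ M₂ : Matroid α} {i : α} {C : Set α} (h : IsPCCircuit M₁ M₂ i C) :
    IsPCCircuit M₂ M₁ i C := by
  rcases h with h | h | ⟨h0, C₁, C₂, h1, h2, h3, h4, rfl⟩
  · exact Or.inr (Or.inl h)
  · exact Or.inl h
  · exact Or.inr (Or.inr ⟨h0, C₂, C₁, h2, h1, h4, h3, union_comm _ _⟩)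

theorem PCIndep.symm {M₁ M₂ : Matroid α} {i : α} {I : Set α} (h : PCIndep M₁ M₂ i I) :
    PCIndep M₂ M₁ i I :=
  ⟨by rw [union_comm]; exact h.1, fun C hC => h.2 C (isPCCircuit_comm hC)⟩

theorem pcIndep_of_left {M₁ M₂ : Matroid α} {i : α} {I : Set α} (hI : I ⊆ M₁.E ∪ M₂.E)
    (h1 : M₁.Indep (I ∩ M₁.E)) (h2 : M₂.Indep (insert i (I ∩ M₂.E))) : PCIndep M₁ M₂ i I := by
  refine ⟨hI, ?_⟩
  rintro C (hC | hC | ⟨-, C₁, C₂, -, hC₂, -, h4, rfl⟩) hCI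
  · exact hC.not_indep (h1.subset (subset_inter hCI hC.subset_ground))
  · exact hC.not_indep (h2.subset
      ((subset_inter hCI hC.subset_ground).trans (subset_insert _ _)))
  · refine hC₂.not_indep (h2.subset fun x hx => ?_)
    by_cases hxi : x = i
    · exact Or.inl hxi
    · exact Or.inr ⟨hCI (Or.inr ⟨hx, hxi⟩), hC₂.subset_ground hx⟩

theorem exists_isCircuit_of_insert {M : Matroid α} {i : α} {I : Set α} (hi : i ∈ M.E)
    (hI : M.Indep (I ∩ M.E)) (h : ¬ M.Indep (insert i (I ∩ M.E))) :
    ∃ C, M.IsCircuit C ∧ i ∈ C ∧ C \ {i} ⊆ I := by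
  have hd : M.Dep (insert i (I ∩ M.E)) := ⟨h, insert_subset hi inter_subset_right⟩
  obtain ⟨C, hC, hCc⟩ := hd.exists_isCircuit_subset
  refine ⟨C, hCc, ?_, fun x hx => ?_⟩
  · by_contra hiC
    exact hCc.not_indep (hI.subset ((subset_insert_iff_of_notMem hiC).1 hC))
  · rcases hC hx.1 with h | h
    · exact absurd h hx.2
    · exact h.1

theorem PCIndep.or_insert {M₁ M₂ : Matroid α} {i : α} {I : Set α} (h1 : M₁.IsNonloop i)
    (h2 : M₂.IsNonloop i) (h : PCIndep M₁ M₂ i I) :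
    M₁.Indep (insert i (I ∩ M₁.E)) ∨ M₂.Indep (insert i (I ∩ M₂.E)) := by
  by_contra! hc
  obtain ⟨C₁, hC₁, hi1, hs1⟩ := exists_isCircuit_of_insert h1.mem_ground h.left hc.1
  obtain ⟨C₂, hC₂, hi2, hs2⟩ := exists_isCircuit_of_insert h2.mem_ground h.right hc.2
  refine h.2 ((C₁ \ {i}) ∪ (C₂ \ {i})) (Or.inr (Or.inr ⟨?_, C₁, C₂, hC₁, hC₂, hi1, hi2, rfl⟩))
    (union_subset hs1 hs2)
  by_contra h0
  rw [not_nonempty_iff_eq_empty, union_empty_iff, sdiff_eq_empty] at h0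
  exact hC₁.not_indep (h1.indep.subset h0.1)

theorem pc_encard {E₁ E₂ : Set α} {i : α} (hE : E₁ ∩ E₂ = {i}) {I : Set α} (hI : I ⊆ E₁ ∪ E₂) :
    (I ∩ E₁).encard + (insert i (I ∩ E₂)).encard = I.encard + 1 := by
  have hi : i ∈ E₁ ∩ E₂ := by rw [hE]; rfl
  have hu : (I ∩ E₁) ∪ insert i (I ∩ E₂) = insert i I := by
    rw [union_insert, ← inter_union_distrib_left, inter_eq_self_of_subset_left hI]
  have hn : (I ∩ E₁) ∩ insert i (I ∩ E₂) = I ∩ {i} := by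
    ext x
    have hx : x ∈ E₁ ∧ x ∈ E₂ ↔ x = i := by
      rw [← mem_inter_iff, hE, mem_singleton_iff]
    simp only [mem_inter_iff, mem_insert_iff, mem_singleton_iff]
    tauto
  rw [← encard_union_add_encard_inter, hu, hn]
  by_cases h : i ∈ I
  · rw [insert_eq_of_mem h, inter_eq_self_of_subset_right (singleton_subset_iff.2 h),
      encard_singleton]
  · rw [inter_singleton_eq_empty.2 h, encard_empty, add_zero, encard_insert_of_notMem h]

theorem pc_step {M₁ M₂ : Matroid α} {i : α} (hE : M₁.E ∩ M₂.E = {i})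
    {I J A B : Set α} (hI : PCIndep M₁ M₂ i I) (hI2 : M₂.Indep (insert i (I ∩ M₂.E)))
    (hJE : J ⊆ M₁.E ∪ M₂.E) (hA : M₁.Indep A) (hB : M₂.Indep B)
    (hAJ : A ⊆ insert i J) (hBJ : B ⊆ insert i J)
    (hlt : I.encard + 1 < A.encard + B.encard) :
    (∃ e ∈ J, e ∉ I ∧ PCIndep M₁ M₂ i (insert e I)) ∨
      (i ∈ A ∧ i ∉ I ∧ M₁.Indep (insert i (I ∩ M₁.E))) := by
  have hi : i ∈ M₁.E ∩ M₂.E := by rw [hE]; rfl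
  have hx : ∀ x, x ∈ M₁.E → x ∈ M₂.E → x = i := fun x h1 h2 => by
    have : x ∈ M₁.E ∩ M₂.E := ⟨h1, h2⟩
    rwa [hE] at this
  rw [← pc_encard hE hI.1] at hlt
  by_cases h : (I ∩ M₁.E).encard < A.encard
  · obtain ⟨e, he, hei⟩ := hI.left.augment hA h
    have heE : e ∈ M₁.E := hA.subset_ground he.1
    have heI : e ∉ I := fun h => he.2 ⟨h, heE⟩
    by_cases hei' : e = i
    · subst hei'
      exact Or.inr ⟨he.1, heI, hei⟩
    · left
      have heJ : e ∈ J := (hAJ he.1).resolve_left hei'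
      refine ⟨e, heJ, heI, pcIndep_of_left (insert_subset (hJE heJ) hI.1) ?_ ?_⟩
      · rwa [insert_inter_of_mem heE]
      · rwa [insert_inter_of_notMem fun h => hei' (hx e heE h)]
  · have h' : (insert i (I ∩ M₂.E)).encard < B.encard := by
      by_contra hc
      exact absurd hlt (not_lt.2 (add_le_add (not_lt.1 h) (not_lt.1 hc)))
    obtain ⟨e, he, hei⟩ := hI2.augment hB h'
    have heE : e ∈ M₂.E := hB.subset_ground he.1
    have hei' : e ≠ i := fun h => he.2 (Or.inl h)
    have heI : e ∉ I := fun h => he.2 (Or.inr ⟨h, heE⟩)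
    have heJ : e ∈ J := (hBJ he.1).resolve_left hei'
    left
    refine ⟨e, heJ, heI, pcIndep_of_left (insert_subset (hJE heJ) hI.1) ?_ ?_⟩
    · rw [insert_inter_of_notMem fun h => hei' (hx e h heE)]
      exact hI.left
    · rwa [insert_inter_of_mem heE, insert_comm]

theorem pc_aug_left {M₁ M₂ : Matroid α} {i : α} (hE : M₁.E ∩ M₂.E = {i})
    (h1 : M₁.IsNonloop i) (h2 : M₂.IsNonloop i) {I J : Set α} (hI : PCIndep M₁ M₂ i I)
    (hJ : PCIndep M₁ M₂ i J) (hlt : I.encard + 1 < J.encard + 1)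
    (hI2 : M₂.Indep (insert i (I ∩ M₂.E))) :
    ∃ e ∈ J, e ∉ I ∧ PCIndep M₁ M₂ i (insert e I) := by
  have hi : i ∈ M₁.E ∩ M₂.E := by rw [hE]; rfl
  have hE' : M₂.E ∩ M₁.E = {i} := by rw [inter_comm, hE]
  have hins : ∀ X : Set α, insert i (J ∩ X) ⊆ insert i J := fun X =>
    insert_subset_insert inter_subset_left
  have hint : ∀ X : Set α, J ∩ X ⊆ insert i J := fun X =>
    inter_subset_left.trans (subset_insert _ _)
  by_cases hJ2 : M₂.Indep (insert i (J ∩ M₂.E))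
  · rcases pc_step hE hI hI2 hJ.1 hJ.left hJ2 (hint _) (hins _)
      (by rwa [pc_encard hE hJ.1]) with h | ⟨hiA, hiI, hI1⟩
    · exact h
    · refine ⟨i, hiA.1, hiI, pcIndep_of_left (insert_subset (Or.inl hi.1) hI.1) ?_ ?_⟩
      · rwa [insert_inter_of_mem hi.1]
      · rwa [insert_inter_of_mem hi.2, insert_idem]
  · have hJ1 := (hJ.or_insert h1 h2).resolve_right hJ2
    have hc : I.encard + 1 < (insert i (J ∩ M₁.E)).encard + (J ∩ M₂.E).encard := by
      rwa [add_comm (insert i (J ∩ M₁.E)).encard, pc_encard hE' hJ.symm.1]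
    rcases pc_step hE hI hI2 hJ.1 hJ1 hJ.right (hins _) (hint _) hc with h | ⟨-, -, hI1⟩
    · exact h
    · rcases pc_step hE' hI.symm hI1 hJ.symm.1 hJ.right hJ1 (hint _) (hins _)
        (by rwa [add_comm (J ∩ M₂.E).encard]) with ⟨e, heJ, heI, h⟩ | ⟨hiA, hiI, hI2'⟩
      · exact ⟨e, heJ, heI, h.symm⟩
      · refine ⟨i, hiA.1, hiI, pcIndep_of_left (insert_subset (Or.inl hi.1) hI.1) ?_ ?_⟩
        · rwa [insert_inter_of_mem hi.1]
        · rwa [insert_inter_of_mem hi.2, insert_idem]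

theorem pcIndep_iff_of_isLoop {M₁ M₂ : Matroid α} {i : α} (h1 : M₁.IsLoop i) (h2 : M₂.IsLoop i)
    {I : Set α} : PCIndep M₁ M₂ i I ↔
      I ⊆ M₁.E ∪ M₂.E ∧ M₁.Indep (I ∩ M₁.E) ∧ M₂.Indep (I ∩ M₂.E) := by
  refine ⟨fun h => ⟨h.1, h.left, h.right⟩, fun ⟨hI, hI1, hI2⟩ => ⟨hI, ?_⟩⟩
  rintro C (hC | hC | ⟨h0, C₁, C₂, hC₁, hC₂, h3, h4, rfl⟩) hCI
  · exact hC.not_indep (hI1.subset (subset_inter hCI hC.subset_ground))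
  · exact hC.not_indep (hI2.subset (subset_inter hCI hC.subset_ground))
  · have e1 := h1.eq_of_isCircuit_mem hC₁ h3
    have e2 := h2.eq_of_isCircuit_mem hC₂ h4
    simp [e1, e2] at h0

theorem pc_aug {M₁ M₂ : Matroid α} {i : α} (hE : M₁.E ∩ M₂.E = {i})
    (hr : M₁ ↾ {i} = M₂ ↾ {i}) {I J : Set α} (hI : PCIndep M₁ M₂ i I)
    (hJ : PCIndep M₁ M₂ i J) (hlt : I.encard + 1 < J.encard + 1) :
    ∃ e ∈ J, e ∉ I ∧ PCIndep M₁ M₂ i (insert e I) := by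
  have hi : i ∈ M₁.E ∩ M₂.E := by rw [hE]; rfl
  have hE' : M₂.E ∩ M₁.E = {i} := by rw [inter_comm, hE]
  have hiff : M₁.IsNonloop i ↔ M₂.IsNonloop i := by
    rw [← Matroid.indep_singleton, ← Matroid.indep_singleton]
    have := congrArg (fun M => Matroid.Indep M {i}) hr
    simpa using this
  by_cases h1 : M₁.IsNonloop i
  · have h2 := hiff.1 h1
    rcases hI.or_insert h1 h2 with hI1 | hI2
    · obtain ⟨e, heJ, heI, h⟩ := pc_aug_left hE' h2 h1 hI.symm hJ.symm hlt hI1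
      exact ⟨e, heJ, heI, h.symm⟩
    · exact pc_aug_left hE h1 h2 hI hJ hlt hI2
  · have h2 : M₂.IsLoop i := by
      rw [← Matroid.not_isNonloop_iff hi.2]
      exact fun h => h1 (hiff.2 h)
    rw [Matroid.not_isNonloop_iff hi.1] at h1
    have hni : ∀ {K : Set α}, PCIndep M₁ M₂ i K → i ∉ K := fun {K} hK hiK =>
      h1.not_indep_of_mem (show i ∈ K ∩ M₁.E from ⟨hiK, hi.1⟩) hK.left
    have hcard : ∀ {K : Set α}, PCIndep M₁ M₂ i K →
        (K ∩ M₁.E).encard + (K ∩ M₂.E).encard + 1 = K.encard + 1 := fun {K} hK => by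
      rw [← pc_encard hE hK.1, encard_insert_of_notMem fun h => hni hK h.1, add_assoc]
    have hx : ∀ x, x ∈ M₁.E → x ∈ M₂.E → x = i := fun x h1 h2 => by
      have : x ∈ M₁.E ∩ M₂.E := ⟨h1, h2⟩
      rwa [hE] at this
    rw [← hcard hI, ← hcard hJ] at hlt
    by_cases h : (I ∩ M₁.E).encard < (J ∩ M₁.E).encard
    · obtain ⟨e, he, hei⟩ := hI.left.augment hJ.left h
      refine ⟨e, he.1.1, fun h => he.2 ⟨h, he.1.2⟩, (pcIndep_iff_of_isLoop h1 h2).2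
        ⟨insert_subset (Or.inl he.1.2) hI.1, ?_, ?_⟩⟩
      · rwa [insert_inter_of_mem he.1.2]
      · rw [insert_inter_of_notMem fun h => hni hJ (hx e he.1.2 h ▸ he.1.1)]
        exact hI.right
    · have h' : (I ∩ M₂.E).encard < (J ∩ M₂.E).encard := by
        by_contra hc
        exact absurd hlt
          (not_lt.2 (add_le_add (add_le_add (not_lt.1 h) (not_lt.1 hc)) le_rfl))
      obtain ⟨e, he, hei⟩ := hI.right.augment hJ.right h'
      refine ⟨e, he.1.1, fun h => he.2 ⟨h, he.1.2⟩, (pcIndep_iff_of_isLoop h1 h2).2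
        ⟨insert_subset (Or.inr he.1.2) hI.1, ?_, ?_⟩⟩
      · rw [insert_inter_of_notMem fun h => hni hJ (hx e h he.1.2 ▸ he.1.1)]
        exact hI.left
      · rwa [insert_inter_of_mem he.1.2]

theorem isPCCircuit_antichain_left {M₁ M₂ : Matroid α} {i : α} (hE : M₁.E ∩ M₂.E = {i})
    (hiff : M₁.IsLoop i ↔ M₂.IsLoop i) {C D : Set α} (hC : M₁.IsCircuit C)
    (hD : IsPCCircuit M₁ M₂ i D) (hDC : D ⊆ C) : C ⊆ D := by
  have hx : ∀ x, x ∈ M₁.E → x ∈ M₂.E → x = i := fun x h1 h2 => by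
    have : x ∈ M₁.E ∩ M₂.E := ⟨h1, h2⟩
    rwa [hE] at this
  rcases hD with hD | hD | ⟨h0, C₁, C₂, hC₁, hC₂, h3, h4, rfl⟩
  · exact (hD.eq_of_subset_isCircuit hC hDC).ge
  · have hDi : D = {i} := hD.nonempty.subset_singleton_iff.1 fun x hxD =>
      hx x (hC.subset_ground (hDC hxD)) (hD.subset_ground hxD)
    subst hDi
    exact ((hiff.2 (Matroid.singleton_isCircuit.1 hD)).eq_of_isCircuit_mem hC (hDC rfl)).le
  · exfalso
    have h2 : C₂ = {i} := (nonempty_of_mem h4).subset_singleton_iff.1 fun x hxC => by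
      by_contra hxi
      exact hxi (hx x (hC.subset_ground (hDC (Or.inr ⟨hxC, hxi⟩))) (hC₂.subset_ground hxC))
    subst h2
    have h1 := (hiff.2 (Matroid.singleton_isCircuit.1 hC₂)).eq_of_isCircuit_mem hC₁ h3
    simp [h1] at h0

theorem isPCCircuit_antichain {M₁ M₂ : Matroid α} {i : α} (hE : M₁.E ∩ M₂.E = {i})
    (hiff : M₁.IsLoop i ↔ M₂.IsLoop i) {C D : Set α} (hC : IsPCCircuit M₁ M₂ i C)
    (hD : IsPCCircuit M₁ M₂ i D) (hDC : D ⊆ C) : C ⊆ D := by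
  have hE' : M₂.E ∩ M₁.E = {i} := by rw [inter_comm, hE]
  have hx : ∀ x, x ∈ M₁.E → x ∈ M₂.E → x = i := fun x h1 h2 => by
    have : x ∈ M₁.E ∩ M₂.E := ⟨h1, h2⟩
    rwa [hE] at this
  rcases hC with hC | hC | ⟨h0, C₁, C₂, hC₁, hC₂, h3, h4, rfl⟩
  · exact isPCCircuit_antichain_left hE hiff hC hD hDC
  · exact isPCCircuit_antichain_left hE' hiff.symm hC (isPCCircuit_comm hD) hDC
  · have hl : ∀ x, x ∈ M₁.E → x ∈ (C₁ \ {i}) ∪ (C₂ \ {i}) → x ∈ C₁ \ {i} := fun x hx1 hxC =>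
      hxC.elim id fun h => absurd (hx x hx1 (hC₂.subset_ground h.1)) h.2
    have hr : ∀ x, x ∈ M₂.E → x ∈ (C₁ \ {i}) ∪ (C₂ \ {i}) → x ∈ C₂ \ {i} := fun x hx2 hxC =>
      hxC.elim (fun h => absurd (hx x (hC₁.subset_ground h.1) hx2) h.2) id
    rcases hD with hD | hD | ⟨-, D₁, D₂, hD₁, hD₂, h3', h4', rfl⟩
    · exact absurd ((hC₁.sdiff_singleton_indep h3).subset fun x hxD =>
        hl x (hD.subset_ground hxD) (hDC hxD)) hD.not_indep
    · exact absurd ((hC₂.sdiff_singleton_indep h4).subset fun x hxD =>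
        hr x (hD.subset_ground hxD) (hDC hxD)) hD.not_indep
    · have e1 : D₁ = C₁ := hD₁.eq_of_subset_isCircuit hC₁ fun x hxD => by
        by_cases hxi : x = i
        · rwa [hxi]
        · exact (hl x (hD₁.subset_ground hxD) (hDC (Or.inl ⟨hxD, hxi⟩))).1
      have e2 : D₂ = C₂ := hD₂.eq_of_subset_isCircuit hC₂ fun x hxD => by
        by_cases hxi : x = i
        · rwa [hxi]
        · exact (hr x (hD₂.subset_ground hxD) (hDC (Or.inr ⟨hxD, hxi⟩))).1
      rw [e1, e2]

theorem pc_isLoop_iff {M₁ M₂ : Matroid α} {i : α} (hE : M₁.E ∩ M₂.E = {i})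
    (hr : M₁ ↾ {i} = M₂ ↾ {i}) : M₁.IsLoop i ↔ M₂.IsLoop i := by
  have hi : i ∈ M₁.E ∩ M₂.E := by rw [hE]; rfl
  rw [← Matroid.singleton_not_indep hi.1, ← Matroid.singleton_not_indep hi.2]
  have := congrArg (fun M => ¬ Matroid.Indep M {i}) hr
  simpa using this

/-- The parallel connection of two finite matroids whose ground sets meet in the single element `i`
and which agree on `{i}`: the matroid on the union of the ground sets whose independent sets are
the sets that contain no member of `IsPCCircuit M₁ M₂ i`. -/
def parallelConnection (M₁ M₂ : Matroid α) [M₁.Finite] [M₂.Finite] (i : α)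
    (hE : M₁.E ∩ M₂.E = {i}) (hr : M₁ ↾ {i} = M₂ ↾ {i}) : Matroid α :=
  (IndepMatroid.ofFinite (E := M₁.E ∪ M₂.E) (M₁.ground_finite.union M₂.ground_finite)
    (PCIndep M₁ M₂ i) (pcIndep_empty M₁ M₂ i) (fun _ _ hJ hIJ => hJ.subset hIJ)
    (fun I J hI hJ hlt => pc_aug hE hr hI hJ (by
      have hf := M₁.ground_finite.union M₂.ground_finite
      rw [← (hf.subset hI.1).cast_ncard_eq, ← (hf.subset hJ.1).cast_ncard_eq]
      exact_mod_cast Nat.succ_lt_succ hlt))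
    (fun _ hI => hI.1)).matroid

/-- The circuits of the parallel connection are the sets `IsPCCircuit M₁ M₂ i`. -/
theorem parallelConnection_isCircuit_iff (M₁ M₂ : Matroid α) [M₁.Finite] [M₂.Finite] (i : α)
    (hE : M₁.E ∩ M₂.E = {i}) (hr : M₁ ↾ {i} = M₂ ↾ {i}) (C : Set α) :
    (parallelConnection M₁ M₂ i hE hr).IsCircuit C ↔ IsPCCircuit M₁ M₂ i C := by
  have hloop := pc_isLoop_iff hE hr
  have hsub : ∀ D, IsPCCircuit M₁ M₂ i D → D ⊆ M₁.E ∪ M₂.E := by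
    rintro D (hD | hD | ⟨-, C₁, C₂, hC₁, hC₂, -, -, rfl⟩)
    · exact hD.subset_ground.trans subset_union_left
    · exact hD.subset_ground.trans subset_union_right
    · exact union_subset_union (sdiff_subset.trans hC₁.subset_ground)
        (sdiff_subset.trans hC₂.subset_ground)
  have hdep : ∀ D, (parallelConnection M₁ M₂ i hE hr).Dep D ↔
      D ⊆ M₁.E ∪ M₂.E ∧ ∃ C, IsPCCircuit M₁ M₂ i C ∧ C ⊆ D := fun D => by
    change (¬ PCIndep M₁ M₂ i D ∧ D ⊆ M₁.E ∪ M₂.E) ↔ _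
    unfold PCIndep
    push Not
    tauto
  rw [Matroid.isCircuit_iff, hdep]
  constructor
  · rintro ⟨⟨hC, D, hD, hDC⟩, hmin⟩
    rwa [← hmin ((hdep D).2 ⟨hsub D hD, D, hD, Subset.rfl⟩) hDC]
  · refine fun hC => ⟨⟨hsub C hC, C, hC, Subset.rfl⟩, fun D hD hDC => hDC.antisymm ?_⟩
    obtain ⟨-, D', hD', hDD⟩ := (hdep D).1 hD
    exact (isPCCircuit_antichain hE hloop hC hD' (hDD.trans hDC)).trans hDD

end ParallelConnection

/-! ### The natural map `V(M₁ ⊕ M₂) → V(M)`, with `M` the parallel connection -/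

section NaturalMap

variable (k : Type*) [Field k] {α : Type*} (M₁ M₂ : Matroid α)

/-- The subspace `V̄(M₁) ⊕ V̄(M₂)` of `V(M₁ ⊕ M₂)`, where the ground set of `M₁ ⊕ M₂` is the disjoint
union of the ground sets. -/
noncomputable def VBarSum : Submodule k (VSpace k (M₁.sum M₂)) :=
  (VBar k M₁).map (Finsupp.lmapDomain k k
      (fun s : M₁.E => (⟨Sum.inl s, by simp⟩ : (M₁.sum M₂).E))) ⊔
    (VBar k M₂).map (Finsupp.lmapDomain k k
      (fun s : M₂.E => (⟨Sum.inr s, by simp⟩ : (M₁.sum M₂).E)))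

variable [M₁.Finite] [M₂.Finite] (i : α) (hE : M₁.E ∩ M₂.E = {i}) (hr : M₁ ↾ {i} = M₂ ↾ {i})

/-- The map of ground sets which identifies the two copies of `i`. -/
def pcIdent (s : (M₁.sum M₂).E) : (parallelConnection M₁ M₂ i hE hr).E :=
  ⟨Sum.elim id id s.1, by
    obtain ⟨s | s, hs⟩ := s
    · exact Or.inl (by simpa using hs)
    · exact Or.inr (by simpa using hs)⟩

/-- The linear map `φ : V(M₁ ⊕ M₂) → V(M)` which sends `e_s` to `e_{φ(s)}`. -/
noncomputable def pcMap :
    VSpace k (M₁.sum M₂) →ₗ[k] VSpace k (parallelConnection M₁ M₂ i hE hr) :=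
  Finsupp.lmapDomain k k (pcIdent M₁ M₂ i hE hr)

end NaturalMap

/-! Write A for A(M₁ ⊕ M₂), P for the parallel connection and d = e_i − e_{i'} for the difference of
the two copies of e_i (`ptDiff`). If i is a loop, both algebras vanish. In general every circuit of
the direct sum lies on one side, so the contraction ∂' with e_s ↦ 1 on S₁ and e_s ↦ 0 on S₂ descends
to A. Since ∂'d = 1, an element killed by d is a multiple of d. Moreover A(P) = A/dA, which gives an
exact sequence 0 → A(P)[-1] → A → A(P) → 0 of complexes for multiplication by φ(v) and v, the first
map being multiplication by d. If v has coordinate sum zero on S₁, then ∂' commutes with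
multiplication by v and x ↦ ∂'(dx) splits the sequence. Hence H^p(A, v) vanishes if and only if H^p
and H^{p-1} of (A(P), φ(v)) both do (`osExact_pcMap`, `osExact_of_pcMap`).

It remains to drop H^{p-1}, and this is propagation (`osExact_of_osExact_succ`): for p at most the
rank, vanishing of H^p at a point forces vanishing of H^{p-1} there. For i not a loop, the rank of
M₁ ⊕ M₂ is rank P + 1. If p exceeds rank P and is not rank P + 1, then A(P) is zero in degrees p and
p − 1. This is why a single p is excluded.

Propagation rests on the universal complex, with power series in variables x_s as coefficients and Ω
= ∑ x_s e_s as differential. It is exact in all degrees below the rank (`universallyExact`), by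
deletion and contraction along 0 → A(N \ t) → A(N) → A(N / t)[-1] → 0, whose last map is contraction
against e_t. The delicate point of that sequence is injectivity on the left (`mem_osRel_delete`),
proved flat by flat. Then a degree p cocycle at v extends to a universal cocycle as soon as H^{p+1}
vanishes at v; it is a universal coboundary, and evaluation at v finishes
(`exists_eq_mul_of_universallyExact`).

The inclusions of the resonance varieties in the hyperplanes come from `osExact_of_bd`: a
contraction that preserves the ideal and is nonzero on v makes the complex contractible.

Computations take place on representatives in one exterior algebra shared by a matroid and its
minors, modulo the subspaces `osRel`. Throughout, the index q of `extDeg` and `osRel` stands for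
degree q − 1. -/

/-! ### Monomials and contractions in the exterior algebra of a free module -/

section ExteriorMonomials

variable (k : Type*) [Field k] {X Y : Type*}

/-- The exterior algebra of the vector space with basis `X`. -/
abbrev ExtAlg (X : Type*) : Type _ := ExteriorAlgebra k (X →₀ k)

/-- The generator `e_s`. -/
noncomputable def gen (s : X) : ExtAlg k X := ExteriorAlgebra.ι k (Finsupp.single s (1 : k))

/-- The monomial `e_{s_1} ⋯ e_{s_r}`. -/
noncomputable def mon (l : List X) : ExtAlg k X := (l.map (gen k)).prod

variable {k} in
/-- The antiderivation which sends `e_s` to `f s`. -/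
noncomputable def bd (f : X → k) : ExtAlg k X →ₗ[k] ExtAlg k X :=
  CliffordAlgebra.contractLeft (Q := (0 : QuadraticForm k (X →₀ k))) (Finsupp.linearCombination k f)

@[simp] theorem mon_nil : mon k ([] : List X) = 1 := by simp [mon]

@[simp] theorem mon_cons (s : X) (l : List X) : mon k (s :: l) = gen k s * mon k l := by simp [mon]

@[simp] theorem mon_append (l m : List X) : mon k (l ++ m) = mon k l * mon k m := by simp [mon]

theorem mon_singleton (s : X) : mon k [s] = gen k s := by simp

theorem gen_mul_gen (s t : X) : gen k s * gen k t = - (gen k t * gen k s) :=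
  eq_neg_of_add_eq_zero_left (ExteriorAlgebra.ι_add_mul_swap _ _)

@[simp] theorem gen_mul_self (s : X) : gen k s * gen k s = 0 := ExteriorAlgebra.ι_sq_zero _

@[simp] theorem gen_mul_gen_mul_self (s : X) (x : ExtAlg k X) : gen k s * (gen k s * x) = 0 := by
  rw [← mul_assoc, gen_mul_self, zero_mul]

theorem ι_eq_sum [Fintype X] (v : X →₀ k) :
    ExteriorAlgebra.ι k v = ∑ s, v s • gen k s := by
  conv_lhs => rw [← Finsupp.univ_sum_single v]
  rw [map_sum]
  refine Finset.sum_congr rfl fun s _ => ?_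
  rw [gen, ← map_smul, Finsupp.smul_single, smul_eq_mul, mul_one]

theorem mon_perm {l m : List X} (h : l.Perm m) : mon k l = mon k m ∨ mon k l = - mon k m := by
  induction h with
  | nil => exact Or.inl rfl
  | cons s _ ih => rcases ih with h | h <;> simp [h]
  | swap s t l =>
    right
    rw [mon_cons, mon_cons, mon_cons, mon_cons, ← mul_assoc, ← mul_assoc, gen_mul_gen, neg_mul]
  | trans _ _ h1 h2 => rcases h1 with h1 | h1 <;> rcases h2 with h2 | h2 <;> simp [h1, h2]

theorem exists_perm_cons_of_mem {t : X} {l : List X} (h : t ∈ l) :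
    ∃ m, l.Perm (t :: m) := by
  classical
  exact ⟨_, List.perm_cons_erase h⟩

theorem mon_eq_zero {l : List X} (h : ¬ l.Nodup) : mon k l = 0 := by
  induction l with
  | nil => simp at h
  | cons s l ih =>
    by_cases hs : s ∈ l
    · obtain ⟨m, hm⟩ := exists_perm_cons_of_mem hs
      rcases mon_perm k hm with h | h <;> simp [h]
    · rw [mon_cons, ih fun h' => h (List.nodup_cons.2 ⟨hs, h'⟩), mul_zero]

theorem gen_mul_mon_of_mem {t : X} {l : List X} (h : t ∈ l) : gen k t * mon k l = 0 := by
  rw [← mon_cons]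
  exact mon_eq_zero k fun h' => (List.nodup_cons.1 h').1 h

variable {k} {f g : X → k}

@[simp] theorem bd_one : bd f (1 : ExtAlg k X) = 0 := CliffordAlgebra.contractLeft_one ..

theorem bd_ι_mul (v : X →₀ k) (x : ExtAlg k X) : bd f (ExteriorAlgebra.ι k v * x) =
    Finsupp.linearCombination k f v • x - ExteriorAlgebra.ι k v * bd f x :=
  CliffordAlgebra.contractLeft_ι_mul (Q := (0 : QuadraticForm k (X →₀ k))) ..

theorem bd_gen_mul (s : X) (x : ExtAlg k X) :
    bd f (gen k s * x) = f s • x - gen k s * bd f x := by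
  rw [gen, bd_ι_mul]; simp

theorem bd_bd (x : ExtAlg k X) : bd f (bd f x) = 0 :=
  CliffordAlgebra.contractLeft_contractLeft (Q := (0 : QuadraticForm k (X →₀ k))) ..

theorem bd_comm (x : ExtAlg k X) : bd f (bd g x) = - bd g (bd f x) :=
  CliffordAlgebra.contractLeft_comm (Q := (0 : QuadraticForm k (X →₀ k))) ..

theorem bd_add (x : ExtAlg k X) : bd (f + g) x = bd f x + bd g x := by
  have : Finsupp.linearCombination k (f + g) =
      Finsupp.linearCombination k f + Finsupp.linearCombination k g := by ext; simp
  rw [bd, this, map_add]; rfl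

theorem bd_gen (s : X) : bd f (gen k s) = algebraMap k _ (f s) := by
  have := bd_gen_mul (f := f) s (1 : ExtAlg k X)
  rwa [mul_one, bd_one, mul_zero, sub_zero, ← Algebra.algebraMap_eq_smul_one] at this

theorem bd_mon_congr {l : List X} (h : ∀ s ∈ l, f s = g s) : bd f (mon k l) = bd g (mon k l) := by
  induction l with
  | nil => simp
  | cons s l ih =>
    rw [mon_cons, bd_gen_mul, bd_gen_mul, ih fun t ht => h t (List.mem_cons_of_mem _ ht),
      h s List.mem_cons_self]

theorem bd_mon_eq_zero {l : List X} (h : ∀ s ∈ l, f s = 0) : bd f (mon k l) = 0 := by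
  rw [bd_mon_congr (g := 0) h, bd]
  have : Finsupp.linearCombination k (0 : X → k) = 0 := by ext; simp
  rw [this, map_zero]; rfl

theorem contractLeft_map {V W : Type*} [AddCommGroup V] [Module k V] [AddCommGroup W] [Module k W]
    (T : V →ₗ[k] W) (d : Module.Dual k W) (x : ExteriorAlgebra k V) :
    CliffordAlgebra.contractLeft (Q := (0 : QuadraticForm k W)) d (ExteriorAlgebra.map T x) =
      ExteriorAlgebra.map T
        (CliffordAlgebra.contractLeft (Q := (0 : QuadraticForm k V)) (d ∘ₗ T) x) := by
  induction x using CliffordAlgebra.left_induction with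
  | algebraMap r => simp
  | add x y hx hy => rw [map_add, map_add, hx, hy, map_add, map_add]
  | ι_mul x v hx =>
    rw [CliffordAlgebra.contractLeft_ι_mul]
    erw [map_mul, ExteriorAlgebra.map_apply_ι, CliffordAlgebra.contractLeft_ι_mul, hx, map_sub,
      map_mul, map_smul, ExteriorAlgebra.map_apply_ι]
    rfl

variable (k) in
/-- The homomorphism of exterior algebras with `e_s ↦ h s`. -/
noncomputable def extHom (h : X → (Y →₀ k)) : ExtAlg k X →ₐ[k] ExtAlg k Y :=
  ExteriorAlgebra.map (Finsupp.linearCombination k h)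

theorem extHom_gen (h : X → (Y →₀ k)) (s : X) :
    extHom k h (gen k s) = ExteriorAlgebra.ι k (h s) := by
  rw [extHom, gen, ExteriorAlgebra.map_apply_ι]; simp

theorem bd_extHom (h : X → (Y →₀ k)) (f : Y → k) (x : ExtAlg k X) : bd f (extHom k h x) =
    extHom k h (bd (fun s => Finsupp.linearCombination k f (h s)) x) := by
  rw [bd, extHom, contractLeft_map, bd]
  congr 3
  ext; simp

theorem extHom_mon {h : X → (Y →₀ k)} {j : X → Y} {l : List X}
    (hl : ∀ s ∈ l, h s = Finsupp.single (j s) 1) : extHom k h (mon k l) = mon k (l.map j) := by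
  induction l with
  | nil => simp
  | cons s l ih =>
    rw [mon_cons, map_mul, extHom_gen, hl s List.mem_cons_self,
      ih fun t ht => hl t (List.mem_cons_of_mem _ ht), List.map_cons, mon_cons]
    rfl

theorem extHom_mon_eq_zero {h : X → (Y →₀ k)} {s : X} {l : List X} (hs : s ∈ l) (h0 : h s = 0) :
    extHom k h (mon k l) = 0 := by
  obtain ⟨m, hm⟩ := exists_perm_cons_of_mem hs
  rcases mon_perm k hm with h | h <;> simp [h, extHom_gen, h0]

variable (k) in
/-- The span of the monomials of degree `q - 1` in the generators from `Z`; the shift of the degree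
makes room for a zero space in front of the constants. -/
noncomputable def extDeg (Z : Set X) (q : ℕ) : Submodule k (ExtAlg k X) :=
  Submodule.span k {x | ∃ l : List X, (∀ s ∈ l, s ∈ Z) ∧ l.length + 1 = q ∧ x = mon k l}

theorem mon_mem_extDeg {Z : Set X} {l : List X} (hl : ∀ s ∈ l, s ∈ Z) :
    mon k l ∈ extDeg k Z (l.length + 1) := Submodule.subset_span ⟨l, hl, rfl, rfl⟩

theorem extDeg_mono {Z Z' : Set X} (h : Z ⊆ Z') (q : ℕ) : extDeg k Z q ≤ extDeg k Z' q :=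
  Submodule.span_mono fun _ ⟨l, h1, h2, h3⟩ => ⟨l, fun s hs => h (h1 s hs), h2, h3⟩

theorem extDeg_zero (Z : Set X) : extDeg k Z 0 = ⊥ := by
  rw [extDeg, Submodule.span_eq_bot]
  rintro x ⟨l, -, h, -⟩
  omega

theorem extDeg_le {Z : Set X} {q : ℕ} {P : Submodule k (ExtAlg k X)}
    (h : ∀ l : List X, (∀ s ∈ l, s ∈ Z) → l.length + 1 = q → mon k l ∈ P) : extDeg k Z q ≤ P :=
  Submodule.span_le.2 fun _ ⟨l, h1, h2, h3⟩ => h3 ▸ h l h1 h2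

theorem gen_mul_mem_extDeg {Z : Set X} {q : ℕ} {x : ExtAlg k X} {s : X} (hs : s ∈ Z)
    (hx : x ∈ extDeg k Z q) : gen k s * x ∈ extDeg k Z (q + 1) := by
  revert x
  change extDeg k Z q ≤ (extDeg k Z (q + 1)).comap (LinearMap.mulLeft k (gen k s))
  refine extDeg_le fun l hl hq => ?_
  rw [Submodule.mem_comap, LinearMap.mulLeft_apply, ← mon_cons]
  exact Submodule.subset_span ⟨s :: l, by simpa [hs] using hl, by simp [hq], rfl⟩

theorem mul_gen_mem_extDeg {Z : Set X} {q : ℕ} {x : ExtAlg k X} {s : X} (hs : s ∈ Z)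
    (hx : x ∈ extDeg k Z q) : x * gen k s ∈ extDeg k Z (q + 1) := by
  revert x
  change extDeg k Z q ≤ (extDeg k Z (q + 1)).comap (LinearMap.mulRight k (gen k s))
  refine extDeg_le fun l hl hq => ?_
  rw [Submodule.mem_comap, LinearMap.mulRight_apply, ← mon_singleton, ← mon_append]
  exact Submodule.subset_span ⟨l ++ [s], by
    simp only [List.mem_append, List.mem_singleton]; rintro t (h | rfl); exacts [hl t h, hs],
    by simp [hq], rfl⟩

theorem mon_mul_gen (l : List X) (s : X) :
    mon k l * gen k s = (-1 : k) ^ l.length • (gen k s * mon k l) := by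
  induction l with
  | nil => simp
  | cons t l ih =>
    rw [mon_cons, mul_assoc, ih, mul_smul_comm, ← mul_assoc, gen_mul_gen, ← mul_assoc,
      List.length_cons, pow_succ, neg_mul, smul_neg, mul_neg_one, neg_smul]

theorem mul_gen_eq {q : ℕ} {x : ExtAlg k X} (hx : x ∈ extDeg k univ (q + 1)) (s : X) :
    x * gen k s = (-1 : k) ^ q • (gen k s * x) := by
  suffices extDeg k univ (q + 1) ≤ LinearMap.eqLocus (LinearMap.mulRight k (gen k s))
      ((-1 : k) ^ q • LinearMap.mulLeft k (gen k s)) from this hx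
  refine extDeg_le fun l _ hl => ?_
  obtain rfl : l.length = q := by omega
  exact mon_mul_gen l s

theorem bd_mon_mul_gen (l : List X) (s : X) : bd f (mon k l * gen k s) =
    bd f (mon k l) * gen k s + ((-1 : k) ^ l.length * f s) • mon k l := by
  induction l with
  | nil => simp [bd_gen, Algebra.algebraMap_eq_smul_one]
  | cons t l ih =>
    rw [mon_cons, mul_assoc, bd_gen_mul, ih, bd_gen_mul, List.length_cons, pow_succ, sub_mul,
      mul_add, mul_assoc, smul_mul_assoc, mul_smul_comm, mul_neg_one, neg_mul, neg_smul]
    abel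

theorem bd_mul_gen {q : ℕ} {x : ExtAlg k X} (hx : x ∈ extDeg k univ (q + 1)) (s : X) :
    bd f (x * gen k s) = bd f x * gen k s + ((-1 : k) ^ q * f s) • x := by
  suffices extDeg k univ (q + 1) ≤ LinearMap.eqLocus (bd f ∘ₗ LinearMap.mulRight k (gen k s))
      (LinearMap.mulRight k (gen k s) ∘ₗ bd f + ((-1 : k) ^ q * f s) • LinearMap.id) from this hx
  refine extDeg_le fun l _ hl => ?_
  obtain rfl : l.length = q := by omega
  exact bd_mon_mul_gen l s

theorem bd_mon_mem {Z : Set X} {l : List X} (hl : ∀ s ∈ l, s ∈ Z) :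
    bd f (mon k l) ∈ extDeg k Z l.length := by
  induction l with
  | nil => simp
  | cons s l ih =>
    rw [mon_cons, bd_gen_mul]
    refine sub_mem (Submodule.smul_mem _ _ (mon_mem_extDeg fun t ht => hl t
      (List.mem_cons_of_mem _ ht))) (gen_mul_mem_extDeg (hl s List.mem_cons_self)
        (ih fun t ht => hl t (List.mem_cons_of_mem _ ht)))

theorem bd_mem_extDeg {Z : Set X} {q : ℕ} {x : ExtAlg k X} (hx : x ∈ extDeg k Z (q + 1)) :
    bd f x ∈ extDeg k Z q := by
  suffices extDeg k Z (q + 1) ≤ (extDeg k Z q).comap (bd f) from this hx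
  refine extDeg_le fun l hl h => ?_
  obtain rfl : l.length = q := by omega
  exact bd_mon_mem hl

theorem bd_eq_of_mem_extDeg {Z : Set X} (hZ : ∀ s ∈ Z, f s = g s) {q : ℕ} {x : ExtAlg k X}
    (hx : x ∈ extDeg k Z q) : bd f x = bd g x := by
  suffices extDeg k Z q ≤ LinearMap.eqLocus (bd f) (bd g) from this hx
  exact extDeg_le fun l hl _ => bd_mon_congr fun s hs => hZ s (hl s hs)

theorem exterior_induction {P : Submodule k (ExtAlg k X)} (h : ∀ l : List X, mon k l ∈ P)
    (x : ExtAlg k X) : x ∈ P := by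
  suffices Submodule.span k (range (mon k (X := X))) = ⊤ by
    have hx : x ∈ Submodule.span k (range (mon k (X := X))) := this ▸ Submodule.mem_top
    exact Submodule.span_le.2 (by rintro _ ⟨l, rfl⟩; exact h l) hx
  rw [eq_top_iff]
  rintro x -
  induction x using CliffordAlgebra.left_induction with
  | algebraMap r =>
    rw [Algebra.algebraMap_eq_smul_one, ← mon_nil]
    exact Submodule.smul_mem _ _ (Submodule.subset_span ⟨_, rfl⟩)
  | add x y hx hy => exact add_mem hx hy
  | ι_mul x v hx =>
    have key : ∀ s, ∀ y ∈ Submodule.span k (range (mon k (X := X))),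
        gen k s * y ∈ Submodule.span k (range (mon k (X := X))) := by
      intro s y hy
      refine Submodule.span_induction (p := fun y _ => gen k s * y ∈ _) ?_ ?_ ?_ ?_ hy
      · rintro _ ⟨l, rfl⟩
        exact Submodule.subset_span ⟨s :: l, by simp⟩
      · simp
      · intro a b _ _ ha hb; rw [mul_add]; exact add_mem ha hb
      · intro a b _ hb; rw [mul_smul_comm]; exact Submodule.smul_mem _ _ hb
    induction v using Finsupp.induction_linear with
    | zero => erw [map_zero, zero_mul]; exact zero_mem _
    | add a b ha hb => erw [map_add, add_mul]; exact add_mem ha hb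
    | single s c =>
      have : CliffordAlgebra.ι (0 : QuadraticForm k (X →₀ k)) (Finsupp.single s c) =
          c • gen k s := by
        rw [gen, ExteriorAlgebra.ι, ← map_smul, Finsupp.smul_single, smul_eq_mul, mul_one]
      rw [this, smul_mul_assoc]
      exact Submodule.smul_mem _ _ (key s x hx)

theorem extDeg_univ_eq (p : ℕ) : extDeg k (univ : Set X) (p + 1) = ⋀[k]^p (X →₀ k) := by
  induction p with
  | zero =>
    refine le_antisymm (extDeg_le fun l _ hl => ?_) ?_
    · obtain rfl : l = [] := List.length_eq_zero_iff.1 (by omega)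
      simp
    · simp only [pow_zero, Submodule.one_eq_span, Submodule.span_singleton_le_iff_mem]
      exact Submodule.subset_span ⟨[], by simp⟩
  | succ p ih =>
    have hs : (⋀[k]^(p + 1) (X →₀ k)) = LinearMap.range (ExteriorAlgebra.ι k (M := X →₀ k)) *
        (⋀[k]^p (X →₀ k)) := pow_succ' _ _
    rw [hs, ← ih]
    refine le_antisymm (extDeg_le fun l _ hl => ?_) ?_
    · match l, hl with
      | s :: l, hl =>
        rw [mon_cons]
        refine Submodule.mul_mem_mul ⟨_, rfl⟩ (Submodule.subset_span ⟨l, by simp, ?_, rfl⟩)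
        simpa using hl
    · rw [Submodule.mul_le]
      rintro _ ⟨v, rfl⟩ y hy
      induction v using Finsupp.induction_linear with
      | zero => rw [map_zero, zero_mul]; exact zero_mem _
      | add a b ha hb => rw [map_add, add_mul]; exact add_mem ha hb
      | single s c =>
        have : ExteriorAlgebra.ι k (Finsupp.single s c) = c • gen k s := by
          rw [gen, ← map_smul, Finsupp.smul_single, smul_eq_mul, mul_one]
        rw [this, smul_mul_assoc]
        exact Submodule.smul_mem _ _ (gen_mul_mem_extDeg (mem_univ s) hy)

/-- Every element is `a + e_t b` with `a` and `b` free of `e_t`. -/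
theorem exists_eq_add_gen_mul (t : X) {q : ℕ} {x : ExtAlg k X} (hx : x ∈ extDeg k univ q) :
    ∃ a ∈ extDeg k {t}ᶜ q, ∃ b ∈ extDeg k {t}ᶜ (q - 1), x = a + gen k t * b := by
  let P : Submodule k (ExtAlg k X) := extDeg k {t}ᶜ q ⊔
    (extDeg k {t}ᶜ (q - 1)).map (LinearMap.mulLeft k (gen k t))
  suffices extDeg k univ q ≤ P by
    obtain ⟨a, ha, _, ⟨b, hb, rfl⟩, h⟩ := Submodule.mem_sup.1 (this hx)
    exact ⟨a, ha, b, hb, h.symm⟩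
  refine extDeg_le fun l _ hl => ?_
  by_cases ht : t ∈ l
  · obtain ⟨m, hm⟩ := exists_perm_cons_of_mem ht
    suffices mon k (t :: m) ∈ P by
      rcases mon_perm k hm with h | h <;> rw [h]
      · exact this
      · exact neg_mem this
    by_cases htm : t ∈ m
    · rw [mon_cons, gen_mul_mon_of_mem k htm]; exact zero_mem _
    · refine Submodule.mem_sup_right ⟨mon k m, ?_, by simp⟩
      refine Submodule.subset_span ⟨m, fun s hs => ?_, ?_, rfl⟩
      · rintro rfl; exact htm hs
      · have := hm.length_eq
        simp only [List.length_cons] at this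
        omega
  · refine Submodule.mem_sup_left (Submodule.subset_span ⟨l, fun s hs => ?_, hl, rfl⟩)
    rintro rfl; exact ht hs

end ExteriorMonomials

/-! ### The relations of the Orlik-Solomon algebra, degree by degree -/

section Relations

variable (k : Type*) [Field k] {X : Type*}

/-- The indicator function of a set of generators. -/
noncomputable def wt (Z : Set X) : X → k := Z.indicator 1

variable {k}

theorem wt_of_mem {Z : Set X} {s : X} (h : s ∈ Z) : wt k Z s = 1 := by simp [wt, h]

theorem wt_of_notMem {Z : Set X} {s : X} (h : s ∉ Z) : wt k Z s = 0 := by simp [wt, h]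

theorem wt_diff_add {Z : Set X} {t : X} (h : t ∈ Z) : wt k (Z \ {t}) + wt k {t} = wt k Z := by
  ext s
  by_cases hs : s = t
  · subst hs; simp [wt, h]
  · by_cases hZ : s ∈ Z <;> simp [wt, indicator, hs, hZ]

variable (k) in
/-- The relations in degree `q - 1` of the Orlik-Solomon algebra of `N`, where the elements outside
of the ground set of `N` are set to zero. -/
noncomputable def osRel (N : Matroid X) (q : ℕ) : Submodule k (ExtAlg k X) :=
  Submodule.span k {x | ∃ l : List X, ¬ N.Indep {s | s ∈ l} ∧
    ((l.length + 1 = q ∧ x = mon k l) ∨ (l.length = q ∧ x = bd (wt k N.E) (mon k l)))}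

variable {N : Matroid X} {q : ℕ} {x : ExtAlg k X} {t : X}

theorem osRel_le {P : Submodule k (ExtAlg k X)}
    (h1 : ∀ l : List X, ¬ N.Indep {s | s ∈ l} → l.length + 1 = q → mon k l ∈ P)
    (h2 : ∀ l : List X, ¬ N.Indep {s | s ∈ l} → l.length = q → bd (wt k N.E) (mon k l) ∈ P) :
    osRel k N q ≤ P :=
  Submodule.span_le.2 <| by
    rintro _ ⟨l, hl, ⟨hq, rfl⟩ | ⟨hq, rfl⟩⟩
    exacts [h1 l hl hq, h2 l hl hq]

theorem mon_mem_osRel {l : List X} (hl : ¬ N.Indep {s | s ∈ l}) (hq : l.length + 1 = q) :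
    mon k l ∈ osRel k N q := Submodule.subset_span ⟨l, hl, Or.inl ⟨hq, rfl⟩⟩

theorem bd_mon_mem_osRel {l : List X} (hl : ¬ N.Indep {s | s ∈ l}) (hq : l.length = q) :
    bd (wt k N.E) (mon k l) ∈ osRel k N q := Submodule.subset_span ⟨l, hl, Or.inr ⟨hq, rfl⟩⟩

theorem osRel_le_extDeg : osRel k N q ≤ extDeg k univ q :=
  osRel_le (fun _ _ hq => hq ▸ mon_mem_extDeg fun _ _ => mem_univ _)
    (fun _ _ hq => hq ▸ bd_mon_mem fun _ _ => mem_univ _)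

theorem bd_mem_osRel (hx : x ∈ osRel k N (q + 1)) : bd (wt k N.E) x ∈ osRel k N q := by
  suffices osRel k N (q + 1) ≤ (osRel k N q).comap (bd (wt k N.E)) from this hx
  refine osRel_le (fun l hl hq => bd_mon_mem_osRel hl (by omega)) fun l hl hq => ?_
  rw [Submodule.mem_comap, bd_bd]
  exact zero_mem _

theorem not_indep_cons {s : X} {l : List X} (hl : ¬ N.Indep {s | s ∈ l}) :
    ¬ N.Indep {u | u ∈ s :: l} :=
  fun h => hl (h.subset fun _ hu => List.mem_cons_of_mem _ hu)

/-- By the Leibniz rule e_s ∂e_l is a combination of e_l and ∂(e_s e_l). This is why the dependent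
monomials are listed among the generators: the plain linear span is then closed under
multiplication. -/
theorem gen_mul_mem_osRel (s : X) (hx : x ∈ osRel k N q) : gen k s * x ∈ osRel k N (q + 1) := by
  suffices osRel k N q ≤ (osRel k N (q + 1)).comap (LinearMap.mulLeft k (gen k s)) from this hx
  refine osRel_le (fun l hl hq => ?_) fun l hl hq => ?_
  · rw [Submodule.mem_comap, LinearMap.mulLeft_apply, ← mon_cons]
    exact mon_mem_osRel (not_indep_cons hl) (by simp [hq])
  · have h := bd_gen_mul (f := wt k N.E) s (mon k l)
    rw [Submodule.mem_comap, LinearMap.mulLeft_apply, ← sub_sub_self (wt k N.E s • mon k l)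
      (gen k s * _), ← h, ← mon_cons]
    exact sub_mem (Submodule.smul_mem _ _ (mon_mem_osRel hl (by omega)))
      (bd_mon_mem_osRel (not_indep_cons hl) (by simp [hq]))

theorem mul_gen_mem_osRel (s : X) (hx : x ∈ osRel k N q) : x * gen k s ∈ osRel k N (q + 1) := by
  cases q with
  | zero =>
    have := osRel_le_extDeg hx
    rw [extDeg_zero, Submodule.mem_bot] at this
    rw [this, zero_mul]; exact zero_mem _
  | succ q =>
    rw [mul_gen_eq (osRel_le_extDeg hx)]
    exact Submodule.smul_mem _ _ (gen_mul_mem_osRel s hx)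

theorem gen_mul_mem_of_not_indep (ht : ¬ N.Indep {t}) (hx : x ∈ extDeg k univ q) :
    gen k t * x ∈ osRel k N (q + 1) := by
  suffices extDeg k univ q ≤ (osRel k N (q + 1)).comap (LinearMap.mulLeft k (gen k t)) from this hx
  refine extDeg_le fun l hl hq => ?_
  rw [Submodule.mem_comap, LinearMap.mulLeft_apply, ← mon_cons]
  exact mon_mem_osRel (fun h => ht (h.subset (by simp))) (by simp [hq])

theorem mul_gen_mem_of_not_indep (ht : ¬ N.Indep {t}) (hx : x ∈ extDeg k univ q) :
    x * gen k t ∈ osRel k N (q + 1) := by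
  cases q with
  | zero =>
    rw [extDeg_zero, Submodule.mem_bot] at hx
    rw [hx, zero_mul]; exact zero_mem _
  | succ q =>
    rw [mul_gen_eq hx]
    exact Submodule.smul_mem _ _ (gen_mul_mem_of_not_indep ht hx)

/-- For a loop t the unit 1 = ∂e_t is a relation. -/
theorem extDeg_le_osRel_of_isLoop (ht : N.IsLoop t) : extDeg k univ q ≤ osRel k N q := by
  have ht' : ¬ N.Indep {t} := (Matroid.singleton_not_indep ht.mem_ground).2 ht
  refine extDeg_le fun l _ hq => ?_
  have h := bd_gen_mul (f := wt k N.E) t (mon k l)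
  rw [wt_of_mem ht.mem_ground, one_smul, eq_sub_iff_add_eq, ← mon_cons] at h
  rw [← h]
  refine add_mem (bd_mon_mem_osRel (fun h => ht' (h.subset (by simp))) (by simp [hq])) ?_
  obtain rfl : q = l.length + 1 := hq.symm
  exact gen_mul_mem_of_not_indep ht' (bd_mon_mem fun _ _ => mem_univ _)

/-! ### Deletion, contraction and the residue along e_t -/

theorem not_indep_singleton_contract : ¬ (N ／ {t}).Indep {t} := fun h => by
  have := h.subset_ground (mem_singleton t)
  simp at this

theorem not_indep_singleton_delete : ¬ (N ＼ {t}).Indep {t} := fun h => by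
  have := h.subset_ground (mem_singleton t)
  simp at this

theorem contract_indep_iff' (ht : N.Indep {t}) {I : Set X} :
    (N ／ {t}).Indep I ↔ t ∉ I ∧ N.Indep (insert t I) :=
  (Matroid.indep_singleton.1 ht).contractElem_indep_iff

theorem bd_wt_ground (ht : t ∈ N.E) (x : ExtAlg k X) :
    bd (wt k N.E) x = bd (wt k (N.E \ {t})) x + bd (wt k {t}) x := by
  rw [← bd_add, wt_diff_add ht]

theorem bd_wt_eq_zero_of_mem_extDeg {Z : Set X} (htZ : t ∉ Z) (hx : x ∈ extDeg k Z q) :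
    bd (wt k {t}) x = 0 := by
  suffices extDeg k Z q ≤ LinearMap.ker (bd (wt k {t})) from this hx
  refine extDeg_le fun l hl _ => bd_mon_eq_zero fun s hs => wt_of_notMem ?_
  rintro rfl
  exact htZ (hl s hs)

theorem bd_wt_mon_eq_zero {l : List X} (htl : t ∉ l) : bd (wt k {t}) (mon k l) = 0 :=
  bd_mon_eq_zero fun s hs => wt_of_notMem (by rintro rfl; exact htl hs)

theorem bd_wt_mon_mem_contract (ht : N.Indep {t}) {l : List X} (hl : ¬ N.Indep {s | s ∈ l}) :
    bd (wt k {t}) (mon k l) ∈ osRel k (N ／ {t}) l.length := by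
  by_cases htl : t ∈ l
  · obtain ⟨m, hm⟩ := exists_perm_cons_of_mem htl
    have hlen : l.length = m.length + 1 := by simpa using hm.length_eq
    suffices bd (wt k {t}) (mon k (t :: m)) ∈ osRel k (N ／ {t}) l.length by
      rcases mon_perm k hm with h | h <;> rw [h]
      · exact this
      · rw [map_neg]; exact neg_mem this
    rw [mon_cons, bd_gen_mul, wt_of_mem (mem_singleton t), one_smul, hlen]
    refine sub_mem (mon_mem_osRel (fun h => hl ?_) rfl)
      (gen_mul_mem_of_not_indep not_indep_singleton_contract (bd_mon_mem fun _ _ => mem_univ _))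
    refine ((contract_indep_iff' ht).1 h).2.subset fun s hs => ?_
    simpa using hm.subset hs
  · rw [bd_wt_mon_eq_zero htl]
    exact zero_mem _

/-- Contraction ∂_t against e_t is the residue map from A(N) to A(N / t). It respects the relations
∂e_l because ∂_t anticommutes with ∂, and because on the image of ∂_t the boundaries of N and of N /
t agree, as ∂_t² = 0. -/
theorem bd_wt_mem_contract (ht : N.Indep {t}) (hx : x ∈ osRel k N (q + 1)) :
    bd (wt k {t}) x ∈ osRel k (N ／ {t}) q := by
  have htE : t ∈ N.E := ht.subset_ground rfl
  suffices osRel k N (q + 1) ≤ (osRel k (N ／ {t}) q).comap (bd (wt k {t})) from this hx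
  refine osRel_le (fun l hl hq => ?_) fun l hl hq => ?_
  · obtain rfl : l.length = q := by omega
    exact bd_wt_mon_mem_contract ht hl
  · have h := bd_wt_mon_mem_contract (k := k) ht hl
    rw [hq] at h
    rw [Submodule.mem_comap, bd_comm, bd_wt_ground htE (bd (wt k {t}) _), bd_bd, add_zero]
    exact neg_mem (bd_mem_osRel h)

theorem osRel_le_contract (ht : N.Indep {t}) : osRel k N q ≤ osRel k (N ／ {t}) q := by
  have htE : t ∈ N.E := ht.subset_ground rfl
  have hc : ∀ l : List X, ¬ N.Indep {s | s ∈ l} → ¬ (N ／ {t}).Indep {s | s ∈ l} :=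
    fun l hl h => hl (((contract_indep_iff' ht).1 h).2.subset (subset_insert _ _))
  refine osRel_le (fun l hl hq => mon_mem_osRel (hc l hl) hq) fun l hl hq => ?_
  rw [bd_wt_ground htE]
  exact add_mem (bd_mon_mem_osRel (N := N ／ {t}) (hc l hl) hq)
    (hq ▸ bd_wt_mon_mem_contract ht hl)

theorem osRel_delete_le_contract (ht : N.Indep {t}) :
    osRel k (N ＼ {t}) q ≤ osRel k (N ／ {t}) q := by
  have hc : ∀ l : List X, ¬ (N ＼ {t}).Indep {s | s ∈ l} → ¬ (N ／ {t}).Indep {s | s ∈ l} := by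
    refine fun l hl h => hl ?_
    obtain ⟨h1, h2⟩ := (contract_indep_iff' ht).1 h
    exact Matroid.delete_indep_iff.2 ⟨h2.subset (subset_insert _ _), by simpa using h1⟩
  exact osRel_le (fun l hl hq => mon_mem_osRel (hc l hl) hq)
    fun l hl hq => bd_mon_mem_osRel (N := N ／ {t}) (hc l hl) hq

/-- Relations of the contraction lift along the residue. If l is dependent in N / t and t is not in
l, then e_t e_l is dependent in N, and e_t ∂e_l = e_l − ∂(e_t e_l) with an error e_l free of e_t. If
t is in l, the product with e_t is zero. -/
theorem exists_gen_mul_add_mem (ht : N.Indep {t}) (hx : x ∈ osRel k (N ／ {t}) q) :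
    ∃ a ∈ extDeg k {t}ᶜ (q + 1), gen k t * x + a ∈ osRel k N (q + 1) := by
  have htE : t ∈ N.E := ht.subset_ground rfl
  let P : Submodule k (ExtAlg k X) :=
    (osRel k N (q + 1) ⊔ extDeg k {t}ᶜ (q + 1)).comap (LinearMap.mulLeft k (gen k t))
  suffices osRel k (N ／ {t}) q ≤ P by
    obtain ⟨y, hy, a, ha, h⟩ := Submodule.mem_sup.1 (this hx)
    refine ⟨-a, neg_mem ha, ?_⟩
    rw [LinearMap.mulLeft_apply] at h
    rwa [← h, add_neg_cancel_right]
  refine osRel_le (fun l hl hq => ?_) fun l hl hq => ?_ <;>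
    rw [Submodule.mem_comap, LinearMap.mulLeft_apply]
  · by_cases htl : t ∈ l
    · rw [gen_mul_mon_of_mem k htl]; exact zero_mem _
    · rw [← mon_cons]
      refine Submodule.mem_sup_left (mon_mem_osRel (fun h => hl ?_) (by simp [hq]))
      refine (contract_indep_iff' ht).2 ⟨htl, h.subset fun s hs => ?_⟩
      simpa using hs
  · by_cases htl : t ∈ l
    · obtain ⟨m, hm⟩ := exists_perm_cons_of_mem htl
      have h0 : gen k t * bd (wt k (N ／ {t}).E) (mon k (t :: m)) = 0 := by
        rw [mon_cons, bd_gen_mul, wt_of_notMem (by simp), zero_smul, zero_sub, mul_neg,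
          gen_mul_gen_mul_self, neg_zero]
      rcases mon_perm k hm with h | h <;> rw [h]
      · rw [h0]; exact zero_mem _
      · rw [map_neg, mul_neg, h0, neg_zero]; exact zero_mem _
    · have e : bd (wt k (N ／ {t}).E) (mon k l) = bd (wt k N.E) (mon k l) := by
        rw [bd_wt_ground htE, bd_wt_mon_eq_zero htl, add_zero]; rfl
      have h := bd_gen_mul (f := wt k N.E) t (mon k l)
      rw [wt_of_mem htE, one_smul] at h
      rw [e, ← sub_sub_self (mon k l) (gen k t * _), ← h, ← mon_cons]
      refine sub_mem (Submodule.mem_sup_right ?_) (Submodule.mem_sup_left ?_)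
      · exact Submodule.subset_span ⟨l, by rintro s hs rfl; exact htl hs, by omega, rfl⟩
      · refine bd_mon_mem_osRel (fun h => hl ?_) (by simp [hq])
        refine (contract_indep_iff' ht).2 ⟨htl, h.subset fun s hs => ?_⟩
        simpa using hs

/-! ### Killing generators -/

open Classical in
variable (k) in
/-- The endomorphism of the exterior algebra which kills the generators outside of `Z`. -/
noncomputable def kill (Z : Set X) : ExtAlg k X →ₐ[k] ExtAlg k X :=
  extHom k fun s => if s ∈ Z then Finsupp.single s 1 else 0

open Classical in
theorem kill_mon {Z : Set X} {l : List X} (hl : ∀ s ∈ l, s ∈ Z) :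
    kill k Z (mon k l) = mon k l := by
  have h := extHom_mon (k := k) (h := fun s => if s ∈ Z then Finsupp.single s 1 else 0) (j := id)
    (l := l) fun s hs => if_pos (hl s hs)
  rw [kill, h, List.map_id]

theorem kill_mon_eq_zero {Z : Set X} {l : List X} {s : X} (hs : s ∈ l) (hZ : s ∉ Z) :
    kill k Z (mon k l) = 0 := extHom_mon_eq_zero hs (if_neg hZ)

theorem kill_gen_eq_zero {Z : Set X} {s : X} (hZ : s ∉ Z) : kill k Z (gen k s) = 0 := by
  rw [← mon_singleton, kill_mon_eq_zero (List.mem_singleton_self s) hZ]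

theorem kill_gen {Z : Set X} {s : X} (hZ : s ∈ Z) : kill k Z (gen k s) = gen k s := by
  rw [← mon_singleton, kill_mon (by simpa using hZ)]

theorem kill_of_mem {Z : Set X} (hx : x ∈ extDeg k Z q) : kill k Z x = x := by
  suffices extDeg k Z q ≤ LinearMap.eqLocus (kill k Z).toLinearMap LinearMap.id from this hx
  exact extDeg_le fun l hl _ => kill_mon hl

theorem kill_mem {Z Z' : Set X} (hx : x ∈ extDeg k Z' q) : kill k Z x ∈ extDeg k (Z' ∩ Z) q := by
  suffices extDeg k Z' q ≤ (extDeg k (Z' ∩ Z) q).comap (kill k Z).toLinearMap from this hx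
  refine extDeg_le fun l hl hq => ?_
  rw [Submodule.mem_comap, AlgHom.toLinearMap_apply]
  by_cases h : ∀ s ∈ l, s ∈ Z
  · rw [kill_mon h]
    exact Submodule.subset_span ⟨l, fun s hs => ⟨hl s hs, h s hs⟩, hq, rfl⟩
  · push Not at h
    obtain ⟨s, hs, hsZ⟩ := h
    rw [kill_mon_eq_zero hs hsZ]
    exact zero_mem _

theorem kill_bd_mon {Z : Set X} {l m : List X} {s : X} (h : l.Perm (s :: m)) (hs : s ∉ Z)
    {P : Submodule k (ExtAlg k X)} {f : X → k} (hP : f s • kill k Z (mon k m) ∈ P) :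
    kill k Z (bd f (mon k l)) ∈ P := by
  have key : kill k Z (bd f (mon k (s :: m))) = f s • kill k Z (mon k m) := by
    rw [mon_cons, bd_gen_mul, map_sub, map_mul, kill_gen_eq_zero hs, zero_mul, sub_zero, map_smul]
  rcases mon_perm k h with h | h <;> rw [h]
  · rwa [key]
  · rw [map_neg, map_neg, key]; exact neg_mem hP

/-- Here it matters that the surviving generators form a flat. If exactly one entry s of a dependent
list lies outside the flat, then up to sign ∂e_l retains only a multiple of the monomial of the
other entries. When s is in the ground set these are already dependent, since s is not in their
closure; otherwise s has weight zero. With two entries outside nothing survives. -/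
theorem kill_closure_mem_osRel {A : Set X} (hx : x ∈ osRel k N q) :
    kill k (N.closure A) x ∈ osRel k N q := by
  suffices osRel k N q ≤ (osRel k N q).comap (kill k (N.closure A)).toLinearMap from this hx
  refine osRel_le (fun l hl hq => ?_) fun l hl hq => ?_ <;>
    rw [Submodule.mem_comap, AlgHom.toLinearMap_apply]
  · by_cases h : ∀ s ∈ l, s ∈ N.closure A
    · rw [kill_mon h]; exact mon_mem_osRel hl hq
    · push Not at h
      obtain ⟨s, hs, hsZ⟩ := h
      rw [kill_mon_eq_zero hs hsZ]; exact zero_mem _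
  · by_cases h : ∀ s ∈ l, s ∈ N.closure A
    · rw [kill_of_mem (bd_mon_mem h)]; exact bd_mon_mem_osRel hl hq
    · push Not at h
      obtain ⟨s, hs, hsZ⟩ := h
      obtain ⟨m, hm⟩ := exists_perm_cons_of_mem hs
      refine kill_bd_mon hm hsZ ?_
      by_cases hsE : s ∈ N.E
      · by_cases h : ∀ s ∈ m, s ∈ N.closure A
        · rw [kill_mon h]
          refine Submodule.smul_mem _ _ (mon_mem_osRel (fun hi => hl ?_) ?_)
          · have : N.Indep (insert s {u | u ∈ m}) := by
              rw [hi.insert_indep_iff]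
              exact Or.inl ⟨hsE, fun h' => hsZ (N.closure_subset_closure_of_subset_closure h h')⟩
            exact this.subset fun u hu => by simpa using hm.subset hu
          · rw [← hq, hm.length_eq, List.length_cons]
        · push Not at h
          obtain ⟨u, hu, huZ⟩ := h
          rw [kill_mon_eq_zero hu huZ, smul_zero]; exact zero_mem _
      · rw [wt_of_notMem hsE, zero_smul]; exact zero_mem _

theorem kill_compl_mem_osRel (hx : x ∈ osRel k (N ＼ {t}) q) :
    kill k {t}ᶜ x ∈ osRel k N q := by
  have hc : ∀ l : List X, ¬ (N ＼ {t}).Indep {s | s ∈ l} → t ∉ l → ¬ N.Indep {s | s ∈ l} :=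
    fun l hl htl h => hl (Matroid.delete_indep_iff.2 ⟨h, by simpa using htl⟩)
  suffices osRel k (N ＼ {t}) q ≤ (osRel k N q).comap (kill k {t}ᶜ).toLinearMap from this hx
  refine osRel_le (fun l hl hq => ?_) fun l hl hq => ?_ <;>
    rw [Submodule.mem_comap, AlgHom.toLinearMap_apply] <;> by_cases htl : t ∈ l
  · rw [kill_mon_eq_zero htl (by simp)]; exact zero_mem _
  · rw [kill_mon (by rintro s hs rfl; exact htl hs)]
    exact mon_mem_osRel (hc l hl htl) hq
  · obtain ⟨m, hm⟩ := exists_perm_cons_of_mem htl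
    refine kill_bd_mon hm (by simp) ?_
    rw [wt_of_notMem (by simp), zero_smul]; exact zero_mem _
  · have : ∀ s ∈ l, s ∈ ({t}ᶜ : Set X) := by rintro s hs rfl; exact htl hs
    rw [kill_of_mem (bd_mon_mem this), bd_mon_congr (g := wt k N.E)]
    · exact bd_mon_mem_osRel (hc l hl htl) hq
    · intro s hs
      by_cases hsE : s ∈ N.E
      · rw [wt_of_mem hsE, wt_of_mem (show s ∈ (N ＼ {t}).E from ⟨hsE, this s hs⟩)]
      · rw [wt_of_notMem hsE, wt_of_notMem fun h => hsE h.1]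

/-! ### Relations free of e_t are relations of the deletion -/

theorem encard_setOf_mem_le (l : List X) : {s | s ∈ l}.encard ≤ l.length := by
  induction l with
  | nil => simp
  | cons s l ih =>
    have : {u | u ∈ s :: l} = insert s {u | u ∈ l} := by ext; simp
    rw [this, List.length_cons]
    push_cast
    exact (encard_insert_le _ _).trans (add_le_add_left ih 1)

theorem encard_setOf_mem {l : List X} (hl : l.Nodup) : {s | s ∈ l}.encard = l.length := by
  induction l with
  | nil => simp
  | cons s l ih =>
    have : {u | u ∈ s :: l} = insert s {u | u ∈ l} := by ext; simp
    rw [List.nodup_cons] at hl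
    rw [this, List.length_cons, encard_insert_of_notMem (by simpa using hl.1), ih hl.2]
    push_cast
    rfl

theorem length_le_of_subset_closure {l m : List X} (hl : N.Indep {s | s ∈ l}) (hd : l.Nodup)
    (h : {s | s ∈ l} ⊆ N.closure {s | s ∈ m}) : l.length ≤ m.length := by
  have h1 := hl.encard_le_eRk_of_subset h
  rw [Matroid.eRk_closure_eq, encard_setOf_mem hd] at h1
  exact_mod_cast h1.trans ((N.eRk_le_encard _).trans (encard_setOf_mem_le m))

theorem osRel_one [N.Loopless] : osRel k N 1 = ⊥ := by
  rw [eq_bot_iff]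
  refine osRel_le (fun l hl hq => ?_) fun l hl hq => ?_
  · obtain rfl : l = [] := List.length_eq_zero_iff.1 (by omega)
    simp at hl
  · obtain ⟨s, rfl⟩ := List.length_eq_one_iff.1 hq
    rw [mon_singleton, bd_gen, wt_of_notMem, map_zero]
    · exact zero_mem _
    · intro hs
      exact hl (by simpa using Matroid.isNonloop_of_loopless hs)

/-- The case of elements supported on a flat of the appropriate rank. -/
theorem mem_delete_of_subset_closure {p : ℕ} {m : List X} (hm : m.length = p + 1)
    (htm : t ∉ m) (hmi : N.Indep {s | s ∈ m})
    (ih : ∀ {x : ExtAlg k X}, x ∈ osRel k N (p + 1) → x ∈ extDeg k {t}ᶜ (p + 1) →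
      x ∈ osRel k (N ＼ {t}) (p + 1)) (hx : x ∈ osRel k N (p + 2))
    (hx' : x ∈ extDeg k ({t}ᶜ ∩ N.closure {s | s ∈ m}) (p + 2)) :
    x ∈ osRel k (N ＼ {t}) (p + 2) := by
  obtain ⟨s, hs⟩ : ∃ s, s ∈ m := List.exists_mem_of_length_pos (by omega)
  have hst : s ≠ t := by rintro rfl; exact htm hs
  have hsE : s ∈ (N ＼ {t}).E := ⟨hmi.subset_ground hs, hst⟩
  have hx2 := extDeg_mono inter_subset_left _ hx'
  have e : bd (wt k (N ＼ {t}).E) x = bd (wt k N.E) x := by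
    refine bd_eq_of_mem_extDeg (fun u hu => ?_) hx2
    by_cases huE : u ∈ N.E
    · rw [wt_of_mem huE, wt_of_mem (show u ∈ (N ＼ {t}).E from ⟨huE, hu⟩)]
    · rw [wt_of_notMem huE, wt_of_notMem fun h => huE h.1]
  have h1 : bd (wt k (N ＼ {t}).E) x ∈ osRel k (N ＼ {t}) (p + 1) := by
    have := bd_mem_extDeg (f := wt k (N ＼ {t}).E) hx2
    rw [e] at this ⊢
    exact ih (bd_mem_osRel hx) this
  -- The flat has rank p + 1 and e_s x has degree p + 2, so every monomial occurring in it is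
  -- dependent.
  have h2 : gen k s * x ∈ osRel k (N ＼ {t}) (p + 3) := by
    suffices extDeg k ({t}ᶜ ∩ N.closure {s | s ∈ m}) (p + 2) ≤
      (osRel k (N ＼ {t}) (p + 3)).comap (LinearMap.mulLeft k (gen k s)) from this hx'
    refine extDeg_le fun l hl hq => ?_
    rw [Submodule.mem_comap, LinearMap.mulLeft_apply, ← mon_cons]
    by_cases hd : (s :: l).Nodup
    · refine mon_mem_osRel (fun h => ?_) (by simp [hq])
      have := length_le_of_subset_closure (m := m) (Matroid.delete_indep_iff.1 h).1 hd ?_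
      · simp only [List.length_cons] at this
        omega
      · rintro u hu
        rcases List.mem_cons.1 hu with rfl | hu
        · exact N.mem_closure_of_mem hs hmi.subset_ground
        · exact (hl u hu).2
    · rw [mon_eq_zero k hd]; exact zero_mem _
  -- The Leibniz rule gives x = ∂(e_s x) + e_s ∂x, and both terms are now relations of the deletion.
  have h := bd_gen_mul (f := wt k (N ＼ {t}).E) s x
  rw [wt_of_mem hsE, one_smul, eq_sub_iff_add_eq] at h
  rw [← h]
  exact add_mem (bd_mem_osRel h2) (gen_mul_mem_osRel s h1)

-- This is injectivity of A(N \ t) → A(N), by induction on the degree. As in Brieskorn's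
-- decomposition, the independent monomials are sorted by the flat they span, and modulo relations
-- of the deletion each part of x is obtained by killing the generators outside its flat. That
-- operation preserves relations, so it is enough to treat elements supported on a flat whose rank
-- is their degree.
open Classical in
theorem mem_osRel_delete [N.Loopless] (hx : x ∈ osRel k N q) (hx' : x ∈ extDeg k {t}ᶜ q) :
    x ∈ osRel k (N ＼ {t}) q := by
  induction q generalizing x with
  | zero =>
    rw [extDeg_zero, Submodule.mem_bot] at hx'
    rw [hx']; exact zero_mem _
  | succ q ih =>
  cases q with
  | zero =>
    rw [osRel_one, Submodule.mem_bot] at hx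
    rw [hx]; exact zero_mem _
  | succ p =>
  set R := osRel k (N ＼ {t}) (p + 2) with hR
  have himg : extDeg k {t}ᶜ (p + 2) = Submodule.span k
      (mon k '' {l : List X | (∀ s ∈ l, s ∈ ({t}ᶜ : Set X)) ∧ l.length + 1 = p + 2}) := by
    rw [extDeg]
    congr 1
    ext y
    constructor
    · rintro ⟨l, h1, h2, rfl⟩; exact ⟨l, ⟨h1, h2⟩, rfl⟩
    · rintro ⟨l, ⟨h1, h2⟩, rfl⟩; exact ⟨l, h1, h2, rfl⟩
  obtain ⟨c, hc, hcx⟩ := (Finsupp.mem_span_image_iff_linearCombination k).1 (himg ▸ hx')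
  rw [Finsupp.mem_supported] at hc
  rw [Finsupp.linearCombination_apply, Finsupp.sum] at hcx
  have hcl : ∀ l ∈ c.support, (∀ s ∈ l, s ≠ t) ∧ l.length = p + 1 := fun l hl =>
    ⟨(hc hl).1, by have := (hc hl).2; omega⟩
  have hdep : ∀ l ∈ c.support, ¬ (N.Indep {s | s ∈ l} ∧ l.Nodup) → mon k l ∈ R := by
    intro l hl h
    by_cases hd : l.Nodup
    · exact mon_mem_osRel (fun h' => h ⟨(Matroid.delete_indep_iff.1 h').1, hd⟩)
        (by rw [(hcl l hl).2])
    · rw [mon_eq_zero k hd]; exact zero_mem _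
  set S := c.support.filter fun l => N.Indep {s | s ∈ l} ∧ l.Nodup with hS
  have hflat : ∀ F ∈ S.image (fun l : List X => N.closure {s | s ∈ l}),
      ∑ l ∈ S with N.closure {s | s ∈ l} = F, c l • mon k l ∈ R := by
    intro F hF
    obtain ⟨m, hm, rfl⟩ := Finset.mem_image.1 hF
    obtain ⟨hmc, hmi, hmd⟩ := Finset.mem_filter.1 hm
    have h1 : kill k (N.closure {s | s ∈ m}) x ∈ R :=
      mem_delete_of_subset_closure (hcl m hmc).2 (fun h => (hcl m hmc).1 t h rfl) hmi
        (fun h h' => ih h h') (kill_closure_mem_osRel hx) (kill_mem hx')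
    -- Killing the generators outside the flat leaves, up to dependent monomials, exactly the
    -- independent terms of x that span it.
    have h2 : kill k (N.closure {s | s ∈ m}) x -
        ∑ l ∈ S with N.closure {s | s ∈ l} = N.closure {s | s ∈ m}, c l • mon k l ∈ R := by
      rw [hS, Finset.filter_filter, Finset.sum_filter, ← hcx, map_sum, ← Finset.sum_sub_distrib]
      refine Submodule.sum_mem _ fun l hl => ?_
      rw [map_smul]
      split_ifs with h
      · rw [kill_mon fun s hs => ?_, sub_self]
        · exact zero_mem _
        · rw [← h.2]
          exact N.mem_closure_of_mem hs h.1.1.subset_ground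
      · rw [sub_zero]
        refine Submodule.smul_mem _ _ ?_
        by_cases hlm : ∀ s ∈ l, s ∈ N.closure {s | s ∈ m}
        · rw [kill_mon hlm]
          refine hdep l hl fun hid => h ⟨hid, ?_⟩
          refine (N.closure_subset_closure_of_subset_closure hlm).antisymm fun s hs => ?_
          by_contra hsl
          -- An independent list inside the flat that failed to span it would extend to an
          -- independent list of length p + 2 in rank p + 1.
          have hi : N.Indep {u | u ∈ s :: l} := by
            have : {u | u ∈ s :: l} = insert s {u | u ∈ l} := by ext; simp
            rw [this, hid.1.insert_indep_iff]
            exact Or.inl ⟨N.closure_subset_ground _ hs, hsl⟩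
          have hd : (s :: l).Nodup := List.nodup_cons.2
            ⟨fun h => hsl (N.mem_closure_of_mem h hid.1.subset_ground), hid.2⟩
          have := length_le_of_subset_closure (m := m) hi hd (by
            rintro u hu
            rcases List.mem_cons.1 hu with rfl | hu
            · exact hs
            · exact hlm u hu)
          rw [List.length_cons, (hcl l hl).2, (hcl m hmc).2] at this
          omega
        · push Not at hlm
          obtain ⟨s, hs, hsF⟩ := hlm
          rw [kill_mon_eq_zero hs hsF]; exact zero_mem _
    have := sub_mem h1 h2
    rwa [sub_sub_cancel] at this
  have h1 : ∑ l ∈ S, c l • mon k l ∈ R := by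
    rw [← Finset.sum_fiberwise_of_maps_to (fun l hl => Finset.mem_image_of_mem
      (fun l : List X => N.closure {s | s ∈ l}) hl)]
    exact Submodule.sum_mem _ hflat
  rw [← hcx, ← Finset.sum_filter_add_sum_filter_not c.support
    (fun l => N.Indep {s | s ∈ l} ∧ l.Nodup)]
  refine add_mem h1 (Submodule.sum_mem _ fun l hl => Submodule.smul_mem _ _ ?_)
  obtain ⟨hl1, hl2⟩ := Finset.mem_filter.1 hl
  exact hdep l hl1 hl2

end Relations

/-! ### Right multiplication by the universal element `∑ x_s e_s` -/

section UniversalDifferential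

variable {X A : Type*} [Ring A]

/-- Multiplication by the variable `x_s` of a power series with coefficients in `A`. -/
noncomputable def shift (s : X) (z : (X →₀ ℕ) → A) (n : X →₀ ℕ) : A :=
  if n s = 0 then 0 else z (n - Finsupp.single s 1)

/-- Right multiplication by `∑ x_s e_s` of a power series with coefficients in `A`. -/
noncomputable def kdiff [Fintype X] (e : X → A) (z : (X →₀ ℕ) → A) (n : X →₀ ℕ) : A :=
  ∑ s, shift s z n * e s

theorem shift_of_eq_zero {s : X} {n : X →₀ ℕ} (h : n s = 0) (z : (X →₀ ℕ) → A) :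
    shift s z n = 0 := if_pos h

@[simp] theorem shift_add_single (s : X) (n : X →₀ ℕ) (z : (X →₀ ℕ) → A) :
    shift s z (n + Finsupp.single s 1) = z n := by simp [shift]

theorem exists_eq_add_single {s : X} {n : X →₀ ℕ} (h : n s ≠ 0) :
    ∃ m, n = m + Finsupp.single s 1 := by
  refine ⟨n - Finsupp.single s 1, (tsub_add_cancel_of_le ?_).symm⟩
  rw [Finsupp.single_le_iff]
  omega

theorem shift_add_single_of_ne {s t : X} (h : s ≠ t) (n : X →₀ ℕ) (z : (X →₀ ℕ) → A) :
    shift s z (n + Finsupp.single t 1) = shift s (fun m => z (m + Finsupp.single t 1)) n := by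
  classical
  by_cases hs : n s = 0
  · rw [shift_of_eq_zero hs, shift_of_eq_zero]
    simp [hs, h.symm]
  · obtain ⟨m, rfl⟩ := exists_eq_add_single hs
    rw [shift_add_single, add_right_comm, shift_add_single]

theorem shift_comm (s t : X) (z : (X →₀ ℕ) → A) : shift s (shift t z) = shift t (shift s z) := by
  by_cases hst : s = t
  · rw [hst]
  ext n
  by_cases hs : n s = 0
  · rw [shift_of_eq_zero hs]
    by_cases ht : n t = 0
    · rw [shift_of_eq_zero ht]
    · obtain ⟨m, rfl⟩ := exists_eq_add_single ht
      rw [shift_add_single, shift_of_eq_zero]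
      simpa using And.left (by simpa using hs)
  · obtain ⟨m, rfl⟩ := exists_eq_add_single hs
    rw [shift_add_single, shift_add_single_of_ne (Ne.symm hst)]
    congr 1
    ext m
    rw [shift_add_single]

theorem shift_add (s : X) (z w : (X →₀ ℕ) → A) : shift s (z + w) = shift s z + shift s w := by
  ext n
  by_cases hs : n s = 0 <;> simp [shift, hs]

theorem shift_sub (s : X) (z w : (X →₀ ℕ) → A) : shift s (z - w) = shift s z - shift s w := by
  ext n
  by_cases hs : n s = 0 <;> simp [shift, hs]

theorem shift_comp {A' F : Type*} [Ring A'] [FunLike F A A'] [AddMonoidHomClass F A A'] (h : F)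
    (s : X) (z : (X →₀ ℕ) → A) (n : X →₀ ℕ) : h (shift s z n) = shift s (fun m => h (z m)) n := by
  by_cases hs : n s = 0 <;> simp [shift, hs]

theorem shift_mul_left (s : X) (a : A) (z : (X →₀ ℕ) → A) (n : X →₀ ℕ) :
    shift s (fun m => a * z m) n = a * shift s z n := by
  by_cases hs : n s = 0 <;> simp [shift, hs]

theorem shift_mul_right (s : X) (a : A) (z : (X →₀ ℕ) → A) (n : X →₀ ℕ) :
    shift s (fun m => z m * a) n = shift s z n * a := by
  by_cases hs : n s = 0 <;> simp [shift, hs]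

theorem shift_sum {ι : Type*} (s : X) (S : Finset ι) (z : ι → (X →₀ ℕ) → A) (n : X →₀ ℕ) :
    shift s (fun m => ∑ i ∈ S, z i m) n = ∑ i ∈ S, shift s (z i) n := by
  by_cases hs : n s = 0 <;> simp [shift, hs]

theorem shift_mem {S : Type*} [SetLike S A] [ZeroMemClass S A] {P : S} {z : (X →₀ ℕ) → A}
    (hz : ∀ n, z n ∈ P) (s : X) (n : X →₀ ℕ) : shift s z n ∈ P := by
  by_cases hs : n s = 0
  · rw [shift_of_eq_zero hs]; exact zero_mem P
  · rw [shift, if_neg hs]; exact hz _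

theorem shift_congr {s : X} {z w : (X →₀ ℕ) → A} {n : X →₀ ℕ}
    (h : ∀ m, n = m + Finsupp.single s 1 → z m = w m) : shift s z n = shift s w n := by
  by_cases hs : n s = 0
  · rw [shift_of_eq_zero hs, shift_of_eq_zero hs]
  · obtain ⟨m, rfl⟩ := exists_eq_add_single hs
    rw [shift_add_single, shift_add_single, h m rfl]

variable [Fintype X] {e : X → A}

theorem kdiff_add (z w : (X →₀ ℕ) → A) : kdiff e (z + w) = kdiff e z + kdiff e w := by
  ext n
  simp [kdiff, shift_add, add_mul, Finset.sum_add_distrib]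

theorem kdiff_sub (z w : (X →₀ ℕ) → A) : kdiff e (z - w) = kdiff e z - kdiff e w := by
  ext n
  simp [kdiff, shift_sub, sub_mul, Finset.sum_sub_distrib]

theorem kdiff_shift (t : X) (z : (X →₀ ℕ) → A) : kdiff e (shift t z) = shift t (kdiff e z) := by
  ext n
  unfold kdiff
  rw [shift_sum]
  refine Finset.sum_congr rfl fun s _ => ?_
  rw [shift_comm, shift_mul_right]

theorem kdiff_mul_left (a : A) (z : (X →₀ ℕ) → A) (n : X →₀ ℕ) :
    kdiff e (fun m => a * z m) n = a * kdiff e z n := by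
  simp only [kdiff, shift_mul_left, Finset.mul_sum, mul_assoc]

theorem kdiff_zero (n : X →₀ ℕ) : kdiff e (fun _ => 0) n = 0 :=
  Finset.sum_eq_zero fun s _ => by
    rw [shift, ite_self, zero_mul]

theorem kdiff_kdiff (h1 : ∀ s t, e s * e t = - (e t * e s)) (h2 : ∀ s, e s * e s = 0)
    (z : (X →₀ ℕ) → A) (n : X →₀ ℕ) : kdiff e (kdiff e z) n = 0 := by
  classical
  unfold kdiff
  simp only [shift_sum, shift_mul_right, Finset.sum_mul, mul_assoc]
  rw [← Finset.sum_product']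
  -- The terms for (s, t) and (t, s) cancel, and the diagonal terms vanish.
  refine Finset.sum_involution (fun p _ => p.swap) (fun p _ => ?_) (fun p _ hp he => hp ?_)
    (fun p _ => by simp) (fun p _ => by simp)
  · change shift p.1 (shift p.2 z) n * _ + shift p.2 (shift p.1 z) n * _ = 0
    rw [shift_comm, h1 p.2 p.1, mul_neg]
    exact neg_add_cancel _
  · have : p.1 = p.2 := congrArg Prod.snd he
    rw [this, h2, mul_zero]

theorem kdiff_congr {z w : (X →₀ ℕ) → A} {n : X →₀ ℕ}
    (h : ∀ m s, n = m + Finsupp.single s 1 → z m = w m) : kdiff e z n = kdiff e w n :=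
  Finset.sum_congr rfl fun s _ => by rw [shift_congr fun m hm => h m s hm]

theorem kdiff_eq_of_ne_zero {t : X} {z : (X →₀ ℕ) → A} (hz : ∀ n, n t ≠ 0 → z n = 0)
    {n : X →₀ ℕ} (hn : n t ≠ 0) : kdiff e z n = shift t z n * e t := by
  classical
  refine Finset.sum_eq_single_of_mem t (Finset.mem_univ t) fun s _ hst => ?_
  by_cases hs : n s = 0
  · rw [shift_of_eq_zero hs, zero_mul]
  · obtain ⟨m, rfl⟩ := exists_eq_add_single hs
    rw [shift_add_single, hz, zero_mul]
    simpa [hst] using hn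

/-- Translation divides by x_t and discards the part of z free of x_t. That part enters the
coefficients of zΩ divisible by x_t only through its product with x_t e_t, which is the correction
term. -/
theorem kdiff_translate (t : X) (z : (X →₀ ℕ) → A) (n : X →₀ ℕ) :
    kdiff e (fun m => z (m + Finsupp.single t 1)) n =
      kdiff e z (n + Finsupp.single t 1) - (if n t = 0 then z n * e t else 0) := by
  classical
  unfold kdiff
  rw [← Finset.add_sum_erase _ _ (Finset.mem_univ t),
    ← Finset.add_sum_erase _ (fun s => shift s z (n + Finsupp.single t 1) * e s)
      (Finset.mem_univ t), shift_add_single]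
  have : ∀ s ∈ Finset.univ.erase t, shift s (fun m => z (m + Finsupp.single t 1)) n * e s =
      shift s z (n + Finsupp.single t 1) * e s := fun s hs => by
    rw [shift_add_single_of_ne (Finset.ne_of_mem_erase hs)]
  rw [Finset.sum_congr rfl this]
  by_cases ht : n t = 0
  · rw [if_pos ht, shift_of_eq_zero ht, zero_mul]
    abel
  · rw [if_neg ht]
    obtain ⟨m, rfl⟩ := exists_eq_add_single ht
    rw [shift_add_single, sub_zero]

end UniversalDifferential

/-! ### Exactness of the universal complex below the rank -/

section UniversalExactness

variable {k : Type*} [Field k] {X : Type*} {N : Matroid X} {q p : ℕ} {t : X}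

theorem eq_zero_of_mem_extDeg_zero {x : ExtAlg k X} {Z : Set X} (hx : x ∈ extDeg k Z 0) : x = 0 := by
  rwa [extDeg_zero, Submodule.mem_bot] at hx

theorem gen_mul_mem_extDeg_pred {x : ExtAlg k X} (t : X) (hx : x ∈ extDeg k univ (q - 1)) :
    gen k t * x ∈ extDeg k univ q := by
  cases q with
  | zero => rw [eq_zero_of_mem_extDeg_zero hx, mul_zero]; exact zero_mem _
  | succ q => exact gen_mul_mem_extDeg (mem_univ t) hx

theorem gen_mul_bd_mem_osRel (ht : ¬ N.Indep {t}) {f : X → k} {x : ExtAlg k X}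
    (hx : x ∈ extDeg k univ q) : gen k t * bd f x ∈ osRel k N q := by
  cases q with
  | zero => rw [eq_zero_of_mem_extDeg_zero hx, map_zero, mul_zero]; exact zero_mem _
  | succ q => exact gen_mul_mem_of_not_indep ht (bd_mem_extDeg hx)

theorem bd_wt_gen_mul (x : ExtAlg k X) :
    bd (wt k {t}) (gen k t * x) = x - gen k t * bd (wt k {t}) x := by
  rw [bd_gen_mul, wt_of_mem (mem_singleton t), one_smul]

theorem bd_wt_mul_gen {x : ExtAlg k X} (hx : x ∈ extDeg k {t}ᶜ q) :
    bd (wt k {t}) (x * gen k t) = -((-1 : k) ^ q • x) := by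
  cases q with
  | zero => rw [eq_zero_of_mem_extDeg_zero hx]; simp
  | succ q =>
    rw [bd_mul_gen (extDeg_mono (subset_univ _) _ hx), wt_of_mem (mem_singleton t),
      bd_wt_eq_zero_of_mem_extDeg (by simp) hx, zero_mul, zero_add, mul_one, pow_succ,
      mul_neg_one, neg_smul, neg_neg]

theorem sub_kill_mem_osRel (ht : ¬ N.Indep {t}) {x : ExtAlg k X} (hx : x ∈ extDeg k univ q) :
    x - kill k {t}ᶜ x ∈ osRel k N q := by
  suffices extDeg k univ q ≤
    (osRel k N q).comap (LinearMap.id - (kill k {t}ᶜ).toLinearMap) from this hx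
  refine extDeg_le fun l _ hl => ?_
  change mon k l - kill k {t}ᶜ (mon k l) ∈ osRel k N q
  by_cases htl : t ∈ l
  · rw [kill_mon_eq_zero htl (by simp), sub_zero]
    exact mon_mem_osRel (fun h => ht (h.subset (by simpa using htl))) hl
  · rw [kill_mon (by rintro s hs rfl; exact htl hs), sub_self]
    exact zero_mem _

theorem eRank_contract_add_one (ht : N.Indep {t}) : (N ／ {t}).eRank + 1 = N.eRank := by
  obtain ⟨B, hB, htB⟩ := ht.exists_isBase_superset
  have hB' : (N ／ {t}).IsBase (B \ {t}) := by
    rw [ht.contract_isBase_iff]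
    simpa [insert_eq_of_mem (htB rfl)] using hB
  rw [← hB.encard_eq_eRank, ← hB'.encard_eq_eRank,
    encard_sdiff_singleton_add_one (htB rfl)]

theorem eRank_le_eRank_delete (ht : ¬ N.IsColoop t) :
    N.eRank ≤ (N ＼ {t}).eRank := by
  rw [Matroid.isColoop_iff_forall_mem_isBase] at ht
  push Not at ht
  obtain ⟨B, hB, htB⟩ := ht
  rw [← hB.encard_eq_eRank]
  exact (Matroid.delete_indep_iff.2 ⟨hB.indep, by simpa using htB⟩).encard_le_eRank

/-- The part of a power series which does not involve the variable `x_t`. -/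
def constPart {A : Type*} [Zero A] (t : X) (z : (X →₀ ℕ) → A) (n : X →₀ ℕ) : A :=
  if n t = 0 then z n else 0

theorem constPart_of_eq_zero {A : Type*} [Zero A] {z : (X →₀ ℕ) → A} {n : X →₀ ℕ} (h : n t = 0) :
    constPart t z n = z n := if_pos h

theorem constPart_of_ne_zero {A : Type*} [Zero A] {z : (X →₀ ℕ) → A} {n : X →₀ ℕ} (h : n t ≠ 0) :
    constPart t z n = 0 := if_neg h

theorem constPart_mem {P : Submodule k (ExtAlg k X)} {z : (X →₀ ℕ) → ExtAlg k X}
    (hz : ∀ n, z n ∈ P) (n : X →₀ ℕ) : constPart t z n ∈ P := by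
  by_cases h : n t = 0
  · rw [constPart_of_eq_zero h]; exact hz n
  · rw [constPart_of_ne_zero h]; exact zero_mem _

/-- Exactness at A(N) of the residue sequence. In x = a + e_t b the residue is b, a relation of N /
t; it lifts to a relation e_t b + c with c free of e_t. -/
theorem exists_sub_mem_of_bd_mem (ht : N.Indep {t}) {x : ExtAlg k X}
    (hx : x ∈ extDeg k univ (p + 1)) (hx' : bd (wt k {t}) x ∈ osRel k (N ／ {t}) p) :
    ∃ a ∈ extDeg k {t}ᶜ (p + 1), x - a ∈ osRel k N (p + 1) := by
  obtain ⟨a, ha, b, hb, rfl⟩ := exists_eq_add_gen_mul t hx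
  rw [map_add, bd_wt_gen_mul, bd_wt_eq_zero_of_mem_extDeg (by simp) ha,
    bd_wt_eq_zero_of_mem_extDeg (by simp) hb, mul_zero, sub_zero, zero_add] at hx'
  obtain ⟨c, hc, h⟩ := exists_gen_mul_add_mem ht hx'
  refine ⟨a - c, sub_mem ha hc, ?_⟩
  convert h using 1
  abel

variable [Fintype X]

theorem kdiff_mem_extDeg {z : (X →₀ ℕ) → ExtAlg k X} (hz : ∀ n, z n ∈ extDeg k univ q)
    (n : X →₀ ℕ) : kdiff (gen k) z n ∈ extDeg k univ (q + 1) :=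
  Submodule.sum_mem _ fun s _ => mul_gen_mem_extDeg (mem_univ s) (shift_mem hz s n)

theorem kdiff_mem_extDeg_pred {z : (X →₀ ℕ) → ExtAlg k X} (hz : ∀ n, z n ∈ extDeg k univ (q - 1))
    (n : X →₀ ℕ) : kdiff (gen k) z n ∈ extDeg k univ q := by
  cases q with
  | zero =>
    have : kdiff (gen k) z n = 0 := Finset.sum_eq_zero fun s _ => by
      rw [eq_zero_of_mem_extDeg_zero (shift_mem hz s n), zero_mul]
    rw [this]; exact zero_mem _
  | succ q => exact kdiff_mem_extDeg hz n

theorem kdiff_gen_kdiff (z : (X →₀ ℕ) → ExtAlg k X) (n : X →₀ ℕ) :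
    kdiff (gen k) (kdiff (gen k) z) n = 0 :=
  kdiff_kdiff (gen_mul_gen k) (gen_mul_self k) z n

theorem bd_wt_kdiff {z : (X →₀ ℕ) → ExtAlg k X} (hz : ∀ n, z n ∈ extDeg k univ (p + 1))
    (t : X) (n : X →₀ ℕ) : bd (wt k {t}) (kdiff (gen k) z n) =
      kdiff (gen k) (fun m => bd (wt k {t}) (z m)) n + (-1 : k) ^ p • shift t z n := by
  classical
  unfold kdiff
  rw [map_sum]
  simp only [bd_mul_gen (shift_mem hz _ n), shift_comp, Finset.sum_add_distrib]
  congr 1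
  rw [Finset.sum_eq_single_of_mem t (Finset.mem_univ t), wt_of_mem (mem_singleton t), mul_one]
  intro s _ hs
  rw [wt_of_notMem (by simpa using hs), mul_zero, zero_smul]

/-- If `z` does not involve the variable `x_t`, then one only has to look at the coefficients of
`z ω` which do not involve `x_t` either. -/
theorem kdiff_mem_osRel_of_forall_eq_zero (ht : ¬ N.Indep {t}) {z : (X →₀ ℕ) → ExtAlg k X}
    (hz : ∀ n, z n ∈ extDeg k univ q) (hz0 : ∀ n, n t ≠ 0 → z n = 0)
    (h : ∀ n, n t = 0 → kdiff (gen k) z n ∈ osRel k N (q + 1)) (n : X →₀ ℕ) :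
    kdiff (gen k) z n ∈ osRel k N (q + 1) := by
  by_cases hn : n t = 0
  · exact h n hn
  · rw [kdiff_eq_of_ne_zero hz0 hn]
    exact mul_gen_mem_of_not_indep ht (shift_mem hz t n)

theorem kdiff_constPart {A : Type*} [Ring A] {e : X → A} {z : (X →₀ ℕ) → A} {n : X →₀ ℕ}
    (h : n t = 0) : kdiff e (constPart t z) n = kdiff e z n := by
  refine kdiff_congr fun m s hm => constPart_of_eq_zero ?_
  rw [hm, Finsupp.add_apply] at h
  omega

variable (k) in
/-- Exactness of the universal complex of `N` in the degrees below the rank. -/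
def UniversallyExact (N : Matroid X) : Prop :=
  ∀ q : ℕ, (q : ℕ∞) ≤ N.eRank → ∀ z : (X →₀ ℕ) → ExtAlg k X, (∀ n, z n ∈ extDeg k univ q) →
    (∀ n, kdiff (gen k) z n ∈ osRel k N (q + 1)) →
    ∃ u : (X →₀ ℕ) → ExtAlg k X, (∀ n, u n ∈ extDeg k univ (q - 1)) ∧
      ∀ n, z n - kdiff (gen k) u n ∈ osRel k N q

/-- In ∂_t(zΩ) = ∂_t(z)Ω + (−1)^p x_t z the last term is divisible by x_t, so the x_t-free part of
the residue of z is a cocycle for N / t. Exactness there writes it as dΩ, and e_t d is a correction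
with residue d modulo the relations. -/
theorem exists_bd_sub_mem_contract (ht : N.Indep {t}) (hC : UniversallyExact k (N ／ {t}))
    (hp : (p : ℕ∞) ≤ (N ／ {t}).eRank) {z : (X →₀ ℕ) → ExtAlg k X}
    (hz : ∀ n, z n ∈ extDeg k univ (p + 1))
    (hdz : ∀ n, kdiff (gen k) z n ∈ osRel k N (p + 2)) :
    ∃ w : (X →₀ ℕ) → ExtAlg k X, (∀ n, w n ∈ extDeg k univ p) ∧
      ∀ n, n t = 0 → bd (wt k {t}) (z n - kdiff (gen k) w n) ∈ osRel k (N ／ {t}) p := by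
  set b : (X →₀ ℕ) → ExtAlg k X := constPart t fun n => bd (wt k {t}) (z n) with hb
  have hbz : ∀ n, b n ∈ extDeg k univ p := constPart_mem fun n => bd_mem_extDeg (hz n)
  obtain ⟨d, hd, hbd⟩ := hC p hp b hbz
    (kdiff_mem_osRel_of_forall_eq_zero not_indep_singleton_contract hbz
      (fun n hn => constPart_of_ne_zero hn) fun n hn => by
        have := bd_wt_mem_contract ht (hdz n)
        rwa [bd_wt_kdiff hz, shift_of_eq_zero hn, smul_zero, add_zero,
          ← kdiff_constPart hn] at this)
  refine ⟨fun n => gen k t * d n, fun n => gen_mul_mem_extDeg_pred t (hd n), fun n hn => ?_⟩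
  have h := hbd n
  rw [hb, constPart_of_eq_zero hn] at h
  rw [kdiff_mul_left, map_sub, bd_wt_gen_mul, ← sub_add]
  exact add_mem h (gen_mul_bd_mem_osRel not_indep_singleton_contract (kdiff_mem_extDeg_pred hd n))

theorem neg_one_pow_smul_smul {V : Type*} [AddCommGroup V] [Module k V] (p : ℕ) (x : V) :
    (-1 : k) ^ p • (-1 : k) ^ p • x = x := by
  rw [smul_smul, ← mul_pow]; simp

/-- The passage to leading coefficients: solving the equation on the deletion and on the
contraction simultaneously. -/
theorem exists_delete_contract (ht : N.Indep {t})
    (hC : UniversallyExact k (N ／ {t})) (hD : UniversallyExact k (N ＼ {t}))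
    (hp : ((p + 1 : ℕ) : ℕ∞) ≤ N.eRank) {a b : (X →₀ ℕ) → ExtAlg k X}
    (ha : ∀ n, a n ∈ extDeg k univ (p + 1)) (hb : ∀ n, b n ∈ extDeg k univ p)
    (hb0 : ∀ n, n t ≠ 0 → b n = 0)
    (hda : ∀ n, kdiff (gen k) a n ∈ osRel k (N ＼ {t}) (p + 2))
    (hab : ∀ n, n t = 0 → kdiff (gen k) b n + (-1 : k) ^ p • a n ∈ osRel k (N ／ {t}) (p + 1)) :
    ∃ u d : (X →₀ ℕ) → ExtAlg k X, (∀ n, u n ∈ extDeg k univ p) ∧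
      (∀ n, d n ∈ extDeg k univ (p - 1)) ∧
      (∀ n, n t = 0 → a n - kdiff (gen k) u n ∈ osRel k (N ＼ {t}) (p + 1)) ∧
      ∀ n, n t = 0 → b n + (-1 : k) ^ p • u n - kdiff (gen k) d n ∈ osRel k (N ／ {t}) p := by
  have hsmul : ∀ (z : (X →₀ ℕ) → ExtAlg k X) (n : X →₀ ℕ),
      kdiff (gen k) (fun m => (-1 : k) ^ p • z m) n = (-1 : k) ^ p • kdiff (gen k) z n := by
    intro z n
    simp only [Algebra.smul_def, kdiff_mul_left]
  -- For a coloop the deletion has smaller rank and the degree may be out of its range. But then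
  -- deletion and contraction coincide, and the relation between a and b already exhibits a as the
  -- coboundary of −(−1)^p b.
  by_cases hco : N.IsColoop t
  · have heq : N ／ {t} = N ＼ {t} :=
      Matroid.contract_eq_delete_of_subset_coloops (singleton_subset_iff.2 hco)
    refine ⟨fun n => (-1 : k) ^ p • (- b n), fun _ => 0,
      fun n => Submodule.smul_mem _ _ (neg_mem (hb n)), fun n => zero_mem _, fun n hn => ?_,
      fun n hn => ?_⟩
    · have h := Submodule.smul_mem _ ((-1 : k) ^ p) (hab n hn)
      rw [smul_add, neg_one_pow_smul_smul, heq] at h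
      have e : kdiff (gen k) (fun m => - b m) n = - kdiff (gen k) b n := by
        simpa using kdiff_mul_left (e := gen k) (-1) b n
      rw [hsmul, e, smul_neg, sub_neg_eq_add, add_comm (a n)]
      exact h
    · rw [neg_one_pow_smul_smul, add_neg_cancel, zero_sub]
      refine neg_mem ?_
      rw [kdiff_zero]; exact zero_mem _
  · obtain ⟨u, hu, hau⟩ := hD (p + 1)
      (hp.trans (eRank_le_eRank_delete hco)) a ha hda
    have hp' : (p : ℕ∞) ≤ (N ／ {t}).eRank := by
      rw [← eRank_contract_add_one ht] at hp
      push_cast at hp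
      exact (ENat.add_le_add_iff_right (by simp)).1 hp
    -- On the contraction the differential of b is −(−1)^p a and that of u is a, so this sum is a
    -- cocycle. Only the x_t-free part of u is kept, so that the coefficients divisible by x_t need
    -- no checking.
    set y : (X →₀ ℕ) → ExtAlg k X := b + fun n => (-1 : k) ^ p • constPart t u n with hy
    have hyd : ∀ n, y n ∈ extDeg k univ p := fun n =>
      add_mem (hb n) (Submodule.smul_mem _ _ (constPart_mem hu n))
    obtain ⟨d, hd, hyd⟩ := hC p hp' y hyd
      (kdiff_mem_osRel_of_forall_eq_zero not_indep_singleton_contract hyd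
        (fun n hn => by simp [hy, hb0 n hn, constPart_of_ne_zero hn]) fun n hn => by
          rw [hy, kdiff_add, Pi.add_apply, hsmul, kdiff_constPart hn]
          have h1 := hab n hn
          have h2 := Submodule.smul_mem _ ((-1 : k) ^ p) (osRel_delete_le_contract ht (hau n))
          convert sub_mem h1 h2 using 1
          rw [smul_sub]
          abel)
    refine ⟨u, d, hu, hd, fun n _ => hau n, fun n hn => ?_⟩
    have := hyd n
    rwa [hy, Pi.add_apply, constPart_of_eq_zero hn] at this

/-- One step of successive approximation in powers of x_t. Let a represent the x_t-free part of z
without e_t, and let b be the residue of the part of z linear in x_t. Solving for a on the deletion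
and for b on the contraction makes z − wΩ divisible by x_t, and the quotient z' satisfies the same
hypotheses as z, including the one on residues. -/
theorem exists_sub_shift_mem [N.Loopless] (ht : N.Indep {t})
    (hC : UniversallyExact k (N ／ {t})) (hD : UniversallyExact k (N ＼ {t}))
    (hp : ((p + 1 : ℕ) : ℕ∞) ≤ N.eRank) {z : (X →₀ ℕ) → ExtAlg k X}
    (hz : ∀ n, z n ∈ extDeg k univ (p + 1))
    (hdz : ∀ n, kdiff (gen k) z n ∈ osRel k N (p + 2))
    (hzt : ∀ n, n t = 0 → bd (wt k {t}) (z n) ∈ osRel k (N ／ {t}) p) :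
    ∃ w z' : (X →₀ ℕ) → ExtAlg k X, (∀ n, w n ∈ extDeg k univ p) ∧
      (∀ n, z' n ∈ extDeg k univ (p + 1)) ∧
      (∀ n, kdiff (gen k) z' n ∈ osRel k N (p + 2)) ∧
      (∀ n, n t = 0 → bd (wt k {t}) (z' n) ∈ osRel k (N ／ {t}) p) ∧
      ∀ n, z n - kdiff (gen k) w n - shift t z' n ∈ osRel k N (p + 1) := by
  classical
  have hnc : ¬ (N ／ {t}).Indep {t} := not_indep_singleton_contract
  have hnd : ¬ (N ＼ {t}).Indep {t} := not_indep_singleton_delete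
  have hA : ∀ n, ∃ a ∈ extDeg k {t}ᶜ (p + 1),
      (n t = 0 → z n - a ∈ osRel k N (p + 1)) ∧ (n t ≠ 0 → a = 0) := by
    intro n
    by_cases hn : n t = 0
    · obtain ⟨a, ha, h⟩ := exists_sub_mem_of_bd_mem ht (hz n) (hzt n hn)
      exact ⟨a, ha, fun _ => h, fun h => absurd hn h⟩
    · exact ⟨0, zero_mem _, fun h => absurd h hn, fun _ => rfl⟩
  choose a ha haz ha0 using hA
  have ha' : ∀ n, a n ∈ extDeg k univ (p + 1) := fun n => extDeg_mono (subset_univ _) _ (ha n)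
  set b : (X →₀ ℕ) → ExtAlg k X :=
    constPart t fun n => bd (wt k {t}) (z (n + Finsupp.single t 1)) with hbdef
  have hb : ∀ n, b n ∈ extDeg k univ p := constPart_mem fun n => bd_mem_extDeg (hz _)
  -- Modulo relations of N, the x_t-free part of aΩ equals that of zΩ, and it involves no e_t; hence
  -- it is a relation of the deletion.
  have hda : ∀ n, kdiff (gen k) a n ∈ osRel k (N ＼ {t}) (p + 2) := by
    refine kdiff_mem_osRel_of_forall_eq_zero hnd ha' ha0 fun n hn => ?_
    have h0 : ∀ s, (shift s a n * gen k s ∈ extDeg k {t}ᶜ (p + 2)) ∧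
        shift s z n * gen k s - shift s a n * gen k s ∈ osRel k N (p + 2) := by
      intro s
      by_cases hs : n s = 0
      · simp [shift_of_eq_zero hs]
      · have hst : s ≠ t := by rintro rfl; exact hs hn
        obtain ⟨m, rfl⟩ := exists_eq_add_single hs
        rw [shift_add_single, shift_add_single, ← sub_mul]
        refine ⟨mul_gen_mem_extDeg hst (ha m), mul_gen_mem_osRel s (haz m ?_)⟩
        rw [Finsupp.add_apply] at hn
        omega
    refine mem_osRel_delete ?_ (Submodule.sum_mem _ fun s _ => (h0 s).1)
    have h1 : kdiff (gen k) z n - kdiff (gen k) a n ∈ osRel k N (p + 2) := by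
      unfold kdiff
      rw [← Finset.sum_sub_distrib]
      exact Submodule.sum_mem _ fun s _ => (h0 s).2
    have := sub_mem (hdz n) h1
    rwa [sub_sub_cancel] at this
  -- This is the part of ∂_t(zΩ) linear in x_t, with z replaced by a where x_t is absent.
  have hab : ∀ n, n t = 0 →
      kdiff (gen k) b n + (-1 : k) ^ p • a n ∈ osRel k (N ／ {t}) (p + 1) := by
    intro n hn
    have h1 := bd_wt_mem_contract ht (hdz (n + Finsupp.single t 1))
    rw [bd_wt_kdiff hz, shift_add_single] at h1
    have h2 := kdiff_translate (e := gen k) t (fun m => bd (wt k {t}) (z m)) n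
    rw [if_pos hn, eq_sub_iff_add_eq] at h2
    rw [hbdef, kdiff_constPart hn]
    have h3 := Submodule.smul_mem _ ((-1 : k) ^ p) (osRel_le_contract ht (haz n hn))
    have h4 : bd (wt k {t}) (z n) * gen k t ∈ osRel k (N ／ {t}) (p + 1) :=
      mul_gen_mem_osRel t (hzt n hn)
    rw [← h2] at h1
    convert sub_mem (sub_mem h1 h4) h3 using 1
    rw [smul_sub]
    abel
  obtain ⟨u, d, hu, hd, hau, hbud⟩ := exists_delete_contract ht hC hD hp ha' hb
    (fun n hn => constPart_of_ne_zero hn) hda hab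
  have hku : ∀ n, kill k {t}ᶜ (u n) ∈ extDeg k {t}ᶜ p := fun n => by
    have := kill_mem (Z := {t}ᶜ) (hu n)
    rwa [univ_inter] at this
  have hku' : ∀ n, kill k {t}ᶜ (u n) ∈ extDeg k univ p := fun n =>
    extDeg_mono (subset_univ _) _ (hku n)
  set u' : (X →₀ ℕ) → ExtAlg k X := constPart t fun n => kill k {t}ᶜ (u n) with hu'
  set d' : (X →₀ ℕ) → ExtAlg k X := constPart t fun n => gen k t * d n with hd'
  have hd'd : ∀ n, d' n ∈ extDeg k univ p :=
    constPart_mem fun n => gen_mul_mem_extDeg_pred t (hd n)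
  -- The series u cancels the x_t-free part of z, and x_t e_t d cancels the residue of the part
  -- linear in x_t that is left.
  set w := u' + shift t d' with hw
  have hwd : ∀ n, w n ∈ extDeg k univ p := fun n =>
    add_mem (constPart_mem hku' n) (shift_mem hd'd t n)
  set y := z - kdiff (gen k) w with hy
  have hyd : ∀ n, y n ∈ extDeg k univ (p + 1) := fun n =>
    sub_mem (hz n) (kdiff_mem_extDeg hwd n)
  have hdy : ∀ n, kdiff (gen k) y n ∈ osRel k N (p + 2) := fun n => by
    rw [hy, kdiff_sub, Pi.sub_apply, kdiff_gen_kdiff, sub_zero]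
    exact hdz n
  have hy0 : ∀ n, n t = 0 → y n ∈ osRel k N (p + 1) := by
    intro n hn
    have h1 : kill k {t}ᶜ (kdiff (gen k) u n) = kdiff (gen k) (fun m => kill k {t}ᶜ (u m)) n := by
      unfold kdiff
      rw [map_sum]
      refine Finset.sum_congr rfl fun s _ => ?_
      rw [map_mul, shift_comp]
      by_cases hs : n s = 0
      · rw [shift_of_eq_zero hs, zero_mul, zero_mul]
      · rw [kill_gen]
        rintro rfl
        exact hs hn
    have h2 := kill_compl_mem_osRel (hau n hn)
    rw [map_sub, kill_of_mem (ha n), h1] at h2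
    rw [hy, hw, kdiff_add, kdiff_shift, Pi.sub_apply, Pi.add_apply, shift_of_eq_zero hn, add_zero,
      hu', kdiff_constPart hn]
    convert add_mem (haz n hn) h2 using 1
    abel
  refine ⟨w, fun n => y (n + Finsupp.single t 1), hwd, fun n => hyd _, fun n => ?_, fun n hn => ?_,
    fun n => ?_⟩
  · rw [kdiff_translate]
    split_ifs with hn
    · exact sub_mem (hdy _) (mul_gen_mem_osRel t (hy0 n hn))
    · rw [sub_zero]; exact hdy _
  · have h1 : kdiff (gen k) u' (n + Finsupp.single t 1) = kill k {t}ᶜ (u n) * gen k t := by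
      rw [kdiff_eq_of_ne_zero (fun m hm => constPart_of_ne_zero hm) (by simp), shift_add_single,
        constPart_of_eq_zero hn]
    change bd (wt k {t}) (y (n + Finsupp.single t 1)) ∈ _
    rw [hy, hw, kdiff_add, kdiff_shift, Pi.sub_apply, Pi.add_apply, shift_add_single, h1, hd',
      kdiff_constPart hn, kdiff_mul_left, map_sub, map_add, bd_wt_mul_gen (hku n), bd_wt_gen_mul]
    have h2 := hbud n hn
    rw [hbdef, constPart_of_eq_zero hn] at h2
    have h3 := Submodule.smul_mem _ ((-1 : k) ^ p) (sub_kill_mem_osRel hnc (hu n))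
    have h4 := gen_mul_bd_mem_osRel (f := wt k {t}) hnc (kdiff_mem_extDeg_pred hd n)
    convert add_mem (sub_mem h2 h3) h4 using 1
    rw [smul_sub]
    abel
  · by_cases hn : n t = 0
    · rw [shift_of_eq_zero hn, sub_zero]
      exact hy0 n hn
    · obtain ⟨m, rfl⟩ := exists_eq_add_single hn
      rw [shift_add_single]
      change y _ - y _ ∈ _
      rw [sub_self]; exact zero_mem _

/-- If z − wΩ = x_t z' and u solves the problem for z' modulo x_t^m, then w + x_t u solves it for z
modulo x_t^(m+1). -/
theorem exists_sub_mem_of_lt [N.Loopless] (ht : N.Indep {t})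
    (hC : UniversallyExact k (N ／ {t})) (hD : UniversallyExact k (N ＼ {t}))
    (hp : ((p + 1 : ℕ) : ℕ∞) ≤ N.eRank) (m : ℕ) {z : (X →₀ ℕ) → ExtAlg k X}
    (hz : ∀ n, z n ∈ extDeg k univ (p + 1))
    (hdz : ∀ n, kdiff (gen k) z n ∈ osRel k N (p + 2))
    (hzt : ∀ n, n t = 0 → bd (wt k {t}) (z n) ∈ osRel k (N ／ {t}) p) :
    ∃ u : (X →₀ ℕ) → ExtAlg k X, (∀ n, u n ∈ extDeg k univ p) ∧
      ∀ n, n t < m → z n - kdiff (gen k) u n ∈ osRel k N (p + 1) := by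
  classical
  induction m generalizing z with
  | zero => exact ⟨fun _ => 0, fun _ => zero_mem _, fun n hn => absurd hn (Nat.not_lt_zero _)⟩
  | succ m ih =>
    obtain ⟨w, z', hw, hz', hdz', hzt', h⟩ := exists_sub_shift_mem ht hC hD hp hz hdz hzt
    obtain ⟨u, hu, hu'⟩ := ih hz' hdz' hzt'
    refine ⟨w + shift t u, fun n => add_mem (hw n) (shift_mem hu t n), fun n hn => ?_⟩
    have h1 : shift t z' n - shift t (kdiff (gen k) u) n ∈ osRel k N (p + 1) := by
      by_cases hn0 : n t = 0
      · rw [shift_of_eq_zero hn0, shift_of_eq_zero hn0, sub_zero]; exact zero_mem _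
      · obtain ⟨n, rfl⟩ := exists_eq_add_single hn0
        rw [shift_add_single, shift_add_single]
        refine hu' n ?_
        simpa using hn
    rw [kdiff_add, kdiff_shift, Pi.add_apply]
    convert add_mem (h n) h1 using 1
    abel

theorem universallyExact_of_delete_contract [N.Loopless] (ht : N.Indep {t})
    (hC : UniversallyExact k (N ／ {t})) (hD : UniversallyExact k (N ＼ {t})) :
    UniversallyExact k N := by
  classical
  rintro (_ | p) hq z hz hdz
  · refine ⟨fun _ => 0, fun _ => zero_mem _, fun n => ?_⟩
    rw [kdiff_zero, eq_zero_of_mem_extDeg_zero (hz n), sub_zero]; exact zero_mem _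
  have hp' : (p : ℕ∞) ≤ (N ／ {t}).eRank := by
    rw [← eRank_contract_add_one ht] at hq
    push_cast at hq
    exact (ENat.add_le_add_iff_right (by simp)).1 hq
  obtain ⟨w, hw, hwz⟩ := exists_bd_sub_mem_contract ht hC hp' hz hdz
  choose U hU hUz using fun m => exists_sub_mem_of_lt ht hC hD hq m
    (z := z - kdiff (gen k) w)
    (fun n => sub_mem (hz n) (kdiff_mem_extDeg hw n)) (fun n => by
      rw [kdiff_sub, Pi.sub_apply, kdiff_gen_kdiff, sub_zero]
      exact hdz n) hwz
  -- The approximate solutions need not be compatible. As Ω is linear in the variables, the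
  -- coefficient of uΩ at n involves only coefficients of u in total degree one less, so a different
  -- approximation may be used in each total degree. At n it is the one modulo x_t^(deg n + 1),
  -- which suffices as n t ≤ deg n.
  refine ⟨w + fun n => U (n.degree + 2) n, fun n => add_mem (hw n) (hU _ n), fun n => ?_⟩
  have h1 : kdiff (gen k) (fun n => U (n.degree + 2) n) n = kdiff (gen k) (U (n.degree + 1)) n := by
    refine kdiff_congr fun m s hm => ?_
    rw [hm, map_add, Finsupp.degree_single]
  rw [kdiff_add, Pi.add_apply, h1, ← sub_sub]
  exact hUz _ n (Nat.lt_succ_of_le (Finsupp.le_degree t n))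

/-- Induction on the size of the ground set. A loop kills the algebra, and for an empty ground set
the rank is 0, so that only q = 0, the zero space, is in range. -/
theorem universallyExact (N : Matroid X) : UniversallyExact k N := by
  classical
  induction h : N.E.ncard using Nat.strong_induction_on generalizing N with
  | _ c ih =>
  subst h
  by_cases hl : ∃ t, N.IsLoop t
  · obtain ⟨t, ht⟩ := hl
    intro q _ z hz _
    refine ⟨fun _ => 0, fun _ => zero_mem _, fun n => extDeg_le_osRel_of_isLoop ht ?_⟩
    rw [kdiff_zero, sub_zero]
    exact hz n
  · push Not at hl
    by_cases hE : N.E = ∅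
    · rintro (_ | p) hq z hz hdz
      · refine ⟨fun _ => 0, fun _ => zero_mem _, fun n => ?_⟩
        rw [kdiff_zero, eq_zero_of_mem_extDeg_zero (hz n), sub_zero]; exact zero_mem _
      · have := hq.trans N.eRank_le_encard_ground
        rw [hE] at this
        simp at this
    · obtain ⟨t, ht⟩ := nonempty_iff_ne_empty.2 hE
      have hti : N.Indep {t} := by
        by_contra h
        exact hl t ((Matroid.singleton_not_indep ht).1 h)
      have : N.Loopless := by
        rw [Matroid.loopless_iff_forall_not_isLoop]
        exact fun e _ => hl e
      have hlt : (N.E \ {t}).ncard < N.E.ncard := ncard_sdiff_singleton_lt_of_mem ht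
      exact universallyExact_of_delete_contract hti (ih _ hlt (N ／ {t}) rfl)
        (ih _ hlt (N ＼ {t}) rfl)

end UniversalExactness

/-! ### Propagation of exactness -/

section Propagation

variable {k A X : Type*} [Field k] [Ring A] [Algebra k A] [Fintype X] {e : X → A}

/-- A power series u cannot be evaluated at v, but uΩ is a polynomial here. Since Ω is homogeneous
of degree 1, uΩ is unchanged up to degree m + 1 when u is truncated at degree m, and the truncation
can be evaluated. -/
theorem exists_sum_smul_kdiff (v : X → k) {P : Submodule k A} {u : (X →₀ ℕ) → A}
    (hu : ∀ n, u n ∈ P) (S : Finset (X →₀ ℕ)) (hS : ∀ n, n ∉ S → kdiff e u n = 0) :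
    ∃ a ∈ P, ∑ n ∈ S, (∏ s, v s ^ n s) • kdiff e u n = a * ∑ s, v s • e s := by
  classical
  have hfin : ∀ m : ℕ, {n : X →₀ ℕ | n.degree ≤ m}.Finite := Finsupp.finite_of_degree_le
  obtain ⟨m, hm⟩ : ∃ m, ∀ n ∈ S, n.degree ≤ m + 1 :=
    ⟨S.sup Finsupp.degree, fun n hn => (Finset.le_sup (f := Finsupp.degree) hn).trans (by omega)⟩
  refine ⟨∑ n ∈ (hfin m).toFinset, (∏ s, v s ^ n s) • u n,
    Submodule.sum_mem _ fun n _ => Submodule.smul_mem _ _ (hu n), ?_⟩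
  have h1 : ∑ n ∈ S, (∏ s, v s ^ n s) • kdiff e u n =
      ∑ n ∈ (hfin (m + 1)).toFinset, (∏ s, v s ^ n s) • kdiff e u n :=
    Finset.sum_subset (fun n hn => by simpa using hm n hn) fun n _ hn => by rw [hS n hn, smul_zero]
  have h2 : ∀ s, ∑ n ∈ (hfin (m + 1)).toFinset, (∏ s, v s ^ n s) • shift s u n =
      v s • ∑ n ∈ (hfin m).toFinset, (∏ s, v s ^ n s) • u n := by
    intro s
    rw [Finset.smul_sum]
    symm
    refine Finset.sum_of_injOn (fun n => n + Finsupp.single s 1) ?_ ?_ ?_ ?_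
    · intro a _ b _ h
      exact add_right_cancel h
    · intro n hn
      simpa [Finsupp.degree_single] using hn
    · intro n hn hn'
      by_cases hs : n s = 0
      · rw [shift_of_eq_zero hs, smul_zero]
      · obtain ⟨n, rfl⟩ := exists_eq_add_single hs
        refine absurd ⟨n, ?_, rfl⟩ hn'
        simpa [Finsupp.degree_single] using hn
    · intro n _
      rw [shift_add_single, smul_smul]
      congr 1
      have : ∀ t, v t ^ ((n + Finsupp.single s 1 : X →₀ ℕ) t) = v t ^ n t * (if t = s then v s else 1) := by
        intro t
        rw [Finsupp.add_apply, pow_add]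
        by_cases h : t = s
        · subst h; simp
        · simp [h]
      simp only [this, Finset.prod_mul_distrib, Finset.prod_ite_eq', Finset.mem_univ, if_true]
      rw [mul_comm]
  rw [h1]
  unfold kdiff
  simp only [Finset.smul_sum, ← smul_mul_assoc]
  rw [Finset.sum_comm]
  simp only [← Finset.sum_mul, h2, Finset.mul_sum]
  refine Finset.sum_congr rfl fun s _ => ?_
  rw [smul_mul_assoc, mul_smul_comm]

/-- The polynomial with coefficients in `A` given by a combination of elements of `A` with
coefficients which are polynomials. -/
noncomputable def polyComb {J : Type*} [Fintype J] (c : J → MvPolynomial X k) (a : J → A)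
    (n : X →₀ ℕ) : A := ∑ j, (c j).coeff n • a j

/-- The linear form `κ (a ∑ x_s e_s)`. -/
noncomputable def linForm (e : X → A) (κ : A →ₗ[k] k) (a : A) : MvPolynomial X k :=
  ∑ s, MvPolynomial.X s * MvPolynomial.C (κ (a * e s))

theorem eval_linForm (v : X → k) (κ : A →ₗ[k] k) (a : A) :
    MvPolynomial.eval v (linForm e κ a) = κ (a * ∑ s, v s • e s) := by
  simp [linForm, Finset.mul_sum]

theorem apply_kdiff_polyComb {J : Type*} [Fintype J] (κ : A →ₗ[k] k) (c : J → MvPolynomial X k)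
    (a : J → A) (n : X →₀ ℕ) :
    κ (kdiff e (polyComb c a) n) = (∑ j, c j * linForm e κ (a j)).coeff n := by
  classical
  unfold kdiff linForm
  rw [map_sum]
  simp only [Finset.mul_sum, MvPolynomial.coeff_sum]
  rw [Finset.sum_comm]
  refine Finset.sum_congr rfl fun s _ => ?_
  have h : ∀ j, (c j * (MvPolynomial.X s * MvPolynomial.C (κ (a j * e s)))).coeff n =
      (if n s = 0 then 0 else (c j).coeff (n - Finsupp.single s 1)) * κ (a j * e s) := by
    intro j
    rw [show c j * (MvPolynomial.X s * MvPolynomial.C (κ (a j * e s))) =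
      MvPolynomial.C (κ (a j * e s)) * (MvPolynomial.X s * c j) by ring, MvPolynomial.coeff_C_mul,
      MvPolynomial.coeff_X_mul', mul_comm]
    by_cases hs : n s = 0 <;> simp [hs]
  simp only [h]
  by_cases hs : n s = 0
  · simp [hs, shift_of_eq_zero hs]
  · simp [hs, shift, polyComb, Finset.sum_mul]

theorem polyComb_eq_zero {J : Type*} [Fintype J] (c : J → MvPolynomial X k) (a : J → A) :
    ∃ S : Finset (X →₀ ℕ), (∀ n, n ∉ S → polyComb c a n = 0) ∧
      ∀ T, S ⊆ T → ∀ v : X → k, ∑ n ∈ T, (∏ s, v s ^ n s) • polyComb c a n =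
        ∑ j, MvPolynomial.eval v (c j) • a j := by
  classical
  refine ⟨Finset.univ.biUnion fun j => (c j).support, fun n hn => ?_, fun T hT v => ?_⟩
  · refine Finset.sum_eq_zero fun j _ => ?_
    rw [MvPolynomial.notMem_support_iff.1, zero_smul]
    exact fun h => hn (Finset.mem_biUnion.2 ⟨j, Finset.mem_univ j, h⟩)
  · unfold polyComb
    simp only [Finset.smul_sum]
    rw [Finset.sum_comm]
    refine Finset.sum_congr rfl fun j _ => ?_
    rw [MvPolynomial.eval_eq', Finset.sum_smul]
    symm
    refine (Finset.sum_subset ?_ fun n _ hn => ?_).trans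
      (Finset.sum_congr rfl fun n _ => by rw [smul_smul, mul_comm])
    · exact (Finset.subset_biUnion_of_mem (fun j => (c j).support) (Finset.mem_univ j)).trans hT
    · rw [MvPolynomial.notMem_support_iff.1 hn, zero_mul, zero_smul]

theorem eval_det_linForm {J : Type*} [Fintype J] [DecidableEq J] {v : X → k} {κ : J → A →ₗ[k] k}
    {a : J → A} (h : ∀ i j, κ j (a i * ∑ s, v s • e s) = if i = j then 1 else 0) :
    MvPolynomial.eval v (Matrix.of fun i j => linForm e (κ j) (a i)).det = 1 := by
  rw [RingHom.map_det]
  rw [← Matrix.det_one (n := J) (R := k)]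
  congr 1
  ext i j
  simp [eval_linForm, h, Matrix.one_apply]

/-- Given exactness at v in the next degree, the cocycle x is the value at v of a universal cocycle
ζ with polynomial coefficients. Universal exactness makes ζ a coboundary, and evaluation at v makes
x one. -/
theorem exists_eq_mul_of_universallyExact
    (h1 : ∀ s t, e s * e t = - (e t * e s)) (h2 : ∀ s, e s * e s = 0) {P₀ P₁ P₂ : Submodule k A}
    [FiniteDimensional k P₂] (hP : ∀ x ∈ P₁, ∀ s, x * e s ∈ P₂)
    (hE : ∀ z : (X →₀ ℕ) → A, (∀ n, z n ∈ P₁) → (∀ n, kdiff e z n = 0) →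
      ∃ u : (X →₀ ℕ) → A, (∀ n, u n ∈ P₀) ∧ ∀ n, z n = kdiff e u n)
    (v : X → k) (hv : ∀ x ∈ P₂, x * ∑ s, v s • e s = 0 → ∃ u ∈ P₁, x = u * ∑ s, v s • e s)
    {x : A} (hx : x ∈ P₁) (hxv : x * ∑ s, v s • e s = 0) :
    ∃ u ∈ P₀, x = u * ∑ s, v s • e s := by
  classical
  set ω := ∑ s, v s • e s with hω
  have hPω : ∀ x ∈ P₁, x * ω ∈ P₂ := fun x hx => by
    rw [hω, Finset.mul_sum]
    refine Submodule.sum_mem _ fun s _ => ?_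
    rw [mul_smul_comm]
    exact Submodule.smul_mem _ _ (hP x hx s)
  set W : Submodule k A := P₁.map (LinearMap.mulRight k ω) with hW
  have hWP : W ≤ P₂ := by
    rintro _ ⟨y, hy, rfl⟩
    exact hPω y hy
  have : FiniteDimensional k W := Submodule.finiteDimensional_of_le hWP
  let bW := Module.finBasis k W
  have hu : ∀ i, ∃ u ∈ P₁, u * ω = bW i := fun i => by
    obtain ⟨u, hu, h⟩ := (bW i).2
    exact ⟨u, hu, h⟩
  choose u huP hu using hu
  obtain ⟨π, hπ⟩ := LinearMap.exists_leftInverse_of_injective W.subtype W.ker_subtype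
  have hπ' : ∀ w : W, π w = w := fun w => LinearMap.congr_fun hπ w
  let lam : Fin (Module.finrank k W) → A →ₗ[k] k := fun i => bW.coord i ∘ₗ π
  -- The coordinates in W of the products u_i Ω. At v this is the identity matrix, so the
  -- determinant is 1 there.
  set M : Matrix _ _ (MvPolynomial X k) := Matrix.of fun i j => linForm e (lam j) (u i) with hM
  have hdet : MvPolynomial.eval v M.det = 1 := eval_det_linForm fun i j => by
    rw [← hω, hu]
    simp [lam, hπ', Finsupp.single_apply]
  let y : Fin (Module.finrank k W) → MvPolynomial X k := fun j => linForm e (lam j) x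
  -- Cramer's rule: with these coefficients ζ = det M · x − ∑ c_i u_i has ζΩ without component in W.
  -- As xω = 0, the c_i vanish at v, whence ζ(v) = x.
  set c := Matrix.vecMul y M.adjugate with hc
  have hcM : Matrix.vecMul c M = M.det • y := by
    rw [hc, Matrix.vecMul_vecMul, Matrix.adjugate_mul, Matrix.vecMul_smul, Matrix.vecMul_one]
  have hcv : ∀ i, MvPolynomial.eval v (c i) = 0 := fun i => by
    have : ∀ j, MvPolynomial.eval v (y j) = 0 := fun j => by
      rw [eval_linForm, ← hω, hxv, map_zero]
    simp [hc, Matrix.vecMul, dotProduct, this]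
  let c' : Option (Fin (Module.finrank k W)) → MvPolynomial X k := fun o => o.elim M.det fun i => - c i
  let a' : Option (Fin (Module.finrank k W)) → A := fun o => o.elim x u
  set ζ : (X →₀ ℕ) → A := polyComb c' a' with hζ
  have hζP : ∀ n, ζ n ∈ P₁ := fun n => Submodule.sum_mem _ fun o _ => Submodule.smul_mem _ _ (by
    cases o with
    | none => exact hx
    | some i => exact huP i)
  have hζ2 : ∀ n, kdiff e ζ n ∈ P₂ := fun n =>
    Submodule.sum_mem _ fun s _ => hP _ (shift_mem hζP s n) s
  have hlam : ∀ n j, lam j (kdiff e ζ n) = 0 := by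
    intro n j
    rw [hζ, apply_kdiff_polyComb, Fintype.sum_option]
    have := congrFun hcM j
    simp only [Matrix.vecMul, dotProduct, hM, Matrix.of_apply, Pi.smul_apply, smul_eq_mul] at this
    simp only [c', a', Option.elim, neg_mul, Finset.sum_neg_distrib]
    rw [this, add_neg_cancel, MvPolynomial.coeff_zero]
  set W' : Submodule k A := P₂ ⊓ LinearMap.ker π with hW'
  have hζW : ∀ n, kdiff e ζ n ∈ W' := fun n => by
    refine ⟨hζ2 n, ?_⟩
    change π (kdiff e ζ n) = 0
    rw [← bW.repr.map_eq_zero_iff]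
    ext j
    exact hlam n j
  have : FiniteDimensional k W' := Submodule.finiteDimensional_of_le inf_le_left
  let bW' := Module.finBasis k W'
  -- Exactness in degree P₂ puts the kernel of multiplication by ω on P₂ inside W, which meets the
  -- kernel of π trivially.
  have hinj : LinearMap.ker (LinearMap.mulRight k ω ∘ₗ W'.subtype) = ⊥ := by
    rw [LinearMap.ker_eq_bot']
    rintro ⟨w, hw2, hwπ⟩ hw0
    obtain ⟨u, hu, rfl⟩ := hv w hw2 hw0
    have h3 := hπ' ⟨u * ω, u, hu, rfl⟩
    rw [LinearMap.mem_ker.1 hwπ] at h3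
    ext
    exact (congrArg Subtype.val h3).symm
  obtain ⟨L, hL⟩ := LinearMap.exists_leftInverse_of_injective _ hinj
  obtain ⟨π', hπ2⟩ := LinearMap.exists_leftInverse_of_injective W'.subtype W'.ker_subtype
  let mu : Fin (Module.finrank k W') → A →ₗ[k] k := fun j => bW'.coord j ∘ₗ L
  set M' : Matrix _ _ (MvPolynomial X k) :=
    Matrix.of fun i j => linForm e (mu j) (bW' i : A) with hM'
  have hdet' : MvPolynomial.eval v M'.det = 1 := eval_det_linForm fun i j => by
    have : L (bW' i * ω) = bW' i := LinearMap.congr_fun hL (bW' i)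
    rw [← hω]
    simp [mu, this, Finsupp.single_apply]
  let d : Fin (Module.finrank k W') → MvPolynomial X k := fun j =>
    ∑ o, c' o * linForm e (bW'.coord j ∘ₗ π') (a' o)
  have hd : kdiff e ζ = polyComb d fun j => (bW' j : A) := by
    ext n
    have h3 : ∀ j, (d j).coeff n = bW'.repr ⟨_, hζW n⟩ j := fun j => by
      rw [← apply_kdiff_polyComb]
      have : π' (kdiff e ζ n) = ⟨_, hζW n⟩ := LinearMap.congr_fun hπ2 ⟨_, hζW n⟩
      rw [LinearMap.comp_apply, ← hζ, this]
      rfl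
    simp only [polyComb, h3]
    have h4 := congrArg W'.subtype (bW'.sum_repr ⟨_, hζW n⟩)
    rw [map_sum] at h4
    exact h4.symm
  -- Ω² = 0 says that the coordinate vector d of ζΩ is annihilated by M', whose determinant is a
  -- nonzero polynomial since it is 1 at v. So ζΩ = 0.
  have hd0 : d = 0 := by
    refine Matrix.eq_zero_of_vecMul_eq_zero (M := M') (fun h => ?_) ?_
    · rw [h, map_zero] at hdet'
      exact zero_ne_one hdet'
    · ext j n
      have h3 := kdiff_kdiff h1 h2 ζ n
      have h4 := apply_kdiff_polyComb (e := e) (mu j) d (fun j => (bW' j : A)) n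
      rw [← hd, h3, map_zero] at h4
      simp only [Matrix.vecMul, dotProduct, hM', Matrix.of_apply]
      rw [← h4]
      rfl
  obtain ⟨w, hw, hζw⟩ := hE ζ hζP fun n => by
    rw [hd, hd0]
    simp [polyComb]
  obtain ⟨S, hS, hS'⟩ := polyComb_eq_zero c' a'
  obtain ⟨a, ha, h⟩ := exists_sum_smul_kdiff (e := e) v hw S fun n hn => by
    rw [← hζw, hζ, hS n hn]
  refine ⟨a, ha, ?_⟩
  simp only [← hζw, hζ] at h
  rw [hS' S subset_rfl v, Fintype.sum_option] at h
  simpa [c', a', hcv, hdet] using h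

end Propagation

/-! ### The Orlik-Solomon algebra in terms of dependent sets -/

section DependentSets

variable {k : Type*} [Field k] {X : Type*}

theorem exists_perm_append {l m : List X} (hl : l.Nodup) (h : l ⊆ m) :
    ∃ r, m.Perm (l ++ r) := by
  obtain ⟨l', hl', hs⟩ := List.subperm_of_subset hl h
  obtain ⟨r, hr⟩ := hs.exists_perm_append
  exact ⟨r, hr.trans (hl'.append_right r)⟩

theorem bd_mon_mul {f : X → k} (l : List X) (y : ExtAlg k X) : bd f (mon k l * y) =
    bd f (mon k l) * y + (-1 : k) ^ l.length • (mon k l * bd f y) := by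
  induction l with
  | nil => simp
  | cons s l ih =>
    rw [mon_cons, mul_assoc, bd_gen_mul, ih, bd_gen_mul, List.length_cons, pow_succ, sub_mul,
      mul_add, mul_assoc, smul_mul_assoc, mul_smul_comm, mul_neg_one, neg_smul, mul_assoc]
    abel

variable (k) in
/-- The relations of the Orlik-Solomon algebra, in all degrees. -/
noncomputable def osTot (N : Matroid X) : Submodule k (ExtAlg k X) := ⨆ q, osRel k N q

variable {N : Matroid X} {x : ExtAlg k X} {q : ℕ}

theorem osRel_le_osTot (N : Matroid X) (q : ℕ) : osRel k N q ≤ osTot k N :=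
  le_iSup (fun q => osRel k N q) q

theorem mul_mem_osTot_left (y : ExtAlg k X) (hx : x ∈ osTot k N) : y * x ∈ osTot k N := by
  have hg : ∀ s, ∀ x ∈ osTot k N, gen k s * x ∈ osTot k N := by
    intro s
    change osTot k N ≤ (osTot k N).comap (LinearMap.mulLeft k (gen k s))
    exact iSup_le fun q x hx => osRel_le_osTot N (q + 1) (gen_mul_mem_osRel s hx)
  change y ∈ (osTot k N).comap (LinearMap.mulRight k x)
  refine exterior_induction (fun l => ?_) y
  change mon k l * x ∈ osTot k N
  induction l with
  | nil => simpa using hx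
  | cons s l ih => rw [mon_cons, mul_assoc]; exact hg s _ ih

theorem mul_mem_osTot_right (y : ExtAlg k X) (hx : x ∈ osTot k N) : x * y ∈ osTot k N := by
  have hg : ∀ s, ∀ x ∈ osTot k N, x * gen k s ∈ osTot k N := by
    intro s
    change osTot k N ≤ (osTot k N).comap (LinearMap.mulRight k (gen k s))
    exact iSup_le fun q x hx => osRel_le_osTot N (q + 1) (mul_gen_mem_osRel s hx)
  change y ∈ (osTot k N).comap (LinearMap.mulLeft k x)
  refine exterior_induction (fun l => ?_) y
  change x * mon k l ∈ osTot k N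
  induction l generalizing x with
  | nil => simpa using hx
  | cons s l ih => rw [mon_cons, ← mul_assoc]; exact ih (hg s _ hx)

/-- The ideal is spanned by homogeneous elements, so it is stable under the projections of the
grading. -/
theorem mem_osRel_of_mem_osTot (hx : x ∈ osTot k N) (hq : x ∈ extDeg k univ (q + 1)) :
    x ∈ osRel k N (q + 1) := by
  let 𝒜 : ℕ → Submodule k (ExtAlg k X) := fun i => ⋀[k]^i (X →₀ k)
  have h1 : ∀ y ∈ extDeg k univ (q + 1), GradedAlgebra.proj 𝒜 q y = y := fun y hy => by
    rw [GradedAlgebra.proj_apply]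
    rw [extDeg_univ_eq] at hy
    exact DirectSum.decompose_of_mem_same 𝒜 hy
  have h2 : ∀ p ≠ q + 1, ∀ y ∈ extDeg k univ p, GradedAlgebra.proj 𝒜 q y = 0 := by
    rintro (_ | p) hp y hy
    · rw [eq_zero_of_mem_extDeg_zero hy, map_zero]
    · rw [GradedAlgebra.proj_apply]
      rw [extDeg_univ_eq] at hy
      exact DirectSum.decompose_of_mem_ne 𝒜 hy (by omega)
  suffices osTot k N ≤ (osRel k N (q + 1)).comap (GradedAlgebra.proj 𝒜 q) by
    have h := this hx
    rwa [Submodule.mem_comap, h1 x hq] at h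
  refine iSup_le fun p y hy => ?_
  rw [Submodule.mem_comap]
  by_cases hp : p = q + 1
  · subst hp
    rwa [h1 y (osRel_le_extDeg hy)]
  · rw [h2 p hp y (osRel_le_extDeg hy)]
    exact zero_mem _

end DependentSets

/-! ### The quotient algebra, vanishing of its cohomology, and propagation -/

section OSAlgebra

variable (k : Type*) [Field k] {α : Type*} (M : Matroid α)

theorem wt_restrictSubtype : wt k (M.restrictSubtype M.E).E = fun _ => (1 : k) := by
  ext s
  exact wt_of_mem (by simp)

theorem extBoundary_eq : extBoundary k M = bd (wt k (M.restrictSubtype M.E).E) := by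
  rw [wt_restrictSubtype]; rfl

theorem osMk_eq_zero_iff_mem_osIdeal (x : ExtAlg k M.E) : osMk k M x = 0 ↔ x ∈ osIdeal k M := by
  rw [TwoSidedIdeal.mem_iff]
  exact RingCon.eq _

variable {M} in
theorem exists_circuit_list {l : List M.E} (hl : ¬ M.Indep ((fun s : M.E => (s : α)) '' {s | s ∈ l})) :
    ∃ m : List M.E, m.Nodup ∧ m ⊆ l ∧ M.IsCircuit ((fun s : M.E => (s : α)) '' {s | s ∈ m}) := by
  classical
  have hd : M.Dep ((fun s : M.E => (s : α)) '' {s | s ∈ l}) :=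
    ⟨hl, by rintro _ ⟨s, -, rfl⟩; exact s.2⟩
  obtain ⟨C, hC, hCc⟩ := hd.exists_isCircuit_subset
  refine ⟨(l.filter fun s : M.E => (s : α) ∈ C).dedup, List.nodup_dedup _, fun s hs => ?_, ?_⟩
  · exact (List.mem_filter.1 (List.mem_dedup.1 hs)).1
  · convert hCc
    ext x
    constructor
    · rintro ⟨s, hs, rfl⟩
      simpa using (List.mem_filter.1 (List.mem_dedup.1 hs)).2
    · intro hx
      obtain ⟨s, hs, rfl⟩ := hC hx
      exact ⟨s, List.mem_dedup.2 (List.mem_filter.2 ⟨hs, by simpa using hx⟩), rfl⟩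

-- For s in C, contracting e_s e_C = 0 gives e_C = e_s ∂e_C, so e_C lies in the ideal together with
-- ∂e_C.
variable {M} in
theorem osMk_mon_of_isCircuit {l : List M.E} (hd : l.Nodup)
    (hl : M.IsCircuit ((fun s : M.E => (s : α)) '' {s | s ∈ l})) :
    osMk k M (bd (fun _ => 1) (mon k l)) = 0 ∧ osMk k M (mon k l) = 0 := by
  have h1 : osMk k M (bd (fun _ => 1) (mon k l)) = 0 := by
    rw [osMk_eq_zero_iff_mem_osIdeal]
    exact TwoSidedIdeal.subset_span ⟨l, hd, hl, rfl⟩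
  refine ⟨h1, ?_⟩
  obtain ⟨_, s, hs, -⟩ := hl.nonempty
  have h := bd_gen_mul (f := fun _ => (1 : k)) s (mon k l)
  rw [gen_mul_mon_of_mem k hs, map_zero, one_smul, eq_comm, sub_eq_zero] at h
  rw [h, map_mul, h1, mul_zero]

variable {M} in
theorem osMk_mon_of_not_indep {l : List M.E}
    (hl : ¬ M.Indep ((fun s : M.E => (s : α)) '' {s | s ∈ l})) :
    osMk k M (bd (fun _ => 1) (mon k l)) = 0 ∧ osMk k M (mon k l) = 0 := by
  obtain ⟨m, hm, hml, hC⟩ := exists_circuit_list hl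
  obtain ⟨h1, h2⟩ := osMk_mon_of_isCircuit k hm hC
  obtain ⟨r, hr⟩ := exists_perm_append hm hml
  have h3 : osMk k M (mon k (m ++ r)) = 0 := by rw [mon_append, map_mul, h2, zero_mul]
  have h4 : osMk k M (bd (fun _ => 1) (mon k (m ++ r))) = 0 := by
    rw [mon_append, bd_mon_mul, map_add, map_mul, h1, zero_mul, map_smul, map_mul, h2, zero_mul,
      smul_zero, add_zero]
  rcases mon_perm k hr with h | h <;> rw [h]
  · exact ⟨h4, h3⟩
  · rw [map_neg, map_neg, map_neg, h3, h4, neg_zero]; exact ⟨rfl, rfl⟩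

/-- The passage from the ideal generated by circuits to an explicit linear span. The span is an
ideal containing the generators; conversely a dependent list contains a circuit, and the Leibniz
rule applies. -/
theorem osMk_eq_zero_iff (x : ExtAlg k M.E) :
    osMk k M x = 0 ↔ x ∈ osTot k (M.restrictSubtype M.E) := by
  constructor
  · rw [osMk_eq_zero_iff_mem_osIdeal]
    let I : TwoSidedIdeal (ExtAlg k M.E) := TwoSidedIdeal.mk' (osTot k (M.restrictSubtype M.E))
      (zero_mem _) (fun hx hy => add_mem hx hy) (fun hx => neg_mem hx)
      (fun {x _} hy => mul_mem_osTot_left x hy) fun {_ y} hx => mul_mem_osTot_right y hx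
    have hI : osIdeal k M ≤ I := by
      refine TwoSidedIdeal.span_le.2 ?_
      rintro _ ⟨l, -, hl, rfl⟩
      refine (TwoSidedIdeal.mem_mk' ..).2 (osRel_le_osTot _ l.length ?_)
      rw [extBoundary_eq]
      exact bd_mon_mem_osRel (fun h => hl.not_indep (Matroid.restrictSubtype_indep_iff.1 h)) rfl
    exact fun hx => (TwoSidedIdeal.mem_mk' ..).1 (hI hx)
  · suffices osTot k (M.restrictSubtype M.E) ≤ LinearMap.ker (osMk k M).toLinearMap from
      fun hx => this hx
    refine iSup_le fun q => osRel_le (fun l hl _ => ?_) fun l hl _ => ?_ <;>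
      rw [Matroid.restrictSubtype_indep_iff] at hl
    · exact (osMk_mon_of_not_indep k hl).2
    · rw [wt_restrictSubtype]
      exact (osMk_mon_of_not_indep k hl).1

theorem osMk_induction {P : Submodule k (ExtAlg k M.E)}
    (h : ∀ l : List M.E, ¬ M.Indep ((fun s : M.E => (s : α)) '' {s | s ∈ l}) →
      mon k l ∈ P ∧ bd (fun _ => 1) (mon k l) ∈ P) {x : ExtAlg k M.E} (hx : osMk k M x = 0) :
    x ∈ P := by
  rw [osMk_eq_zero_iff] at hx
  suffices osTot k (M.restrictSubtype M.E) ≤ P from this hx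
  refine iSup_le fun q => osRel_le (fun l hl _ => ?_) fun l hl _ => ?_ <;>
    rw [Matroid.restrictSubtype_indep_iff] at hl
  · exact (h l hl).1
  · rw [wt_restrictSubtype]
    exact (h l hl).2

theorem osMk_bd_eq_zero {x : ExtAlg k M.E} (hx : osMk k M x = 0) :
    osMk k M (bd (fun _ => 1) x) = 0 := by
  change x ∈ LinearMap.ker ((osMk k M).toLinearMap ∘ₗ bd (fun _ => (1 : k)))
  refine osMk_induction k M (fun l hl => ⟨(osMk_mon_of_not_indep k hl).1, ?_⟩) hx
  rw [LinearMap.mem_ker, LinearMap.comp_apply, bd_bd, map_zero]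

/-- The vanishing of the cohomology `H^p(A(M), ·v)`. -/
def OSExact (p : ℕ) (v : VSpace k M) : Prop :=
  ∀ x ∈ extDeg k univ (p + 1), osMk k M (x * ExteriorAlgebra.ι k v) = 0 →
    ∃ u ∈ extDeg k univ p, osMk k M x = osMk k M (u * ExteriorAlgebra.ι k v)

theorem osGraded_eq (p : ℕ) :
    osGraded k M p = (extDeg k univ (p + 1)).map (osMk k M).toLinearMap := by
  rw [osGraded, extDeg_univ_eq]

theorem mem_osCoboundaries_iff (p : ℕ) (v : VSpace k M) (y : OSAlgebra k M) :
    y ∈ osCoboundaries k M p v ↔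
      ∃ u ∈ extDeg k univ p, y = osMk k M (u * ExteriorAlgebra.ι k v) := by
  cases p with
  | zero =>
    rw [osCoboundaries, Submodule.mem_bot]
    constructor
    · rintro rfl
      exact ⟨0, zero_mem _, by rw [zero_mul, map_zero]⟩
    · rintro ⟨u, hu, rfl⟩
      rw [eq_zero_of_mem_extDeg_zero hu, zero_mul, map_zero]
  | succ p =>
    rw [osCoboundaries, osGraded_eq]
    constructor
    · rintro ⟨_, ⟨u, hu, rfl⟩, rfl⟩
      exact ⟨u, hu, by rw [map_mul]; rfl⟩
    · rintro ⟨u, hu, rfl⟩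
      exact ⟨_, ⟨u, hu, rfl⟩, by rw [map_mul]; rfl⟩

theorem mem_resonance_iff (p : ℕ) (v : VSpace k M) : v ∈ resonance k M p ↔ ¬ OSExact k M p v := by
  have h1 : v ∈ resonance k M p ↔ ¬ osCocycles k M p v ≤ osCoboundaries k M p v := by
    change 1 ≤ Module.rank k (OSCohomology k M p v) ↔ _
    rw [Cardinal.one_le_iff_ne_zero, Ne, rank_zero_iff, Submodule.Quotient.subsingleton_iff,
      Submodule.submoduleOf, Submodule.comap_subtype_eq_top]
  rw [h1, not_iff_not]
  constructor
  · intro h x hx hxv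
    exact (mem_osCoboundaries_iff k M p v _).1 (h ⟨osGraded_eq k M p ▸ ⟨x, hx, rfl⟩, by
      rw [map_mul] at hxv
      exact hxv⟩)
  · rintro h y ⟨hy, hyv⟩
    rw [osGraded_eq] at hy
    obtain ⟨x, hx, rfl⟩ := hy
    refine (mem_osCoboundaries_iff k M p v _).2 (h x hx ?_)
    rw [map_mul]
    exact hyv

theorem osExact_of_eRank_lt {p : ℕ} (hp : M.eRank < p) (v : VSpace k M) : OSExact k M p v := by
  intro x hx _
  refine ⟨0, zero_mem _, ?_⟩
  rw [zero_mul, map_zero]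
  suffices extDeg k univ (p + 1) ≤ LinearMap.ker (osMk k M).toLinearMap from this hx
  refine extDeg_le fun l _ hl => ?_
  change osMk k M (mon k l) = 0
  by_cases hd : l.Nodup
  · refine (osMk_mon_of_not_indep k fun hi => ?_).2
    have := hi.encard_le_eRank
    rw [Function.Injective.encard_image Subtype.val_injective, encard_setOf_mem hd,
      show l.length = p by omega] at this
    exact absurd hp (not_lt.2 this)
  · rw [mon_eq_zero k hd, map_zero]

theorem osExact_of_isLoop {t : α} (ht : M.IsLoop t) (p : ℕ) (v : VSpace k M) :
    OSExact k M p v := by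
  intro x hx _
  refine ⟨0, zero_mem _, ?_⟩
  have h := (osMk_mon_of_not_indep k (l := [⟨t, ht.mem_ground⟩]) (by
    have : (fun s : M.E => (s : α)) '' {s | s ∈ [(⟨t, ht.mem_ground⟩ : M.E)]} = {t} := by simp
    rw [this, Matroid.singleton_not_indep ht.mem_ground]
    exact ht)).1
  rw [mon_singleton, bd_gen, map_one, map_one] at h
  rw [zero_mul, map_zero, ← one_mul (osMk k M x), h, zero_mul]

theorem eRank_restrictSubtype_ground : (M.restrictSubtype M.E).eRank = M.eRank := by
  obtain ⟨B, hB⟩ := (M.restrictSubtype M.E).exists_isBase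
  have h := Matroid.restrictSubtype_isBase_iff.1 hB
  rw [Matroid.isBasis'_iff_isBasis_inter_ground, inter_self, Matroid.isBasis_ground_iff] at h
  rw [← hB.encard_eq_eRank, ← h.encard_eq_eRank,
    Function.Injective.encard_image Subtype.val_injective]

/-- The bound on p puts degree p below the rank, where the universal complex is exact. -/
theorem osExact_of_osExact_succ [M.Finite] {p : ℕ} (hp : ((p + 1 : ℕ) : ℕ∞) ≤ M.eRank)
    {v : VSpace k M} (h : OSExact k M (p + 1) v) : OSExact k M p v := by
  have := M.ground_finite.to_subtype
  have := Fintype.ofFinite M.E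
  let e : M.E → OSAlgebra k M := fun s => osMk k M (gen k s)
  let P : ℕ → Submodule k (OSAlgebra k M) := fun q =>
    (extDeg k univ q).map (osMk k M).toLinearMap
  have hω : ∑ s, v s • e s = osMk k M (ExteriorAlgebra.ι k v) := by
    rw [ι_eq_sum, map_sum]
    exact Finset.sum_congr rfl fun s _ => (map_smul _ _ _).symm
  have hfin : FiniteDimensional k (P (p + 2)) := by
    have : Module.Finite k (extDeg k (univ : Set M.E) (p + 2)) := by
      rw [extDeg_univ_eq]; infer_instance
    exact Module.Finite.map _ _
  have hk : ∀ (z : (M.E →₀ ℕ) → ExtAlg k M.E) n, osMk k M (kdiff (gen k) z n) =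
      kdiff e (fun m => osMk k M (z m)) n := fun z n => by
    unfold kdiff
    rw [map_sum]
    exact Finset.sum_congr rfl fun s _ => by rw [map_mul, shift_comp]
  intro x hx hxv
  obtain ⟨_, ⟨u, hu, rfl⟩, h'⟩ := exists_eq_mul_of_universallyExact (e := e) (P₀ := P p)
    (P₁ := P (p + 1)) (P₂ := P (p + 2))
    (fun s t => by rw [← map_mul, gen_mul_gen, map_neg, map_mul])
    (fun s => by rw [← map_mul, gen_mul_self, map_zero])
    (by
      rintro _ ⟨y, hy, rfl⟩ s
      exact ⟨y * gen k s, mul_gen_mem_extDeg (mem_univ s) hy, map_mul (osMk k M) _ _⟩)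
    (fun z hz hdz => by
      choose z' hz' hzz using hz
      obtain rfl : (fun n => osMk k M (z' n)) = z := funext hzz
      obtain ⟨u, hu, h⟩ := universallyExact (k := k) (M.restrictSubtype M.E) (p + 1)
        (by rwa [eRank_restrictSubtype_ground]) z' hz' fun n =>
          mem_osRel_of_mem_osTot ((osMk_eq_zero_iff k M _).1 (by rw [hk, hdz]))
            (kdiff_mem_extDeg hz' n)
      refine ⟨fun n => osMk k M (u n), fun n => ⟨u n, hu n, rfl⟩, fun n => ?_⟩
      rw [← hk, ← sub_eq_zero, ← map_sub, osMk_eq_zero_iff]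
      exact osRel_le_osTot _ _ (h n))
    v
    (by
      rintro _ ⟨y, hy, rfl⟩ hyv
      rw [hω] at hyv ⊢
      obtain ⟨u, hu, h'⟩ := h y hy (by rw [map_mul]; exact hyv)
      exact ⟨_, ⟨u, hu, rfl⟩, by rw [map_mul] at h'; exact h'⟩)
    (x := osMk k M x) ⟨x, hx, rfl⟩ (by rw [hω, ← map_mul, hxv])
  refine ⟨u, hu, ?_⟩
  rw [h', hω, map_mul]
  rfl

end OSAlgebra

/-! ### Contracting homotopies and the hyperplane of coordinate sum zero -/

section Homotopy

variable {k : Type*} [Field k]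

theorem bd_mul_ι {X : Type*} {f : X → k} {q : ℕ} {x : ExtAlg k X}
    (hx : x ∈ extDeg k univ (q + 1)) (v : X →₀ k) :
    bd f (x * ExteriorAlgebra.ι k v) = bd f x * ExteriorAlgebra.ι k v +
      ((-1 : k) ^ q * Finsupp.linearCombination k f v) • x := by
  induction v using Finsupp.induction_linear with
  | zero => simp
  | add a b ha hb =>
    rw [map_add, mul_add, map_add, ha, hb, map_add, mul_add, mul_add, add_smul]
    abel
  | single s c =>
    have : ExteriorAlgebra.ι k (Finsupp.single s c) = c • gen k s := by
      rw [gen, ← map_smul, Finsupp.smul_single, smul_eq_mul, mul_one]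
    rw [this, mul_smul_comm, map_smul, bd_mul_gen hx, smul_add, mul_smul_comm, smul_smul,
      Finsupp.linearCombination_single, smul_eq_mul, mul_left_comm]

theorem mul_ι_mem_extDeg {X : Type*} {q : ℕ} {x : ExtAlg k X}
    (hx : x ∈ extDeg k univ q) (v : X →₀ k) :
    x * ExteriorAlgebra.ι k v ∈ extDeg k univ (q + 1) := by
  induction v using Finsupp.induction_linear with
  | zero => simp
  | add a b ha hb => rw [map_add, mul_add]; exact add_mem ha hb
  | single s c =>
    have : ExteriorAlgebra.ι k (Finsupp.single s c) = c • gen k s := by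
      rw [gen, ← map_smul, Finsupp.smul_single, smul_eq_mul, mul_one]
    rw [this, mul_smul_comm]
    exact Submodule.smul_mem _ _ (mul_gen_mem_extDeg (mem_univ s) hx)

theorem gen_mul_mul_gen {X : Type*} (t : X) (y : ExtAlg k X) : gen k t * (y * gen k t) = 0 := by
  change y ∈ LinearMap.ker (LinearMap.mulLeft k (gen k t) ∘ₗ LinearMap.mulRight k (gen k t))
  refine exterior_induction (fun l => ?_) y
  change gen k t * (mon k l * gen k t) = 0
  rw [mon_mul_gen, mul_smul_comm, gen_mul_gen_mul_self, smul_zero]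

theorem extHom_mem_extDeg {X Y : Type*} {h : X → (Y →₀ k)} {j : X → Y}
    (hj : ∀ s, h s = Finsupp.single (j s) 1) {q : ℕ} {x : ExtAlg k X}
    (hx : x ∈ extDeg k univ q) : extHom k h x ∈ extDeg k univ q := by
  suffices extDeg k univ q ≤ (extDeg k univ q).comap (extHom k h).toLinearMap from this hx
  refine extDeg_le fun l _ hl => ?_
  rw [Submodule.mem_comap, AlgHom.toLinearMap_apply, extHom_mon (j := j) fun s _ => hj s]
  exact Submodule.subset_span ⟨_, fun _ _ => mem_univ _, by simpa using hl, rfl⟩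

/-- As ∂_f(xv) = ∂_f(x)v ± f(v)x, the contraction divided by f(v) is, up to sign, a contracting
homotopy. -/
theorem osExact_of_bd {α : Type*} {M : Matroid α} {f : M.E → k}
    (hf : ∀ x, osMk k M x = 0 → osMk k M (bd f x) = 0) {v : VSpace k M}
    (hv : Finsupp.linearCombination k f v ≠ 0) (p : ℕ) : OSExact k M p v := by
  intro x hx hxv
  have h := hf _ hxv
  rw [bd_mul_ι hx, map_add, map_smul] at h
  set c := (-1 : k) ^ p * Finsupp.linearCombination k f v with hc
  have hc0 : c ≠ 0 := mul_ne_zero (pow_ne_zero _ (by simp)) hv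
  refine ⟨-(c⁻¹ • bd f x), neg_mem (Submodule.smul_mem _ _ (bd_mem_extDeg hx)), ?_⟩
  rw [neg_mul, smul_mul_assoc, map_neg, map_smul, eq_neg_of_add_eq_zero_left h, smul_neg, neg_neg,
    smul_smul, inv_mul_cancel₀ hc0, one_smul]

theorem resonance_subset_VBar {α : Type*} (M : Matroid α) (p : ℕ) :
    resonance k M p ⊆ VBar k M := by
  intro v hv
  rw [mem_resonance_iff] at hv
  by_contra h
  exact hv (osExact_of_bd (f := fun _ => 1) (fun x hx => osMk_bd_eq_zero k M hx) h p)

end Homotopy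

/-! ### The direct sum -/

section DirectSum

variable {k : Type*} [Field k] {α : Type*} (M₁ M₂ : Matroid α)

variable (k) in
/-- The indicator function of the ground set of `M₁` in that of the sum. -/
def leftWt (s : (M₁.sum M₂).E) : k := Sum.elim (fun _ => 1) (fun _ => 0) s.1

variable (k) in
/-- The indicator function of the ground set of `M₂` in that of the sum. -/
def rightWt (s : (M₁.sum M₂).E) : k := Sum.elim (fun _ => 0) (fun _ => 1) s.1

/-- The inclusion of the ground set of `M₁` into that of the sum. -/
def inlE (s : M₁.E) : (M₁.sum M₂).E := ⟨Sum.inl s, by simp⟩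

/-- The inclusion of the ground set of `M₂` into that of the sum. -/
def inrE (s : M₂.E) : (M₁.sum M₂).E := ⟨Sum.inr s, by simp⟩

theorem sumE_cases (s : (M₁.sum M₂).E) : (∃ a, s = inlE M₁ M₂ a) ∨ ∃ b, s = inrE M₁ M₂ b := by
  obtain ⟨s | s, hs⟩ := s
  · exact Or.inl ⟨⟨s, by simpa using hs⟩, rfl⟩
  · exact Or.inr ⟨⟨s, by simpa using hs⟩, rfl⟩

@[simp] theorem leftWt_inlE (a : M₁.E) : leftWt k M₁ M₂ (inlE M₁ M₂ a) = 1 := rfl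
@[simp] theorem leftWt_inrE (b : M₂.E) : leftWt k M₁ M₂ (inrE M₁ M₂ b) = 0 := rfl
@[simp] theorem rightWt_inlE (a : M₁.E) : rightWt k M₁ M₂ (inlE M₁ M₂ a) = 0 := rfl
@[simp] theorem rightWt_inrE (b : M₂.E) : rightWt k M₁ M₂ (inrE M₁ M₂ b) = 1 := rfl

theorem leftWt_add_rightWt : leftWt k M₁ M₂ + rightWt k M₁ M₂ = fun _ => 1 := by
  ext s
  rcases sumE_cases M₁ M₂ s with ⟨a, rfl⟩ | ⟨b, rfl⟩ <;> simp

theorem sum_isCircuit_subset {C : Set (α ⊕ α)} (hC : (M₁.sum M₂).IsCircuit C) :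
    C ⊆ range Sum.inl ∨ C ⊆ range Sum.inr := by
  have h := hC.not_indep
  rw [Matroid.sum_indep_iff, not_and_or] at h
  rcases h with h | h
  · left
    have hd : (M₁.sum M₂).Dep (Sum.inl '' (Sum.inl ⁻¹' C)) := by
      refine ⟨fun hi => h ?_, (image_preimage_subset _ _).trans hC.subset_ground⟩
      rw [Matroid.sum_indep_iff, preimage_image_eq _ Sum.inl_injective] at hi
      exact hi.1
    rw [← hC.eq_of_dep_subset hd (image_preimage_subset _ _)]
    exact image_subset_range _ _
  · right
    have hd : (M₁.sum M₂).Dep (Sum.inr '' (Sum.inr ⁻¹' C)) := by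
      refine ⟨fun hi => h ?_, (image_preimage_subset _ _).trans hC.subset_ground⟩
      rw [Matroid.sum_indep_iff, preimage_image_eq _ Sum.inr_injective] at hi
      exact hi.2
    rw [← hC.eq_of_dep_subset hd (image_preimage_subset _ _)]
    exact image_subset_range _ _

/-- A circuit C of the direct sum lies on one side, so this contraction sends e_C to ∂e_C or to 0.
-/
theorem osMk_bd_leftWt {x : ExtAlg k (M₁.sum M₂).E} (hx : osMk k (M₁.sum M₂) x = 0) :
    osMk k (M₁.sum M₂) (bd (leftWt k M₁ M₂) x) = 0 := by
  suffices hm : ∀ l : List (M₁.sum M₂).E,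
      ¬ (M₁.sum M₂).Indep ((fun s : (M₁.sum M₂).E => (s : α ⊕ α)) '' {s | s ∈ l}) →
      osMk k (M₁.sum M₂) (bd (leftWt k M₁ M₂) (mon k l)) = 0 by
    change x ∈ LinearMap.ker ((osMk k (M₁.sum M₂)).toLinearMap ∘ₗ bd (leftWt k M₁ M₂))
    refine osMk_induction k _ (fun l hl => ⟨hm l hl, ?_⟩) hx
    change osMk k (M₁.sum M₂) (bd (leftWt k M₁ M₂) (bd _ (mon k l))) = 0
    rw [bd_comm, map_neg, osMk_bd_eq_zero k _ (hm l hl), neg_zero]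
  intro l hl
  obtain ⟨m, hm, hml, hC⟩ := exists_circuit_list hl
  obtain ⟨r, hr⟩ := exists_perm_append hm hml
  obtain ⟨h1, h2⟩ := osMk_mon_of_isCircuit k hm hC
  have h3 : osMk k (M₁.sum M₂) (bd (leftWt k M₁ M₂) (mon k m)) = 0 := by
    rcases sum_isCircuit_subset M₁ M₂ hC with h | h
    · rw [bd_mon_congr (g := fun _ => 1), h1]
      intro s hs
      obtain ⟨a, ha⟩ := h ⟨s, hs, rfl⟩
      simp only at ha
      rw [leftWt, ← ha, Sum.elim_inl]
    · rw [bd_mon_eq_zero, map_zero]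
      intro s hs
      obtain ⟨a, ha⟩ := h ⟨s, hs, rfl⟩
      simp only at ha
      rw [leftWt, ← ha, Sum.elim_inr]
  have h4 : osMk k (M₁.sum M₂) (bd (leftWt k M₁ M₂) (mon k (m ++ r))) = 0 := by
    rw [mon_append, bd_mon_mul, map_add, map_mul, h3, zero_mul, map_smul, map_mul, h2, zero_mul,
      smul_zero, add_zero]
  rcases mon_perm k hr with h | h <;> rw [h]
  · exact h4
  · rw [map_neg, map_neg, h4, neg_zero]

theorem osMk_bd_rightWt {x : ExtAlg k (M₁.sum M₂).E} (hx : osMk k (M₁.sum M₂) x = 0) :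
    osMk k (M₁.sum M₂) (bd (rightWt k M₁ M₂) x) = 0 := by
  have h := bd_add (f := leftWt k M₁ M₂) (g := rightWt k M₁ M₂) x
  rw [leftWt_add_rightWt] at h
  have h1 := osMk_bd_eq_zero k _ hx
  rwa [h, map_add, osMk_bd_leftWt M₁ M₂ hx, zero_add] at h1

theorem mem_VBarSum_iff (v : VSpace k (M₁.sum M₂)) : v ∈ VBarSum k M₁ M₂ ↔
    Finsupp.linearCombination k (leftWt k M₁ M₂) v = 0 ∧
      Finsupp.linearCombination k (rightWt k M₁ M₂) v = 0 := by
  constructor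
  · intro hv
    obtain ⟨_, ⟨a, ha, rfl⟩, _, ⟨b, hb, rfl⟩, rfl⟩ := Submodule.mem_sup.1 hv
    have ha' : Finsupp.linearCombination k (fun _ : M₁.E => (1 : k)) a = 0 := ha
    have hb' : Finsupp.linearCombination k (fun _ : M₂.E => (1 : k)) b = 0 := hb
    have e1 : ∀ a : M₁.E →₀ k, Finsupp.linearCombination k (fun _ : M₁.E => (0 : k)) a = 0 := by
      intro a; simp [Finsupp.linearCombination_apply]
    have e2 : ∀ a : M₂.E →₀ k, Finsupp.linearCombination k (fun _ : M₂.E => (0 : k)) a = 0 := by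
      intro a; simp [Finsupp.linearCombination_apply]
    constructor <;>
      rw [map_add, Finsupp.lmapDomain_apply, Finsupp.lmapDomain_apply,
        Finsupp.linearCombination_mapDomain, Finsupp.linearCombination_mapDomain]
    · exact (congrArg₂ (· + ·) ha' (e2 b)).trans (add_zero 0)
    · exact (congrArg₂ (· + ·) (e1 a) hb').trans (add_zero 0)
  · rintro ⟨h1, h2⟩
    classical
    let g : (M₁.sum M₂).E → (M₁.E →₀ k) := fun s =>
      if h : ∃ a, s = inlE M₁ M₂ a then Finsupp.single h.choose 1 else 0
    let g' : (M₁.sum M₂).E → (M₂.E →₀ k) := fun s =>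
      if h : ∃ a, s = inrE M₁ M₂ a then Finsupp.single h.choose 1 else 0
    have hgl : ∀ a, g (inlE M₁ M₂ a) = Finsupp.single a 1 := fun a => by
      have h : ∃ b, inlE M₁ M₂ a = inlE M₁ M₂ b := ⟨a, rfl⟩
      have h' : a = h.choose := by
        have := congrArg Subtype.val h.choose_spec
        exact Subtype.ext (Sum.inl_injective this)
      simp only [g, dif_pos h, ← h']
    have hgr : ∀ b, g (inrE M₁ M₂ b) = 0 := fun b => dif_neg (by
      rintro ⟨a, h⟩
      exact absurd (congrArg Subtype.val h) (by simp [inlE, inrE]))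
    have hgl' : ∀ b, g' (inlE M₁ M₂ b) = 0 := fun b => dif_neg (by
      rintro ⟨a, h⟩
      exact absurd (congrArg Subtype.val h) (by simp [inlE, inrE]))
    have hgr' : ∀ a, g' (inrE M₁ M₂ a) = Finsupp.single a 1 := fun a => by
      have h : ∃ b, inrE M₁ M₂ a = inrE M₁ M₂ b := ⟨a, rfl⟩
      have h' : a = h.choose := by
        have := congrArg Subtype.val h.choose_spec
        exact Subtype.ext (Sum.inr_injective this)
      simp only [g', dif_pos h, ← h']
    have key : (Finsupp.lmapDomain k k (inlE M₁ M₂) ∘ₗ Finsupp.linearCombination k g +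
        Finsupp.lmapDomain k k (inrE M₁ M₂) ∘ₗ Finsupp.linearCombination k g') = LinearMap.id := by
      refine Finsupp.lhom_ext fun s c => ?_
      rcases sumE_cases M₁ M₂ s with ⟨a, rfl⟩ | ⟨b, rfl⟩
      · simp [hgl, hgl', Finsupp.lmapDomain_apply, Finsupp.mapDomain_single]
      · simp [hgr, hgr', Finsupp.lmapDomain_apply, Finsupp.mapDomain_single]
    have k1 : coordSum k M₁ ∘ₗ Finsupp.linearCombination k g =
        Finsupp.linearCombination k (leftWt k M₁ M₂) := by
      refine Finsupp.lhom_ext fun s c => ?_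
      rcases sumE_cases M₁ M₂ s with ⟨a, rfl⟩ | ⟨b, rfl⟩
      · simp [hgl, coordSum]
      · simp [hgr]
    have k2 : coordSum k M₂ ∘ₗ Finsupp.linearCombination k g' =
        Finsupp.linearCombination k (rightWt k M₁ M₂) := by
      refine Finsupp.lhom_ext fun s c => ?_
      rcases sumE_cases M₁ M₂ s with ⟨a, rfl⟩ | ⟨b, rfl⟩
      · simp [hgl']
      · simp [hgr', coordSum]
    rw [← LinearMap.id_apply (R := k) v, ← key]
    refine Submodule.add_mem_sup ⟨Finsupp.linearCombination k g v, ?_, rfl⟩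
      ⟨Finsupp.linearCombination k g' v, ?_, rfl⟩
    · change (coordSum k M₁ ∘ₗ Finsupp.linearCombination k g) v = 0
      rw [k1, h1]
    · change (coordSum k M₂ ∘ₗ Finsupp.linearCombination k g') v = 0
      rw [k2, h2]

theorem resonance_sum_subset (p : ℕ) :
    resonance k (M₁.sum M₂) p ⊆ VBarSum k M₁ M₂ := by
  intro v hv
  rw [mem_resonance_iff] at hv
  rw [SetLike.mem_coe, mem_VBarSum_iff]
  by_contra h
  rw [not_and_or] at h
  rcases h with h | h
  · exact hv (osExact_of_bd (fun x hx => osMk_bd_leftWt M₁ M₂ hx) h p)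
  · exact hv (osExact_of_bd (fun x hx => osMk_bd_rightWt M₁ M₂ hx) h p)

theorem eRank_sum : (M₁.sum M₂).eRank = M₁.eRank + M₂.eRank := by
  obtain ⟨B₁, h1⟩ := M₁.exists_isBase
  obtain ⟨B₂, h2⟩ := M₂.exists_isBase
  have hB : (M₁.sum M₂).IsBase (Sum.inl '' B₁ ∪ Sum.inr '' B₂) := by
    rw [Matroid.sum_isBase_iff]
    simpa [preimage_image_eq _ Sum.inl_injective, preimage_image_eq _ Sum.inr_injective]
      using ⟨h1, h2⟩
  rw [← hB.encard_eq_eRank, ← h1.encard_eq_eRank, ← h2.encard_eq_eRank, encard_union_eq,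
    Sum.inl_injective.encard_image, Sum.inr_injective.encard_image]
  rw [disjoint_left]
  rintro _ ⟨a, -, rfl⟩ ⟨b, -, h⟩
  exact absurd h (by simp)

variable {M₁} in
theorem isLoop_sum {i : α} (h : M₁.IsLoop i) : (M₁.sum M₂).IsLoop (Sum.inl i) := by
  rw [← Matroid.singleton_not_indep (by simpa using h.mem_ground), Matroid.sum_indep_iff,
    ← image_singleton, preimage_image_eq _ Sum.inl_injective]
  exact fun h' => (Matroid.singleton_not_indep h.mem_ground).2 h h'.1

end DirectSum

/-! ### The parallel connection -/

section ParallelConnection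

variable {k : Type*} [Field k] {α : Type*} {M₁ M₂ : Matroid α} {i : α}

theorem mem_ground_left (hE : M₁.E ∩ M₂.E = {i}) : i ∈ M₁.E :=
  (show i ∈ M₁.E ∩ M₂.E by rw [hE]; rfl).1

theorem mem_ground_right (hE : M₁.E ∩ M₂.E = {i}) : i ∈ M₂.E :=
  (show i ∈ M₁.E ∩ M₂.E by rw [hE]; rfl).2

/-- The copy of `i` in the ground set of `M₁`. -/
def leftPt (hE : M₁.E ∩ M₂.E = {i}) : (M₁.sum M₂).E := inlE M₁ M₂ ⟨i, mem_ground_left hE⟩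

/-- The copy of `i` in the ground set of `M₂`. -/
def rightPt (hE : M₁.E ∩ M₂.E = {i}) : (M₁.sum M₂).E := inrE M₁ M₂ ⟨i, mem_ground_right hE⟩

variable (k) in
/-- The difference of the two copies of `e_i`. -/
noncomputable def ptDiff (hE : M₁.E ∩ M₂.E = {i}) : ExtAlg k (M₁.sum M₂).E :=
  gen k (leftPt hE) - gen k (rightPt hE)

theorem gen_mul_ptDiff_mul (hE : M₁.E ∩ M₂.E = {i}) (x : ExtAlg k (M₁.sum M₂).E) (s : (M₁.sum M₂).E) :
    ptDiff k hE * (gen k s * x) = - (gen k s * (ptDiff k hE * x)) := by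
  simp only [ptDiff, sub_mul, mul_sub, ← mul_assoc]
  rw [gen_mul_gen k (leftPt hE) s, gen_mul_gen k (rightPt hE) s]
  simp only [neg_mul]
  abel

theorem ptDiff_mul_gen_rightPt (hE : M₁.E ∩ M₂.E = {i}) :
    ptDiff k hE * gen k (rightPt hE) = ptDiff k hE * gen k (leftPt hE) := by
  rw [ptDiff, sub_mul, sub_mul, gen_mul_self, gen_mul_self, gen_mul_gen k (rightPt hE)]
  abel

theorem bd_one_ptDiff_mul (hE : M₁.E ∩ M₂.E = {i}) (x : ExtAlg k (M₁.sum M₂).E) :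
    bd (fun _ => 1) (ptDiff k hE * x) = -(ptDiff k hE * bd (fun _ => 1) x) := by
  rw [ptDiff, sub_mul, map_sub, bd_gen_mul, bd_gen_mul, sub_mul]
  abel

theorem bd_leftWt_ptDiff_mul (hE : M₁.E ∩ M₂.E = {i}) (x : ExtAlg k (M₁.sum M₂).E) :
    bd (leftWt k M₁ M₂) (ptDiff k hE * x) = x - ptDiff k hE * bd (leftWt k M₁ M₂) x := by
  rw [ptDiff, sub_mul, map_sub, bd_gen_mul, bd_gen_mul, sub_mul, leftPt, rightPt, leftWt_inlE,
    leftWt_inrE, one_smul, zero_smul]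
  abel

/-- The left contraction takes the value 1 on d, so it is a homotopy showing that the kernel of
multiplication by d is its image. -/
theorem osMk_eq_ptDiff_mul (hE : M₁.E ∩ M₂.E = {i}) {x : ExtAlg k (M₁.sum M₂).E}
    (hx : osMk k (M₁.sum M₂) (ptDiff k hE * x) = 0) :
    osMk k (M₁.sum M₂) x = osMk k (M₁.sum M₂) (ptDiff k hE * bd (leftWt k M₁ M₂) x) := by
  have h := osMk_bd_leftWt M₁ M₂ hx
  rwa [bd_leftWt_ptDiff_mul, map_sub, sub_eq_zero] at h

theorem ptDiff_mul_mem_extDeg (hE : M₁.E ∩ M₂.E = {i}) {q : ℕ} {x : ExtAlg k (M₁.sum M₂).E}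
    (hx : x ∈ extDeg k univ q) : ptDiff k hE * x ∈ extDeg k univ (q + 1) := by
  rw [ptDiff, sub_mul]
  exact sub_mem (gen_mul_mem_extDeg (mem_univ _) hx) (gen_mul_mem_extDeg (mem_univ _) hx)

theorem sum_isCircuit_inl {C : Set α} (hC : M₁.IsCircuit C) :
    (M₁.sum M₂).IsCircuit (Sum.inl '' C) := by
  rw [Matroid.isCircuit_iff_dep_forall_sdiff_singleton_indep]
  refine ⟨⟨fun h => hC.not_indep ?_, ?_⟩, ?_⟩
  · rw [Matroid.sum_indep_iff, preimage_image_eq _ Sum.inl_injective] at h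
    exact h.1
  · rintro _ ⟨a, ha, rfl⟩
    simpa using hC.subset_ground ha
  · rintro _ ⟨a, ha, rfl⟩
    rw [Matroid.sum_indep_iff, ← image_singleton, ← image_sdiff Sum.inl_injective,
      preimage_image_eq _ Sum.inl_injective]
    exact ⟨hC.sdiff_singleton_indep ha, by simp⟩

theorem sum_isCircuit_inr {C : Set α} (hC : M₂.IsCircuit C) :
    (M₁.sum M₂).IsCircuit (Sum.inr '' C) := by
  rw [Matroid.isCircuit_iff_dep_forall_sdiff_singleton_indep]
  refine ⟨⟨fun h => hC.not_indep ?_, ?_⟩, ?_⟩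
  · rw [Matroid.sum_indep_iff, preimage_image_eq _ Sum.inr_injective] at h
    exact h.2
  · rintro _ ⟨a, ha, rfl⟩
    simpa using hC.subset_ground ha
  · rintro _ ⟨a, ha, rfl⟩
    rw [Matroid.sum_indep_iff, ← image_singleton, ← image_sdiff Sum.inr_injective,
      preimage_image_eq _ Sum.inr_injective]
    exact ⟨by simp, hC.sdiff_singleton_indep ha⟩

theorem osMk_mon_of_cons {M : Matroid α} {s : M.E} {l : List M.E} (hl : (s :: l).Nodup)
    (hC : M.IsCircuit ((fun s : M.E => (s : α)) '' {t | t ∈ s :: l})) :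
    osMk k M (mon k l) = osMk k M (gen k s * bd (fun _ => 1) (mon k l)) := by
  have h := (osMk_mon_of_isCircuit k hl hC).1
  rwa [mon_cons, bd_gen_mul, one_smul, map_sub, sub_eq_zero] at h

/-- The case of a circuit of the parallel connection that mixes both sides. Its two halves are
multiples of e_i and of e_{i'}, and d e_i e_{i'} = 0. -/
theorem osMk_ptDiff_mul_mon_mul_mon (hE : M₁.E ∩ M₂.E = {i}) {l m : List (M₁.sum M₂).E}
    (hl : osMk k (M₁.sum M₂) (mon k l) =
      osMk k (M₁.sum M₂) (gen k (leftPt hE) * bd (fun _ => 1) (mon k l)))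
    (hm : osMk k (M₁.sum M₂) (mon k m) =
      osMk k (M₁.sum M₂) (gen k (rightPt hE) * bd (fun _ => 1) (mon k m))) :
    osMk k (M₁.sum M₂) (ptDiff k hE * mon k (l ++ m)) = 0 := by
  have h : ptDiff k hE * ((gen k (leftPt hE) * bd (fun _ => 1) (mon k l)) *
      (gen k (rightPt hE) * bd (fun _ => 1) (mon k m))) = 0 := by
    have h1 : ptDiff k hE * gen k (leftPt hE) = -(gen k (rightPt hE) * gen k (leftPt hE)) := by
      rw [ptDiff, sub_mul, gen_mul_self, zero_sub]
    rw [← mul_assoc, ← mul_assoc, ← mul_assoc, h1, neg_mul, neg_mul, mul_assoc (gen k (rightPt hE)), mul_assoc,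
      gen_mul_mul_gen, neg_zero, zero_mul]
  rw [mon_append, map_mul, map_mul, hl, hm, ← map_mul, ← map_mul, h, map_zero]

variable [M₁.Finite] [M₂.Finite] (hE : M₁.E ∩ M₂.E = {i}) (hr : M₁ ↾ {i} = M₂ ↾ {i})

instance : (parallelConnection M₁ M₂ i hE hr).Finite :=
  ⟨M₁.ground_finite.union M₂.ground_finite⟩

instance : Finite (M₁.sum M₂).E := by
  have : Finite M₁.E := M₁.ground_finite
  have : Finite M₂.E := M₂.ground_finite
  refine Finite.of_surjective (Sum.elim (inlE M₁ M₂) (inrE M₁ M₂)) fun s => ?_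
  rcases sumE_cases M₁ M₂ s with ⟨a, rfl⟩ | ⟨b, rfl⟩
  exacts [⟨Sum.inl a, rfl⟩, ⟨Sum.inr b, rfl⟩]

open Classical in
/-- A section of the map of ground sets which identifies the two copies of `i`. -/
noncomputable def pcSec (s : (parallelConnection M₁ M₂ i hE hr).E) : (M₁.sum M₂).E :=
  if h : (s : α) ∈ M₁.E then inlE M₁ M₂ ⟨s, h⟩ else inrE M₁ M₂ ⟨s, s.2.resolve_left h⟩

theorem pcIdent_pcSec (s : (parallelConnection M₁ M₂ i hE hr).E) :
    pcIdent M₁ M₂ i hE hr (pcSec hE hr s) = s := by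
  unfold pcSec
  split_ifs with h <;> rfl

theorem pcIdent_leftPt_eq :
    pcIdent M₁ M₂ i hE hr (leftPt hE) = pcIdent M₁ M₂ i hE hr (rightPt hE) := rfl

theorem pcIdent_eq {s t : (M₁.sum M₂).E} (h : pcIdent M₁ M₂ i hE hr s = pcIdent M₁ M₂ i hE hr t) :
    s = t ∨ (s = leftPt hE ∧ t = rightPt hE) ∨ (s = rightPt hE ∧ t = leftPt hE) := by
  have h' := congrArg Subtype.val h
  have hx : ∀ x, x ∈ M₁.E → x ∈ M₂.E → x = i := fun x h1 h2 => by
    have : x ∈ M₁.E ∩ M₂.E := ⟨h1, h2⟩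
    rwa [hE] at this
  rcases sumE_cases M₁ M₂ s with ⟨⟨a, ha⟩, rfl⟩ | ⟨⟨a, ha⟩, rfl⟩ <;>
  rcases sumE_cases M₁ M₂ t with ⟨⟨b, hb⟩, rfl⟩ | ⟨⟨b, hb⟩, rfl⟩ <;>
  obtain rfl : a = b := h'
  · exact Or.inl rfl
  · obtain rfl := hx a ha hb
    exact Or.inr (Or.inl ⟨rfl, rfl⟩)
  · obtain rfl := hx a hb ha
    exact Or.inr (Or.inr ⟨rfl, rfl⟩)
  · exact Or.inl rfl

theorem pcSec_pcIdent (s : (M₁.sum M₂).E) :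
    pcSec hE hr (pcIdent M₁ M₂ i hE hr s) = s ∨
      (s = rightPt hE ∧ pcSec hE hr (pcIdent M₁ M₂ i hE hr s) = leftPt hE) := by
  rcases pcIdent_eq hE hr (pcIdent_pcSec hE hr (pcIdent M₁ M₂ i hE hr s)) with h | h | ⟨h, rfl⟩
  · exact Or.inl h
  · exact Or.inr h.symm
  · left
    unfold pcSec
    rw [dif_pos (show ((pcIdent M₁ M₂ i hE hr (leftPt hE)) : α) ∈ M₁.E from mem_ground_left hE)]
    rfl

variable (k) in
/-- The map of exterior algebras which identifies the two copies of `e_i`. -/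
noncomputable def pcExt : ExtAlg k (M₁.sum M₂).E →ₐ[k]
    ExtAlg k (parallelConnection M₁ M₂ i hE hr).E :=
  extHom k fun s => Finsupp.single (pcIdent M₁ M₂ i hE hr s) 1

variable (k) in
/-- A section of `pcExt`. -/
noncomputable def pcLift : ExtAlg k (parallelConnection M₁ M₂ i hE hr).E →ₐ[k]
    ExtAlg k (M₁.sum M₂).E :=
  extHom k fun s => Finsupp.single (pcSec hE hr s) 1

theorem pcExt_mon (l : List (M₁.sum M₂).E) :
    pcExt k hE hr (mon k l) = mon k (l.map (pcIdent M₁ M₂ i hE hr)) := extHom_mon fun _ _ => rfl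

theorem pcLift_mon (l : List (parallelConnection M₁ M₂ i hE hr).E) :
    pcLift k hE hr (mon k l) = mon k (l.map (pcSec hE hr)) := extHom_mon fun _ _ => rfl

theorem pcExt_pcLift (x : ExtAlg k (parallelConnection M₁ M₂ i hE hr).E) :
    pcExt k hE hr (pcLift k hE hr x) = x := by
  suffices x ∈ LinearMap.eqLocus ((pcExt k hE hr).toLinearMap ∘ₗ (pcLift k hE hr).toLinearMap)
    LinearMap.id from this
  refine exterior_induction (fun l => ?_) x
  change pcExt k hE hr (pcLift k hE hr (mon k l)) = mon k l
  rw [pcLift_mon, pcExt_mon, List.map_map, List.map_congr_left (g := id), List.map_id]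
  exact fun s _ => pcIdent_pcSec hE hr s

theorem pcExt_ι (v : VSpace k (M₁.sum M₂)) : pcExt k hE hr (ExteriorAlgebra.ι k v) =
    ExteriorAlgebra.ι k (pcMap k M₁ M₂ i hE hr v) := by
  rw [pcExt, extHom, ExteriorAlgebra.map_apply_ι]
  congr 1
  induction v using Finsupp.induction_linear with
  | zero => simp
  | add a b ha hb => rw [map_add, map_add, ha, hb]
  | single s c => simp [pcMap, Finsupp.mapDomain_single]

theorem bd_one_pcExt (x : ExtAlg k (M₁.sum M₂).E) : bd (fun _ => 1) (pcExt k hE hr x) =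
    pcExt k hE hr (bd (fun _ => 1) x) := by
  rw [pcExt, bd_extHom]; simp

theorem bd_one_pcLift (x : ExtAlg k (parallelConnection M₁ M₂ i hE hr).E) :
    bd (fun _ => 1) (pcLift k hE hr x) = pcLift k hE hr (bd (fun _ => 1) x) := by
  rw [pcLift, bd_extHom]; simp

theorem pcExt_ptDiff : pcExt k hE hr (ptDiff k hE) = 0 := by
  rw [ptDiff, map_sub, pcExt, extHom_gen, extHom_gen, pcIdent_leftPt_eq, sub_self]

/-- Since d e_i = d e_{i'}, the choice of the copy of i is immaterial after multiplication by d. -/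
theorem ptDiff_mul_pcLift_pcExt (x : ExtAlg k (M₁.sum M₂).E) :
    ptDiff k hE * pcLift k hE hr (pcExt k hE hr x) = ptDiff k hE * x := by
  suffices x ∈ LinearMap.eqLocus (LinearMap.mulLeft k (ptDiff k hE) ∘ₗ
    (pcLift k hE hr).toLinearMap ∘ₗ (pcExt k hE hr).toLinearMap)
    (LinearMap.mulLeft k (ptDiff k hE)) from this
  refine exterior_induction (fun l => ?_) x
  change ptDiff k hE * pcLift k hE hr (pcExt k hE hr (mon k l)) = ptDiff k hE * mon k l
  rw [pcExt_mon, pcLift_mon]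
  induction l with
  | nil => rfl
  | cons s l ih =>
    rw [List.map_cons, List.map_cons, mon_cons, mon_cons, gen_mul_ptDiff_mul, ih,
      ← gen_mul_ptDiff_mul]
    rcases pcSec_pcIdent hE hr s with h | ⟨rfl, h⟩ <;> rw [h]
    rw [← mul_assoc, ← mul_assoc, ptDiff_mul_gen_rightPt]

theorem pc_indep_iff {I : Set α} :
    (parallelConnection M₁ M₂ i hE hr).Indep I ↔ PCIndep M₁ M₂ i I := Iff.rfl

theorem image_pcIdent_inter_left (A : Set (M₁.sum M₂).E) :
    Sum.inl ⁻¹' ((fun s : (M₁.sum M₂).E => (s : α ⊕ α)) '' A) ⊆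
      (fun s => (pcIdent M₁ M₂ i hE hr s : α)) '' A ∩ M₁.E := by
  rintro a ⟨s, hs, h⟩
  obtain ⟨s, hsE⟩ := s
  obtain rfl : s = Sum.inl a := h
  exact ⟨⟨_, hs, rfl⟩, by simpa using hsE⟩

theorem image_pcIdent_inter_right (A : Set (M₁.sum M₂).E) :
    Sum.inr ⁻¹' ((fun s : (M₁.sum M₂).E => (s : α ⊕ α)) '' A) ⊆
      (fun s => (pcIdent M₁ M₂ i hE hr s : α)) '' A ∩ M₂.E := by
  rintro a ⟨s, hs, h⟩
  obtain ⟨s, hsE⟩ := s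
  obtain rfl : s = Sum.inr a := h
  exact ⟨⟨_, hs, rfl⟩, by simpa using hsE⟩

theorem osMk_pcExt_eq_zero {x : ExtAlg k (M₁.sum M₂).E} (hx : osMk k (M₁.sum M₂) x = 0) :
    osMk k (parallelConnection M₁ M₂ i hE hr) (pcExt k hE hr x) = 0 := by
  change x ∈ LinearMap.ker ((osMk k (parallelConnection M₁ M₂ i hE hr)).toLinearMap ∘ₗ
    (pcExt k hE hr).toLinearMap)
  refine osMk_induction k _ (fun l hl => ?_) hx
  have h := osMk_mon_of_not_indep k (M := parallelConnection M₁ M₂ i hE hr)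
    (l := l.map (pcIdent M₁ M₂ i hE hr)) (by
      rw [pc_indep_iff]
      intro h
      refine hl ((Matroid.sum_indep_iff _ _).2 ⟨?_, ?_⟩)
      · refine h.left.subset ((image_pcIdent_inter_left hE hr _).trans
          (inter_subset_inter_left _ ?_))
        rintro _ ⟨s, hs, rfl⟩
        exact ⟨_, List.mem_map_of_mem hs, rfl⟩
      · refine h.right.subset ((image_pcIdent_inter_right hE hr _).trans
          (inter_subset_inter_left _ ?_))
        rintro _ ⟨s, hs, rfl⟩
        exact ⟨_, List.mem_map_of_mem hs, rfl⟩)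
  rw [← pcExt_mon, bd_one_pcExt] at h
  exact ⟨h.2, h.1⟩

theorem exists_list_ground (A : Set (M₁.sum M₂).E) :
    ∃ l : List (M₁.sum M₂).E, l.Nodup ∧ ∀ s, s ∈ l ↔ s ∈ A :=
  ⟨A.toFinite.toFinset.toList, Finset.nodup_toList _, by simp⟩

/-- Each circuit of the parallel connection lifts to a monomial annihilated by d. Avoiding one copy
of i keeps the image of the list free of repetitions. -/
theorem exists_list_of_isPCCircuit {C : Set α} (hC : IsPCCircuit M₁ M₂ i C) :
    ∃ l : List (M₁.sum M₂).E, l.Nodup ∧ (∀ s ∈ l, (pcIdent M₁ M₂ i hE hr s : α) ∈ C) ∧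
      ¬ (leftPt hE ∈ l ∧ rightPt hE ∈ l) ∧
      osMk k (M₁.sum M₂) (ptDiff k hE * mon k l) = 0 := by
  rcases hC with hC | hC | ⟨-, C₁, C₂, h1, h2, hi1, hi2, rfl⟩
  · obtain ⟨l, hl, hs⟩ := exists_list_ground (M₁ := M₁) (M₂ := M₂) {s | (s : α ⊕ α) ∈ Sum.inl '' C}
    refine ⟨l, hl, fun s h => ?_, fun h => ?_, ?_⟩
    · obtain ⟨a, ha, h⟩ := (hs s).1 h
      change Sum.elim id id s.1 ∈ C
      rwa [← h]
    · obtain ⟨a, -, h⟩ := (hs _).1 h.2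
      exact absurd h (by simp [rightPt, inrE])
    · rw [map_mul, (osMk_mon_of_isCircuit k hl _).2, mul_zero]
      convert sum_isCircuit_inl (M₂ := M₂) hC
      ext x
      constructor
      · rintro ⟨s, h, rfl⟩
        exact (hs s).1 h
      · rintro h
        exact ⟨⟨x, (sum_isCircuit_inl (M₂ := M₂) hC).subset_ground h⟩, (hs _).2 h, rfl⟩
  · obtain ⟨l, hl, hs⟩ := exists_list_ground (M₁ := M₁) (M₂ := M₂) {s | (s : α ⊕ α) ∈ Sum.inr '' C}
    refine ⟨l, hl, fun s h => ?_, fun h => ?_, ?_⟩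
    · obtain ⟨a, ha, h⟩ := (hs s).1 h
      change Sum.elim id id s.1 ∈ C
      rwa [← h]
    · obtain ⟨a, -, h⟩ := (hs _).1 h.1
      exact absurd h (by simp [leftPt, inlE])
    · rw [map_mul, (osMk_mon_of_isCircuit k hl _).2, mul_zero]
      convert sum_isCircuit_inr (M₁ := M₁) hC
      ext x
      constructor
      · rintro ⟨s, h, rfl⟩
        exact (hs s).1 h
      · rintro h
        exact ⟨⟨x, (sum_isCircuit_inr (M₁ := M₁) hC).subset_ground h⟩, (hs _).2 h, rfl⟩
  · obtain ⟨l, hl, hs⟩ := exists_list_ground (M₁ := M₁) (M₂ := M₂)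
      {s | (s : α ⊕ α) ∈ Sum.inl '' (C₁ \ {i})}
    obtain ⟨m, hm, ht⟩ := exists_list_ground (M₁ := M₁) (M₂ := M₂)
      {s | (s : α ⊕ α) ∈ Sum.inr '' (C₂ \ {i})}
    have hll : leftPt hE ∉ l := fun h => by
      obtain ⟨a, ha, h⟩ := (hs _).1 h
      exact ha.2 (Sum.inl_injective h)
    have hlm : leftPt hE ∉ m := fun h => by
      obtain ⟨a, ha, h⟩ := (ht _).1 h
      exact absurd h (by simp [leftPt, inlE])
    have hmm : rightPt hE ∉ m := fun h => by
      obtain ⟨a, ha, h⟩ := (ht _).1 h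
      exact ha.2 (Sum.inr_injective h)
    refine ⟨l ++ m, List.nodup_append'.2 ⟨hl, hm, fun s h h' => ?_⟩, fun s h => ?_, fun h => ?_,
      osMk_ptDiff_mul_mon_mul_mon hE (osMk_mon_of_cons (List.nodup_cons.2 ⟨hll, hl⟩) ?_)
        (osMk_mon_of_cons (List.nodup_cons.2 ⟨hmm, hm⟩) ?_)⟩
    · obtain ⟨a, -, e⟩ := (hs s).1 h
      obtain ⟨b, -, e'⟩ := (ht s).1 h'
      exact absurd (e.trans e'.symm) (by simp)
    · change Sum.elim id id s.1 ∈ _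
      rcases List.mem_append.1 h with h | h
      · obtain ⟨a, ha, h⟩ := (hs s).1 h
        rw [← h]
        exact Or.inl ha
      · obtain ⟨a, ha, h⟩ := (ht s).1 h
        rw [← h]
        exact Or.inr ha
    · exact (List.mem_append.1 h.1).elim hll hlm
    · convert sum_isCircuit_inl (M₂ := M₂) h1
      ext x
      constructor
      · rintro ⟨s, h, rfl⟩
        rcases List.mem_cons.1 h with rfl | h
        · exact ⟨i, hi1, rfl⟩
        · obtain ⟨a, ha, h⟩ := (hs s).1 h
          exact ⟨a, ha.1, h⟩
      · rintro ⟨a, ha, rfl⟩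
        refine ⟨inlE M₁ M₂ ⟨a, h1.subset_ground ha⟩, ?_, rfl⟩
        by_cases hai : a = i
        · subst hai
          exact List.mem_cons_self
        · exact List.mem_cons_of_mem _ ((hs _).2 ⟨a, ⟨ha, hai⟩, rfl⟩)
    · convert sum_isCircuit_inr (M₁ := M₁) h2
      ext x
      constructor
      · rintro ⟨s, h, rfl⟩
        rcases List.mem_cons.1 h with rfl | h
        · exact ⟨i, hi2, rfl⟩
        · obtain ⟨a, ha, h⟩ := (ht s).1 h
          exact ⟨a, ha.1, h⟩
      · rintro ⟨a, ha, rfl⟩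
        refine ⟨inrE M₁ M₂ ⟨a, h2.subset_ground ha⟩, ?_, rfl⟩
        by_cases hai : a = i
        · subst hai
          exact List.mem_cons_self
        · exact List.mem_cons_of_mem _ ((ht _).2 ⟨a, ⟨ha, hai⟩, rfl⟩)

/-- Multiplication by d descends to a map from the algebra of the parallel connection to that of the
direct sum. Only dependent monomials need a check: ∂d = 0 makes ∂ anticommute with d, which takes
care of their boundaries. -/
theorem osMk_ptDiff_mul_pcLift {z : ExtAlg k (parallelConnection M₁ M₂ i hE hr).E}
    (hz : osMk k (parallelConnection M₁ M₂ i hE hr) z = 0) :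
    osMk k (M₁.sum M₂) (ptDiff k hE * pcLift k hE hr z) = 0 := by
  suffices hm : ∀ l : List (parallelConnection M₁ M₂ i hE hr).E,
      ¬ (parallelConnection M₁ M₂ i hE hr).Indep
        ((fun s : (parallelConnection M₁ M₂ i hE hr).E => (s : α)) '' {s | s ∈ l}) →
      osMk k (M₁.sum M₂) (ptDiff k hE * pcLift k hE hr (mon k l)) = 0 by
    change z ∈ LinearMap.ker ((osMk k (M₁.sum M₂)).toLinearMap ∘ₗ
      LinearMap.mulLeft k (ptDiff k hE) ∘ₗ (pcLift k hE hr).toLinearMap)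
    refine osMk_induction k _ (fun l hl => ⟨hm l hl, ?_⟩) hz
    change osMk k (M₁.sum M₂) (ptDiff k hE * pcLift k hE hr (bd (fun _ => 1) (mon k l))) = 0
    have h := osMk_bd_eq_zero k _ (hm l hl)
    rwa [bd_one_ptDiff_mul, map_neg, neg_eq_zero, bd_one_pcLift] at h
  intro l hl
  have hC : ∃ C, IsPCCircuit M₁ M₂ i C ∧
      C ⊆ (fun s : (parallelConnection M₁ M₂ i hE hr).E => (s : α)) '' {s | s ∈ l} := by
    by_contra! hc
    refine hl ⟨?_, hc⟩
    rintro _ ⟨s, -, rfl⟩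
    exact s.2
  obtain ⟨C, hC, hCl⟩ := hC
  obtain ⟨m, hm, hmC, hp, h0⟩ := exists_list_of_isPCCircuit (k := k) hE hr hC
  have hm' : (m.map (pcIdent M₁ M₂ i hE hr)).Nodup := by
    refine hm.map_on fun s hs t ht h => ?_
    rcases pcIdent_eq hE hr h with h | ⟨rfl, rfl⟩ | ⟨rfl, rfl⟩
    · exact h
    · exact absurd ⟨hs, ht⟩ hp
    · exact absurd ⟨ht, hs⟩ hp
  have hsub : m.map (pcIdent M₁ M₂ i hE hr) ⊆ l := by
    intro t ht
    obtain ⟨s, hs, rfl⟩ := List.mem_map.1 ht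
    obtain ⟨t, ht, h⟩ := hCl (hmC s hs)
    rwa [← Subtype.ext h]
  obtain ⟨r, hr'⟩ := exists_perm_append hm' hsub
  have h1 : osMk k (M₁.sum M₂) (ptDiff k hE * pcLift k hE hr
      (mon k (m.map (pcIdent M₁ M₂ i hE hr) ++ r))) = 0 := by
    rw [mon_append, map_mul (pcLift k hE hr), ← mul_assoc, ← pcExt_mon, ptDiff_mul_pcLift_pcExt, map_mul, h0,
      zero_mul]
  rcases mon_perm k hr' with h | h <;> rw [h]
  · exact h1
  · rw [map_neg, mul_neg, map_neg, h1, neg_zero]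

theorem osMk_ptDiff_mul_of_osMk_pcExt {x : ExtAlg k (M₁.sum M₂).E}
    (hx : osMk k (parallelConnection M₁ M₂ i hE hr) (pcExt k hE hr x) = 0) :
    osMk k (M₁.sum M₂) (ptDiff k hE * x) = 0 := by
  rw [← ptDiff_mul_pcLift_pcExt hE hr]
  exact osMk_ptDiff_mul_pcLift hE hr hx

end ParallelConnection

/-! ### Comparison of the cohomology of the direct sum and of the parallel connection -/

section Comparison

variable {k : Type*} [Field k] {α : Type*} {M₁ M₂ : Matroid α} {i : α}
  [M₁.Finite] [M₂.Finite] (hE : M₁.E ∩ M₂.E = {i}) (hr : M₁ ↾ {i} = M₂ ↾ {i})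

theorem pcLift_mem_extDeg {q : ℕ} {x : ExtAlg k (parallelConnection M₁ M₂ i hE hr).E}
    (hx : x ∈ extDeg k univ q) : pcLift k hE hr x ∈ extDeg k univ q :=
  extHom_mem_extDeg (fun _ => rfl) hx

theorem pcExt_mem_extDeg {q : ℕ} {x : ExtAlg k (M₁.sum M₂).E}
    (hx : x ∈ extDeg k univ q) : pcExt k hE hr x ∈ extDeg k univ q :=
  extHom_mem_extDeg (fun _ => rfl) hx

/-- The splitting at work. For a lift x of a cocycle, ∂'(dx) is again a lift, since ∂'(dx) = x − d
∂'x, and it is a true cocycle because dxv = 0 and ∂' commutes with multiplication by v. -/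
theorem osExact_pcMap {p : ℕ} {v : VSpace k (M₁.sum M₂)}
    (hv : Finsupp.linearCombination k (leftWt k M₁ M₂) v = 0) (h : OSExact k (M₁.sum M₂) p v) :
    OSExact k (parallelConnection M₁ M₂ i hE hr) p (pcMap k M₁ M₂ i hE hr v) := by
  intro z hz hzv
  rw [← pcExt_pcLift hE hr z, ← pcExt_ι, ← map_mul] at hzv
  have hx := pcLift_mem_extDeg hE hr hz
  have h1 := osMk_bd_leftWt M₁ M₂ (osMk_ptDiff_mul_of_osMk_pcExt hE hr hzv)
  rw [← mul_assoc, bd_mul_ι (ptDiff_mul_mem_extDeg hE hx), hv, mul_zero, zero_smul, add_zero] at h1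
  obtain ⟨u, hu, h2⟩ := h _ (bd_mem_extDeg (ptDiff_mul_mem_extDeg hE hx)) h1
  refine ⟨pcExt k hE hr u, pcExt_mem_extDeg hE hr hu, ?_⟩
  rw [← sub_eq_zero, ← map_sub] at h2
  have h3 := osMk_pcExt_eq_zero hE hr h2
  rwa [map_sub, bd_leftWt_ptDiff_mul, map_sub (pcExt k hE hr), map_mul _ (ptDiff k hE),
    pcExt_ptDiff, zero_mul, sub_zero, pcExt_pcLift, map_mul, pcExt_ι, map_sub, sub_eq_zero] at h3

/-- The middle of the long exact sequence, by hand. Modulo a coboundary a cocycle x becomes dy; then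
y is a cocycle modulo d, hence a coboundary modulo d, and multiplication by d removes the ambiguity.
-/
theorem osExact_of_pcMap {p : ℕ} {v : VSpace k (M₁.sum M₂)}
    (h : OSExact k (parallelConnection M₁ M₂ i hE hr) p (pcMap k M₁ M₂ i hE hr v))
    (h' : ∀ q, q + 1 = p →
      OSExact k (parallelConnection M₁ M₂ i hE hr) q (pcMap k M₁ M₂ i hE hr v)) :
    OSExact k (M₁.sum M₂) p v := by
  have key : ∀ q, ∀ x ∈ extDeg k univ (q + 1),
      OSExact k (parallelConnection M₁ M₂ i hE hr) q (pcMap k M₁ M₂ i hE hr v) →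
      osMk k (parallelConnection M₁ M₂ i hE hr)
        (pcExt k hE hr (x * ExteriorAlgebra.ι k v)) = 0 →
      ∃ u ∈ extDeg k univ q, osMk k (M₁.sum M₂)
        (ptDiff k hE * (x - u * ExteriorAlgebra.ι k v)) = 0 := by
    intro q x hx hq hxv
    rw [map_mul, pcExt_ι] at hxv
    obtain ⟨u, hu, h1⟩ := hq _ (pcExt_mem_extDeg hE hr hx) hxv
    refine ⟨pcLift k hE hr u, pcLift_mem_extDeg hE hr hu, osMk_ptDiff_mul_of_osMk_pcExt hE hr ?_⟩
    rw [map_sub, map_mul, pcExt_pcLift, pcExt_ι, map_sub, h1, sub_self]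
  intro x hx hxv
  obtain ⟨u, hu, h1⟩ := key p x hx h (osMk_pcExt_eq_zero hE hr hxv)
  have h2 := osMk_eq_ptDiff_mul hE h1
  set y := bd (leftWt k M₁ M₂) (x - u * ExteriorAlgebra.ι k v) with hy
  have hyp : y ∈ extDeg k univ p := bd_mem_extDeg (sub_mem hx (mul_ι_mem_extDeg hu v))
  cases p with
  | zero =>
    refine ⟨u, hu, ?_⟩
    rwa [eq_zero_of_mem_extDeg_zero hyp, mul_zero, map_zero, map_sub, sub_eq_zero] at h2
  | succ p =>
    have h3 : osMk k (M₁.sum M₂) (ptDiff k hE * (y * ExteriorAlgebra.ι k v)) = 0 := by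
      rw [← mul_assoc, map_mul, ← h2, ← map_mul, sub_mul, mul_assoc, ExteriorAlgebra.ι_sq_zero,
        mul_zero, sub_zero, hxv]
    have h4 : osMk k (parallelConnection M₁ M₂ i hE hr)
        (pcExt k hE hr (y * ExteriorAlgebra.ι k v)) = 0 := by
      have h5 := osMk_eq_ptDiff_mul hE h3
      rw [← sub_eq_zero, ← map_sub] at h5
      have h6 := osMk_pcExt_eq_zero hE hr h5
      rwa [map_sub, map_mul _ (ptDiff k hE), pcExt_ptDiff, zero_mul, sub_zero] at h6
    obtain ⟨u', hu', h5⟩ := key p y hyp (h' p rfl) h4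
    refine ⟨u + ptDiff k hE * u', add_mem hu (ptDiff_mul_mem_extDeg hE hu'), ?_⟩
    rw [mul_sub, map_sub, sub_eq_zero, ← h2, map_sub, sub_eq_iff_eq_add] at h5
    rw [h5, add_mul, map_add, mul_assoc, add_comm]

theorem eRank_parallelConnection (h1 : M₁.IsNonloop i) (h2 : M₂.IsNonloop i) :
    (parallelConnection M₁ M₂ i hE hr).eRank + 1 = (M₁.sum M₂).eRank := by
  have hx : ∀ x, x ∈ M₁.E → x ∈ M₂.E → x = i := fun x h1 h2 => by
    have : x ∈ M₁.E ∩ M₂.E := ⟨h1, h2⟩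
    rwa [hE] at this
  rw [eRank_sum]
  refine le_antisymm ?_ ?_
  · obtain ⟨I, hI⟩ := (parallelConnection M₁ M₂ i hE hr).exists_isBase
    have hp : PCIndep M₁ M₂ i I := hI.indep
    rw [← hI.encard_eq_eRank]
    rcases hp.or_insert h1 h2 with h | h
    · rw [← pc_encard (by rwa [inter_comm]) hp.symm.1, add_comm]
      exact add_le_add h.encard_le_eRank hp.right.encard_le_eRank
    · rw [← pc_encard hE hp.1]
      exact add_le_add hp.left.encard_le_eRank h.encard_le_eRank
  · obtain ⟨B₁, hB₁, hi1⟩ := h1.indep.exists_isBase_superset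
    obtain ⟨B₂, hB₂, hi2⟩ := h2.indep.exists_isBase_superset
    rw [singleton_subset_iff] at hi1 hi2
    have e1 : (B₁ ∪ B₂) ∩ M₁.E = B₁ := by
      refine Subset.antisymm ?_ fun x hx => ⟨Or.inl hx, hB₁.subset_ground hx⟩
      rintro x ⟨h | h, hx1⟩
      · exact h
      · rwa [hx x hx1 (hB₂.subset_ground h)]
    have e2 : insert i ((B₁ ∪ B₂) ∩ M₂.E) = B₂ := by
      refine Subset.antisymm ?_ fun x hx => Or.inr ⟨Or.inr hx, hB₂.subset_ground hx⟩
      rintro x (rfl | ⟨h | h, hx1⟩)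
      · exact hi2
      · rwa [hx x (hB₁.subset_ground h) hx1]
      · exact h
    have hB : PCIndep M₁ M₂ i (B₁ ∪ B₂) :=
      pcIndep_of_left (union_subset_union hB₁.subset_ground hB₂.subset_ground)
        (by rw [e1]; exact hB₁.indep) (by rw [e2]; exact hB₂.indep)
    have h := pc_encard hE hB.1
    rw [e1, e2, hB₁.encard_eq_eRank, hB₂.encard_eq_eRank] at h
    rw [h]
    exact add_le_add_left ((pc_indep_iff hE hr).2 hB).encard_le_eRank 1

theorem isLoop_parallelConnection (h : M₁.IsLoop i) :
    (parallelConnection M₁ M₂ i hE hr).IsLoop i := by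
  rw [← Matroid.singleton_not_indep (Or.inl h.mem_ground)]
  intro h'
  have h1 := PCIndep.left h'
  rw [inter_eq_self_of_subset_left (singleton_subset_iff.2 h.mem_ground)] at h1
  exact (Matroid.singleton_not_indep h.mem_ground).2 h h1

theorem osExact_pcMap_iff {p : ℕ} (hp : (p : ℕ∞) ≠ (M₁.sum M₂).eRank)
    {v : VSpace k (M₁.sum M₂)} (hv : v ∈ VBarSum k M₁ M₂) : OSExact k (M₁.sum M₂) p v ↔
      OSExact k (parallelConnection M₁ M₂ i hE hr) p (pcMap k M₁ M₂ i hE hr v) := by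
  by_cases h1 : M₁.IsLoop i
  · exact iff_of_true (osExact_of_isLoop k _ (isLoop_sum M₂ h1) p v)
      (osExact_of_isLoop k _ (isLoop_parallelConnection hE hr h1) p _)
  · have h2 := mt (pc_isLoop_iff hE hr).2 h1
    rw [Matroid.not_isLoop_iff (mem_ground_left hE)] at h1
    rw [Matroid.not_isLoop_iff (mem_ground_right hE)] at h2
    refine ⟨osExact_pcMap hE hr ((mem_VBarSum_iff M₁ M₂ v).1 hv).1, fun h =>
      osExact_of_pcMap hE hr h ?_⟩
    rintro q rfl
    -- Up to the rank of the parallel connection, propagation provides the vanishing in degree q.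
    -- Beyond it, q is at least that rank, and equality is the excluded value of p; so degree q is
    -- zero.
    by_cases hq : ((q + 1 : ℕ) : ℕ∞) ≤ (parallelConnection M₁ M₂ i hE hr).eRank
    · exact osExact_of_osExact_succ k _ hq h
    · refine osExact_of_eRank_lt k _ (lt_of_le_of_ne ?_ fun h' => hp ?_) _
      · rw [not_le, Nat.cast_add, Nat.cast_one] at hq
        exact Order.lt_add_one_iff_of_not_isMax (by simp) |>.1 hq
      · rw [← eRank_parallelConnection hE hr h1 h2, h', Nat.cast_add, Nat.cast_one]

theorem linearCombination_pcMap (f : (parallelConnection M₁ M₂ i hE hr).E → k)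
    (v : VSpace k (M₁.sum M₂)) :
    Finsupp.linearCombination k f (pcMap k M₁ M₂ i hE hr v) =
      Finsupp.linearCombination k (fun s => f (pcIdent M₁ M₂ i hE hr s)) v := by
  rw [pcMap, Finsupp.lmapDomain_apply, Finsupp.linearCombination_mapDomain]
  rfl

theorem coordSum_pcMap (v : VSpace k (M₁.sum M₂)) :
    coordSum k (parallelConnection M₁ M₂ i hE hr) (pcMap k M₁ M₂ i hE hr v) =
      Finsupp.linearCombination k (leftWt k M₁ M₂) v +
        Finsupp.linearCombination k (rightWt k M₁ M₂) v := by
  have : Finsupp.linearCombination k (leftWt k M₁ M₂ + rightWt k M₁ M₂) =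
      Finsupp.linearCombination k (leftWt k M₁ M₂) +
        Finsupp.linearCombination k (rightWt k M₁ M₂) := by ext; simp
  rw [coordSum, linearCombination_pcMap, ← LinearMap.add_apply, ← this, leftWt_add_rightWt]

/-- The section chooses the left copy of i, so the round trip moves the coordinate of the right copy
to the left one. -/
theorem mapDomain_pcSec_pcMap (v : VSpace k (M₁.sum M₂)) :
    Finsupp.mapDomain (pcSec hE hr) (pcMap k M₁ M₂ i hE hr v) =
      v + v (rightPt hE) • (Finsupp.single (leftPt hE) 1 - Finsupp.single (rightPt hE) 1) := by
  induction v using Finsupp.induction_linear with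
  | zero => simp
  | add a b ha hb =>
    rw [map_add, Finsupp.mapDomain_add, ha, hb, Finsupp.add_apply, add_smul]
    abel
  | single s c =>
    rw [pcMap, Finsupp.lmapDomain_apply, Finsupp.mapDomain_single, Finsupp.mapDomain_single]
    by_cases hs : s = rightPt hE
    · subst hs
      rcases pcSec_pcIdent hE hr (rightPt hE) with h | ⟨-, h⟩
      · exfalso
        rw [← pcIdent_leftPt_eq] at h
        unfold pcSec at h
        rw [dif_pos (show (pcIdent M₁ M₂ i hE hr (leftPt hE) : α) ∈ M₁.E from
          mem_ground_left hE)] at h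
        exact absurd (congrArg Subtype.val h) (by simp [inlE, rightPt, inrE])
      · rw [h, Finsupp.single_eq_same, smul_sub, Finsupp.smul_single, Finsupp.smul_single,
          smul_eq_mul, mul_one]
        abel
    · rcases pcSec_pcIdent hE hr s with h | ⟨h, -⟩
      · rw [h, Finsupp.single_eq_of_ne (Ne.symm hs), zero_smul, add_zero]
      · exact absurd h hs

theorem bijOn_pcMap : BijOn (pcMap k M₁ M₂ i hE hr)
    (VBarSum k M₁ M₂) (VBar k (parallelConnection M₁ M₂ i hE hr)) := by
  refine ⟨fun v hv => ?_, fun v hv v' hv' h => ?_, fun z hz => ?_⟩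
  · change coordSum k _ _ = 0
    obtain ⟨h1, h2⟩ := (mem_VBarSum_iff M₁ M₂ v).1 hv
    rw [coordSum_pcMap, h1, h2, add_zero]
  · rw [← sub_eq_zero]
    rw [← sub_eq_zero, ← map_sub] at h
    have hw := ((mem_VBarSum_iff M₁ M₂ _).1 (sub_mem hv hv')).1
    have h1 := mapDomain_pcSec_pcMap hE hr (v - v')
    rw [h, Finsupp.mapDomain_zero, eq_comm] at h1
    -- The kernel of φ is spanned by the difference of the two copies of i, whose left coordinate
    -- sum is 1; on the subspace the multiple is therefore 0.
    have h2 := congrArg (Finsupp.linearCombination k (leftWt k M₁ M₂)) h1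
    rw [map_add, hw, map_smul, map_sub, Finsupp.linearCombination_single,
      Finsupp.linearCombination_single, leftPt, rightPt, leftWt_inlE, leftWt_inrE, map_zero,
      smul_zero, sub_zero, zero_add, smul_eq_mul, mul_eq_zero] at h2
    rw [rightPt, h2.resolve_right (by simp), zero_smul, add_zero] at h1
    exact h1
  · have hz' : coordSum k (parallelConnection M₁ M₂ i hE hr) z = 0 := hz
    -- A lift may be changed by multiples of the difference of the two copies. Taking c to be its
    -- left coordinate sum makes the left sum zero, and then the right one as well.
    have hu : ∀ c : k, pcMap k M₁ M₂ i hE hr (Finsupp.mapDomain (pcSec hE hr) z +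
        c • (Finsupp.single (rightPt hE) 1 - Finsupp.single (leftPt hE) 1)) = z := by
      intro c
      rw [map_add, map_smul, map_sub, pcMap, Finsupp.lmapDomain_apply, Finsupp.lmapDomain_apply,
        Finsupp.lmapDomain_apply, Finsupp.mapDomain_single, Finsupp.mapDomain_single,
        ← pcIdent_leftPt_eq, sub_self, smul_zero, add_zero, ← Finsupp.mapDomain_comp]
      rw [show pcIdent M₁ M₂ i hE hr ∘ pcSec hE hr = id from
        funext fun s => pcIdent_pcSec hE hr s, Finsupp.mapDomain_id]
    refine ⟨_, ?_, hu (Finsupp.linearCombination k (leftWt k M₁ M₂)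
      (Finsupp.mapDomain (pcSec hE hr) z))⟩
    rw [SetLike.mem_coe, mem_VBarSum_iff]
    have h1 := coordSum_pcMap hE hr (Finsupp.mapDomain (pcSec hE hr) z +
      Finsupp.linearCombination k (leftWt k M₁ M₂) (Finsupp.mapDomain (pcSec hE hr) z) •
        (Finsupp.single (rightPt hE) 1 - Finsupp.single (leftPt hE) 1))
    rw [hu, hz'] at h1
    have h2 : Finsupp.linearCombination k (leftWt k M₁ M₂) (Finsupp.mapDomain (pcSec hE hr) z +
        Finsupp.linearCombination k (leftWt k M₁ M₂) (Finsupp.mapDomain (pcSec hE hr) z) •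
          (Finsupp.single (rightPt hE) 1 - Finsupp.single (leftPt hE) 1)) = 0 := by
      rw [map_add, map_smul, map_sub, Finsupp.linearCombination_single,
        Finsupp.linearCombination_single, leftPt, rightPt, leftWt_inlE, leftWt_inrE]
      simp
    rw [h2, zero_add] at h1
    exact ⟨h2, h1.symm⟩

end Comparison

theorem mainTheorem10 (k : Type*) [Field k] {α : Type*} (M₁ M₂ : Matroid α)
    [M₁.Finite] [M₂.Finite] (i : α) (hE : M₁.E ∩ M₂.E = {i}) (hr : M₁ ↾ {i} = M₂ ↾ {i}) :
    BijOn (pcMap k M₁ M₂ i hE hr)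
      (VBarSum k M₁ M₂) (VBar k (parallelConnection M₁ M₂ i hE hr)) ∧
    ∀ p : ℕ,
      resonance k (M₁.sum M₂) p ⊆ VBarSum k M₁ M₂ ∧
      resonance k (parallelConnection M₁ M₂ i hE hr) p ⊆
        VBar k (parallelConnection M₁ M₂ i hE hr) ∧
      ((p : ℕ∞) ≠ (M₁.sum M₂).eRank →
        BijOn (pcMap k M₁ M₂ i hE hr)
          (resonance k (M₁.sum M₂) p)
          (resonance k (parallelConnection M₁ M₂ i hE hr) p)) := by
  have hb := bijOn_pcMap (k := k) hE hr
  refine ⟨hb, fun p => ⟨resonance_sum_subset M₁ M₂ p, resonance_subset_VBar _ p, fun hp => ?_⟩⟩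
  refine ⟨fun v hv => ?_, hb.injOn.mono (resonance_sum_subset M₁ M₂ p), fun z hz => ?_⟩
  · have hv' := resonance_sum_subset M₁ M₂ p hv
    rw [mem_resonance_iff] at hv ⊢
    exact fun h => hv ((osExact_pcMap_iff hE hr hp hv').2 h)
  · obtain ⟨v, hv, rfl⟩ := hb.surjOn (resonance_subset_VBar _ p hz)
    rw [mem_resonance_iff] at hz
    refine ⟨v, ?_, rfl⟩
    rw [mem_resonance_iff]
    exact fun h => hz ((osExact_pcMap_iff hE hr hp hv).1 h)
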